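/- **Theorem 2.1.** Let $d\ge 1$, let $\Omega\subset\mathbb{R}^d$ be a smooth bounded domain with outward unit normal $\nu$ on $\partial\Omega$, let $T>0$, $Q=\Omega\times(0,T)$, $\rho_0\in\mathbb{R}$ and $C_0>0$, and set $\varphi(t)=e^{\lambda t}$. Let $H^{2,1}(Q)$ be the space of all real-valued $w\in L^2(Q)$ whose weak derivatives $\partial_t w$, $\partial_i w$, $\partial_i\partial_j w$ $(1\le i,j\le d)$ belong to $L^2(Q)$. There exist constants $C,s_0,\lambda_0>0$, depending only on $d,\Omega,T,\rho_0,C_0$, with the following property. Let $Q_1,Q_2,S$ be operators, mapping functions (for $Q_2$, pairs of functions) in $H^{2,1}(Q)$ to measurable functions on $Q$, such that for all $w,y\in H^{2,1}(Q)$ and almost all $(x,t)\in Q$ $$|Q_1(w)(x,t)|\le C_0\,(|w(x,t)|+|\nabla w(x,t)|),$$ $$|Q_2(w,y)(x,t)|\le C_0\,(|w(x,t)|+|y(x,t)|+|\nabla w(x,t)|+|\nabla y(x,t)|),$$ and such that either $|S(y)(x,t)|\le C_0|y(x,t)|$ for all $y\in H^{2,1}(Q)$ and almost all $(x,t)\in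 Q$, or $\|S(y)(\cdot,t)\|_{L^2(\Omega)}\le C_0\|y(\cdot,t)\|_{L^2(\Omega)}$ for all $y\in H^{2,1}(Q)$ and almost all $t\in(0,T)$. Let $u,v\in H^{2,1}(Q)$ satisfy $$\partial_t u+\Delta u=Q_1(u)+S(v),\qquad \partial_t v-\Delta v=Q_2(u,v)+\rho_0\Delta u\qquad\text{a.e. in } Q,$$ and $\partial_\nu u=\partial_\nu v=0$ on $\partial\Omega\times(0,T)$ in the sense of traces. Then the traces $u(\cdot,0),u(\cdot,T),v(\cdot,0),v(\cdot,T)$ exist and belong to $H^1(\Omega)$, and for all $s\ge s_0$ and all $\lambda\ge\lambda_0$ $$\begin{aligned} &\int_Q\Big\{|\partial_tu|^2+|\Delta u|^2+s\lambda\varphi|\nabla u|^2+s^2\lambda^2\varphi^2|u|^2\\ &\qquad+\frac1{s\varphi}\big(|\partial_tv|^2+|\Delta v|^2\big)+\lambda|\nabla v|^2+s\lambda^2\varphi|v|^2\Big\}e^{2s\varphi}\,dx\,dt\\ &+\int_\Omega\big(s^2\lambda|u(x,0)|^2+s|\nabla u(x,0)|^2\big)e^{2s}\,dx +\int_\Omega\big(s\lambda|v(x,0)|^2e^{2s}+|\nabla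 v(x,T)|^2e^{2s\varphi(T)}\big)\,dx\\ \le{}&C\int_\Omega\big(s\lambda\varphi(T)|v(x,T)|^2e^{2s\varphi(T)}+|\nabla v(x,0)|^2e^{2s}\big)\,dx\\ &+C\int_\Omega\big(s\lambda^2\varphi(T)^2|u(x,T)|^2+s\varphi(T)|\nabla u(x,T)|^2\big)e^{2s\varphi(T)}\,dx. \end{aligned}$$ -/

import Mathlib

open MeasureTheory Set Filter Topology
open scoped ContDiff

noncomputable section

namespace MeanField

/-- Euclidean space `ℝᵈ`. -/
abbrev Space (d : ℕ) := EuclideanSpace ℝ (Fin d)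

/-- Space-time `ℝᵈ × ℝ`; a point is written `(x, t)`. -/
abbrev SpaceTime (d : ℕ) := Space d × ℝ

section Domain

variable {d : ℕ}

/-- `ρ` is a smooth defining function of the open set `Ω` near the boundary point `x`: close to `x`,
the set `Ω` is `{ρ < 0}`, and the gradient of `ρ` does not vanish at `x`. -/
def IsLocalDefiningFunction (Ω : Set (Space d)) (x : Space d) (ρ : Space d → ℝ) : Prop :=
  ContDiff ℝ ∞ ρ ∧ gradient ρ x ≠ 0 ∧ ∀ᶠ y in 𝓝 x, (y ∈ Ω ↔ ρ y < 0)

/-- A smooth bounded domain of `ℝᵈ`. -/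
structure IsSmoothBoundedDomain (Ω : Set (Space d)) : Prop where
  isOpen : IsOpen Ω
  isConnected : IsConnected Ω
  isBounded : Bornology.IsBounded Ω
  smooth_boundary : ∀ x ∈ frontier Ω, ∃ ρ, IsLocalDefiningFunction Ω x ρ

/-- `n` is the outward unit normal vector `ν(x)` to `∂Ω` at `x`. -/
def IsOutwardUnitNormal (Ω : Set (Space d)) (x n : Space d) : Prop :=
  ∃ ρ, IsLocalDefiningFunction Ω x ρ ∧ n = ‖gradient ρ x‖⁻¹ • gradient ρ x

/-- The space-time cylinder `Q = Ω × (0, T)`. -/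
def parCylinder (Ω : Set (Space d)) (T : ℝ) : Set (SpaceTime d) := Ω ×ˢ Ioo 0 T

/-- The `i`-th unit vector of `ℝᵈ`. -/
def unitVec (i : Fin d) : Space d := EuclideanSpace.single i 1

/-- The `i`-th spatial unit vector of `ℝᵈ × ℝ`. -/
def spaceDir (i : Fin d) : SpaceTime d := (unitVec i, 0)

/-- The unit vector of `ℝᵈ × ℝ` in the direction of time. -/
def timeDir : SpaceTime d := (0, 1)

end Domain

section WeakDerivative

variable {V : Type*} [NormedAddCommGroup V] [NormedSpace ℝ V] [MeasureSpace V]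

/-- `φ` belongs to `C_c^∞(D)`. -/
def IsTestFunction (D : Set V) (φ : V → ℝ) : Prop :=
  ContDiff ℝ ∞ φ ∧ HasCompactSupport φ ∧ tsupport φ ⊆ D

/-- `g` is the weak (distributional) derivative of `f` in the direction `e` in the open set `D`. -/
def HasWeakDeriv (D : Set V) (e : V) (f g : V → ℝ) : Prop :=
  ∀ φ : V → ℝ, IsTestFunction D φ →
    ∫ z in D, f z * fderiv ℝ φ z e = - ∫ z in D, g z * φ z

/-- `f` has a weak derivative in the direction `e` that belongs to `L²(D)`. -/
def HasL2WeakDeriv (D : Set V) (e : V) (f : V → ℝ) : Prop :=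
  ∃ g : V → ℝ, MemLp g 2 (volume.restrict D) ∧ HasWeakDeriv D e f g

open Classical in
/-- The weak derivative of `f` in the direction `e`, as an element of `L²(D)` (unique up to null
sets); the value is `0` when there is none. -/
def weakDeriv (D : Set V) (e : V) (f : V → ℝ) : V → ℝ :=
  if h : HasL2WeakDeriv D e f then h.choose else 0

theorem weakDeriv_spec {D : Set V} {e : V} {f : V → ℝ} (h : HasL2WeakDeriv D e f) :
    MemLp (weakDeriv D e f) 2 (volume.restrict D) ∧ HasWeakDeriv D e f (weakDeriv D e f) := by
  unfold weakDeriv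
  rw [dif_pos h]
  exact h.choose_spec

end WeakDerivative

section Sobolev

variable {d : ℕ}

/-- The Sobolev space `H¹(Ω)`. -/
structure MemH1 (Ω : Set (Space d)) (a : Space d → ℝ) : Prop where
  memLp : MemLp a 2 (volume.restrict Ω)
  deriv : ∀ i, HasL2WeakDeriv Ω (unitVec i) a

/-- The weak gradient of a function on `Ω`. -/
def grad (Ω : Set (Space d)) (a : Space d → ℝ) (x : Space d) : Space d :=
  WithLp.toLp 2 fun i => weakDeriv Ω (unitVec i) a x

/-- The anisotropic Sobolev space `H^{2,1}(D)` of an open set `D` of space-time: `u`, `∂ᵢu`,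
`∂ⱼ∂ᵢu` and `∂ₜu` all belong to `L²(D)`. -/
structure MemH21 (D : Set (SpaceTime d)) (u : SpaceTime d → ℝ) : Prop where
  memLp : MemLp u 2 (volume.restrict D)
  time_deriv : HasL2WeakDeriv D timeDir u
  space_deriv : ∀ i, HasL2WeakDeriv D (spaceDir i) u
  space_deriv₂ : ∀ i j, HasL2WeakDeriv D (spaceDir j) (weakDeriv D (spaceDir i) u)

/-- The weak time derivative `∂ₜu` in `D`. -/
def dt (D : Set (SpaceTime d)) (u : SpaceTime d → ℝ) : SpaceTime d → ℝ :=
  weakDeriv D timeDir u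

/-- The weak spatial gradient `∇u` in `D`. -/
def gradX (D : Set (SpaceTime d)) (u : SpaceTime d → ℝ) (z : SpaceTime d) : Space d :=
  WithLp.toLp 2 fun i => weakDeriv D (spaceDir i) u z

/-- The weak spatial Laplacian `Δu = ∑ᵢ ∂ᵢ∂ᵢu` in `D`. -/
def laplacianX (D : Set (SpaceTime d)) (u : SpaceTime d → ℝ) (z : SpaceTime d) : ℝ :=
  ∑ i, weakDeriv D (spaceDir i) (weakDeriv D (spaceDir i) u) z

/-- `w` belongs to `L²(0, T; H¹₀(Ω))`, that is, `w` is in `L²(0, T; H¹(Ω))` and its trace on the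
lateral boundary `∂Ω × (0, T)` is zero: `w` is a limit of functions in `C_c^∞(Q)` with respect to
the norm `‖w‖_{L²(Q)} + ‖∇w‖_{L²(Q)}`.  Only spatial derivatives enter this norm, so nothing is
imposed on `w` at `t = 0` and at `t = T`. -/
def HasZeroLateralTrace (Ω : Set (Space d)) (T : ℝ) (w : SpaceTime d → ℝ) : Prop :=
  ∃ (φ : ℕ → SpaceTime d → ℝ) (g : Fin d → SpaceTime d → ℝ),
    (∀ n, IsTestFunction (parCylinder Ω T) (φ n)) ∧
    (∀ i, MemLp (g i) 2 (volume.restrict (parCylinder Ω T))) ∧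
    Tendsto (fun n => eLpNorm (fun z => φ n z - w z) 2 (volume.restrict (parCylinder Ω T)))
      atTop (𝓝 0) ∧
    ∀ i, Tendsto (fun n => eLpNorm (fun z => fderiv ℝ (φ n) z (spaceDir i) - g i z) 2
      (volume.restrict (parCylinder Ω T))) atTop (𝓝 0)

/-- The Neumann condition `∂_ν u = ∇u · ν = 0` on `∂Ω × (0, T)` in the sense of traces: for a smooth
vector field `N` that coincides with the outward unit normal on `∂Ω`, the function `∇u · N` has
zero trace on `∂Ω × (0, T)`. -/
def NeumannZero (Ω : Set (Space d)) (T : ℝ) (u : SpaceTime d → ℝ) : Prop :=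
  ∃ N : Space d → Space d, ContDiff ℝ ∞ N ∧
    (∀ x ∈ frontier Ω, IsOutwardUnitNormal Ω x (N x)) ∧
    HasZeroLateralTrace Ω T (fun z => inner ℝ (gradX (parCylinder Ω T) u z) (N z.1))

/-- `a = u(·, 0)` and `b = u(·, T)` in the sense of traces, for a function `u` on `Q` whose weak
time derivative belongs to `L²(Q)`:
`∫_Q (u ∂ₜψ + ∂ₜu ψ) dx dt = ∫_Ω b ψ(·, T) dx - ∫_Ω a ψ(·, 0) dx` for all `ψ ∈ C_c^∞(Ω × ℝ)`.
This determines `a` and `b` almost everywhere in `Ω`. -/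
def HasTimeTraces (Ω : Set (Space d)) (T : ℝ) (u : SpaceTime d → ℝ) (a b : Space d → ℝ) : Prop :=
  ∀ ψ : SpaceTime d → ℝ, IsTestFunction (Ω ×ˢ (univ : Set ℝ)) ψ →
    ∫ z in parCylinder Ω T, (u z * fderiv ℝ ψ z timeDir + dt (parCylinder Ω T) u z * ψ z) =
      (∫ x in Ω, b x * ψ (x, T)) - ∫ x in Ω, a x * ψ (x, 0)

end Sobolev

section System

variable {d : ℕ}

/-- `|Q₁(w)(x,t)| ≤ C (|w(x,t)| + |∇w(x,t)|)` in `Q`, for all `w ∈ H^{2,1}(Q)`. -/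
def BoundQ₁ (Q : Set (SpaceTime d)) (C : ℝ) (Q₁ : (SpaceTime d → ℝ) → SpaceTime d → ℝ) : Prop :=
  ∀ w, MemH21 Q w → AEStronglyMeasurable (Q₁ w) (volume.restrict Q) ∧
    ∀ᵐ z ∂(volume.restrict Q), |Q₁ w z| ≤ C * (|w z| + ‖gradX Q w z‖)

/-- `|Q₂(w,y)(x,t)| ≤ C (|w(x,t)| + |y(x,t)| + |∇w(x,t)| + |∇y(x,t)|)` in `Q`, for all
`w, y ∈ H^{2,1}(Q)`. -/
def BoundQ₂ (Q : Set (SpaceTime d)) (C : ℝ)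
    (Q₂ : (SpaceTime d → ℝ) → (SpaceTime d → ℝ) → SpaceTime d → ℝ) : Prop :=
  ∀ w y, MemH21 Q w → MemH21 Q y → AEStronglyMeasurable (Q₂ w y) (volume.restrict Q) ∧
    ∀ᵐ z ∂(volume.restrict Q),
      |Q₂ w y z| ≤ C * (|w z| + |y z| + ‖gradX Q w z‖ + ‖gradX Q y z‖)

/-- `|S(y)(x,t)| ≤ C |y(x,t)|` in `Q`, for all `y ∈ H^{2,1}(Q)`. -/
def BoundSPointwise (Q : Set (SpaceTime d)) (C : ℝ)
    (S : (SpaceTime d → ℝ) → SpaceTime d → ℝ) : Prop :=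
  ∀ y, MemH21 Q y → AEStronglyMeasurable (S y) (volume.restrict Q) ∧
    ∀ᵐ z ∂(volume.restrict Q), |S y z| ≤ C * |y z|

/-- `‖S(y)(·,t)‖_{L²(Ω)} ≤ C ‖y(·,t)‖_{L²(Ω)}` for (almost all) `0 < t < T`, for all
`y ∈ H^{2,1}(Q)`. -/
def BoundSL2 (Ω : Set (Space d)) (T : ℝ) (C : ℝ)
    (S : (SpaceTime d → ℝ) → SpaceTime d → ℝ) : Prop :=
  ∀ y, MemH21 (parCylinder Ω T) y →
    AEStronglyMeasurable (S y) (volume.restrict (parCylinder Ω T)) ∧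
    ∀ᵐ t ∂(volume.restrict (Ioo 0 T)),
      eLpNorm (fun x => S y (x, t)) 2 (volume.restrict Ω) ≤
        ENNReal.ofReal C * eLpNorm (fun x => y (x, t)) 2 (volume.restrict Ω)

/-- The function `φ(t) = e^{λ t}`. -/
def weight (lam t : ℝ) : ℝ := Real.exp (lam * t)

end System

end MeanField

end

open MeanField

/-!
The estimate follows from energy identities whose weights depend on time alone. Write `θ = e^{2sφ}`
and `q = λsφ`, so that `θ' = 2qθ` and `q' = λq`. For the backward equation the integral of
`θ (∂ₜu + Δu)²` over `Q` is written as the sum of the integrals of `θ (∂ₜu + qu)²`, of `θ (Δu)²`, of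
`θ' |∇u|²`, of a positive multiple of `u²`, and of terms at `t = 0` and `t = T`
(`HasEnergyIdentities.integral_backward_sq`). For the forward equation the squares are those of
`∂ₜv + qv` and `Δv + qv` (`HasEnergyIdentities.integral_forward_sq`). These identities give the Carleman
estimates `carleman_backward`, `carleman_backward_initial` and `carleman_forward`. In their sum,
`coupled_carleman`, the lower order terms on the right are smaller than the left by a factor `C₀²/λ`
and are absorbed for large `λ`; the term `ρ₀ Δu` has the order of the left-hand side, but it is
controlled by the estimate of `u`. A coupling operator `S` that is nonlocal in space causes no
difficulty, because the weights do not depend on `x`.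

The integrations by parts have to be justified for functions that are merely in `H^{2,1}(Q)`. The
Neumann condition says that the normal component of `∇u`, for a smooth extension `N` of the normal,
is a limit of test functions. Averages of `u` in time therefore satisfy Green's formula without
boundary term (`MemH21.isNeumannRegular`, which rests on `green_of_normal_component_zero`): the
field splits into its component along `N`, for which the formula passes to the limit, and a
remainder that is tangential to the boundary. The latter produces no boundary layer, since its
product with the gradient of a defining function `ρ` is bounded by `|ρ|` times a function in `L²`.
In time the functions are mollified by kernels that push `[0, T]` into `(0, T)`
(`exists_timeKernel_seq`), so that the mollified functions satisfy the identities exactly, up to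
both endpoints. Applied to differences, the identities show that the values of the mollified
functions and of their gradients at `t = 0` and `t = T` converge in `L²(Ω)`; the limits are the
traces (`IsNeumannRegular.exists_traces`).
-/

open MeasureTheory Set Filter Topology
open scoped ContDiff

namespace MeanField

/-! ### Convergence in `L²` -/

section LTwo

variable {X : Type*} [MeasurableSpace X]

theorem eLpNorm_two_sq {κ : Measure X} (h : X → ℝ) :
    eLpNorm h 2 κ ^ 2 = ∫⁻ x, ‖h x‖ₑ ^ 2 ∂κ := by
  have := eLpNorm_nnreal_pow_eq_lintegral (f := h) (μ := κ) (p := 2) (by norm_num)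
  norm_num at this
  exact_mod_cast this

/-- The Cauchy-Schwarz inequality `|∫ h|² ≤ κ(X) ∫ |h|²`; no integrability is needed, since the
integral of a non-integrable function is `0`. -/
theorem enorm_integral_sq_le {κ : Measure X} [IsFiniteMeasure κ] {h : X → ℝ}
    (hh : AEStronglyMeasurable h κ) :
    ‖∫ x, h x ∂κ‖ₑ ^ 2 ≤ κ univ * ∫⁻ x, ‖h x‖ₑ ^ 2 ∂κ := by
  have h1 := eLpNorm_le_eLpNorm_mul_rpow_measure_univ (p := 1) (q := 2) (by norm_num) hh
  have h2 : ‖∫ x, h x ∂κ‖ₑ ≤ eLpNorm h 1 κ := by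
    rw [eLpNorm_one_eq_lintegral_enorm]; exact enorm_integral_le_lintegral_enorm _
  calc ‖∫ x, h x ∂κ‖ₑ ^ 2
      ≤ (eLpNorm h 2 κ * κ univ ^ (1 / (1 : ENNReal).toReal - 1 / (2 : ENNReal).toReal)) ^ 2 := by
        gcongr; exact h2.trans h1
    _ = κ univ * ∫⁻ x, ‖h x‖ₑ ^ 2 ∂κ := by
        rw [mul_pow, eLpNorm_two_sq, ← ENNReal.rpow_natCast, ← ENNReal.rpow_mul, mul_comm]
        norm_num

theorem integrable_mul_of_memLp {μ : Measure X} {a b : X → ℝ} (ha : MemLp a 2 μ)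
    (hb : MemLp b 2 μ) : Integrable (fun x => a x * b x) μ :=
  ha.integrable_mul hb

theorem inner_toLp {μ : Measure X} {a b : X → ℝ} (ha : MemLp a 2 μ) (hb : MemLp b 2 μ) :
    inner ℝ (ha.toLp a) (hb.toLp b) = ∫ x, a x * b x ∂μ := by
  rw [L2.inner_def]
  apply integral_congr_ae
  filter_upwards [ha.coeFn_toLp, hb.coeFn_toLp] with x hx hy
  rw [hx, hy]
  simp [mul_comm]

theorem norm_toLp_eq_sqrt {μ : Measure X} {a : X → ℝ} (ha : MemLp a 2 μ) :
    ‖ha.toLp a‖ = √(∫ x, a x ^ 2 ∂μ) := by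
  rw [norm_eq_sqrt_real_inner, inner_toLp]
  simp only [sq]

/-- Convergence in `L²(μ)` of a sequence of functions. -/
structure TendstoL2 (μ : Measure X) (f : ℕ → X → ℝ) (g : X → ℝ) : Prop where
  memLp : ∀ n, MemLp (f n) 2 μ
  memLp_lim : MemLp g 2 μ
  tendsto : Tendsto (fun n => eLpNorm (fun x => f n x - g x) 2 μ) atTop (𝓝 0)

namespace TendstoL2

variable {μ : Measure X} {f f' : ℕ → X → ℝ} {g g' : X → ℝ}

theorem tendsto_toLp (h : TendstoL2 μ f g) :
    Tendsto (fun n => (h.memLp n).toLp (f n)) atTop (𝓝 (h.memLp_lim.toLp g)) :=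
  (Lp.tendsto_Lp_iff_tendsto_eLpNorm'' f h.memLp g h.memLp_lim).2 h.tendsto

theorem of_tendsto_toLp (hf : ∀ n, MemLp (f n) 2 μ) (hg : MemLp g 2 μ)
    (h : Tendsto (fun n => (hf n).toLp (f n)) atTop (𝓝 (hg.toLp g))) : TendstoL2 μ f g :=
  ⟨hf, hg, (Lp.tendsto_Lp_iff_tendsto_eLpNorm'' f hf g hg).1 h⟩

theorem integral_mul (h : TendstoL2 μ f g) (h' : TendstoL2 μ f' g') :
    Tendsto (fun n => ∫ x, f n x * f' n x ∂μ) atTop (𝓝 (∫ x, g x * g' x ∂μ)) := by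
  have := h.tendsto_toLp.inner (𝕜 := ℝ) h'.tendsto_toLp
  simpa only [inner_toLp] using this

theorem const (hg : MemLp g 2 μ) : TendstoL2 μ (fun _ => g) g :=
  ⟨fun _ => hg, hg, by simp⟩

theorem congr (h : TendstoL2 μ f g) (hf : ∀ n, f n =ᵐ[μ] f' n) : TendstoL2 μ f' g := by
  refine ⟨fun n => (h.memLp n).ae_eq (hf n), h.memLp_lim, ?_⟩
  refine h.tendsto.congr fun n => eLpNorm_congr_ae ?_
  filter_upwards [hf n] with x hx
  rw [hx]

theorem bounded_mul (h : TendstoL2 μ f g) {w : X → ℝ} (hw : AEStronglyMeasurable w μ) {C : ℝ}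
    (hC : ∀ᵐ x ∂μ, |w x| ≤ C) :
    TendstoL2 μ (fun n x => w x * f n x) (fun x => w x * g x) := by
  have hm : ∀ {a : X → ℝ}, MemLp a 2 μ → MemLp (fun x => w x * a x) 2 μ := fun ha => by
    refine MemLp.of_le_mul (c := C) ha (hw.mul ha.1) ?_
    filter_upwards [hC] with x hx
    rw [norm_mul]
    exact mul_le_mul_of_nonneg_right hx (norm_nonneg _)
  refine ⟨fun n => hm (h.memLp n), hm h.memLp_lim, ?_⟩
  have hlim : Tendsto (fun n => ENNReal.ofReal C * eLpNorm (fun x => f n x - g x) 2 μ) atTop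
      (𝓝 0) := by
    simpa using ENNReal.Tendsto.const_mul h.tendsto (Or.inr ENNReal.ofReal_ne_top)
  refine tendsto_of_tendsto_of_tendsto_of_le_of_le tendsto_const_nhds hlim (fun _ => zero_le) ?_
  intro n
  refine eLpNorm_le_mul_eLpNorm_of_ae_le_mul ?_ 2
  filter_upwards [hC] with x hx
  rw [← mul_sub, norm_mul]
  exact mul_le_mul_of_nonneg_right hx (norm_nonneg _)

theorem add (h : TendstoL2 μ f g) (h' : TendstoL2 μ f' g') :
    TendstoL2 μ (fun n x => f n x + f' n x) (fun x => g x + g' x) :=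
  of_tendsto_toLp (fun n => (h.memLp n).add (h'.memLp n)) (h.memLp_lim.add h'.memLp_lim)
    (h.tendsto_toLp.add h'.tendsto_toLp)

theorem const_mul_tendsto (h : TendstoL2 μ f g) {a : ℕ → ℝ} {c : ℝ}
    (ha : Tendsto a atTop (𝓝 c)) : TendstoL2 μ (fun n x => a n * f n x) (fun x => c * g x) :=
  of_tendsto_toLp (fun n => (h.memLp n).const_mul _) (h.memLp_lim.const_mul _)
    (ha.smul h.tendsto_toLp)

/-- A convergent sequence in `L²` is a Cauchy sequence, stated with integrals. -/
theorem tendsto_integral_sq_sub (h : TendstoL2 μ f g) :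
    Tendsto (fun p : ℕ × ℕ => ∫ x, (f p.1 x - f p.2 x) ^ 2 ∂μ) atTop (𝓝 0) := by
  have hc := cauchySeq_iff_tendsto_dist_atTop_0.1 h.tendsto_toLp.cauchySeq
  have h2 := hc.pow 2
  rw [zero_pow two_ne_zero] at h2
  refine h2.congr fun p => ?_
  rw [dist_eq_norm, ← MemLp.toLp_sub, norm_toLp_eq_sqrt, Real.sq_sqrt]
  · rfl
  · exact integral_nonneg fun x => sq_nonneg _

/-- Completeness of `L²`, for representatives and with the Cauchy property stated with integrals. -/
theorem exists_of_cauchy (hf : ∀ n, MemLp (f n) 2 μ)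
    (h : Tendsto (fun p : ℕ × ℕ => ∫ x, (f p.1 x - f p.2 x) ^ 2 ∂μ) atTop (𝓝 0)) :
    ∃ g, TendstoL2 μ f g := by
  have hc : CauchySeq fun n => (hf n).toLp (f n) := by
    rw [cauchySeq_iff_tendsto_dist_atTop_0]
    have : Tendsto (fun p : ℕ × ℕ => √(∫ x, (f p.1 x - f p.2 x) ^ 2 ∂μ)) atTop (𝓝 0) := by
      simpa using h.sqrt
    refine this.congr fun p => ?_
    rw [dist_eq_norm, ← MemLp.toLp_sub, norm_toLp_eq_sqrt]
    rfl
  obtain ⟨G, hG⟩ := cauchySeq_tendsto_of_complete hc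
  exact ⟨G, of_tendsto_toLp hf (Lp.memLp G) (by simpa using hG)⟩

end TendstoL2

/-- Averaging over a probability measure does not increase the norm of `L²`. -/
theorem eLpNorm_integral_le {Y : Type*} [MeasurableSpace Y] {μ : Measure X} {κ : Measure Y}
    [SFinite μ] [IsProbabilityMeasure κ] {F : X × Y → ℝ}
    (hF : AEStronglyMeasurable F (μ.prod κ)) :
    eLpNorm (fun x => ∫ r, F (x, r) ∂κ) 2 μ ≤ eLpNorm F 2 (μ.prod κ) := by
  rw [← ENNReal.pow_le_pow_left_iff two_ne_zero, eLpNorm_two_sq, eLpNorm_two_sq]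
  calc ∫⁻ x, ‖∫ r, F (x, r) ∂κ‖ₑ ^ 2 ∂μ ≤ ∫⁻ x, ∫⁻ r, ‖F (x, r)‖ₑ ^ 2 ∂κ ∂μ := by
        apply lintegral_mono_ae
        filter_upwards [hF.prodMk_left] with x hx
        simpa using enorm_integral_sq_le hx
    _ = ∫⁻ z, ‖F z‖ₑ ^ 2 ∂(μ.prod κ) := (lintegral_prod _ (hF.enorm.pow_const 2)).symm

/-- Averages `x ↦ ∫ f(A(x, r)) dκₙ(r)` over points `A(x, r)` that are `εₙ`-close to `x` converge to
`f` in `L²`, as long as `A` does not concentrate measure.  Mollification in all variables and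
mollification in time alone are both of this form. -/
theorem tendstoL2_average {W Y : Type*} [NormedAddCommGroup W] [NormedSpace ℝ W]
    [FiniteDimensional ℝ W] [MeasurableSpace W] [BorelSpace W] [MeasurableSpace Y]
    {ν μ : Measure W} [ν.Regular] [IsFiniteMeasure μ]
    (hμν : μ ≤ ν) {κ : ℕ → Measure Y} [∀ n, IsProbabilityMeasure (κ n)] {A : ℕ → W × Y → W}
    (hA : ∀ n, Measurable (A n)) {M : ENNReal} (hM : M ≠ ⊤)
    (hmap : ∀ n, (μ.prod (κ n)).map (A n) ≤ M • ν) {ε : ℕ → ℝ} (hε : Tendsto ε atTop (𝓝 0))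
    (hdist : ∀ n, ∀ᵐ z ∂(μ.prod (κ n)), dist (A n z) z.1 ≤ ε n) {f : W → ℝ} (hf : MemLp f 2 ν) :
    TendstoL2 μ (fun n x => ∫ r, f (A n (x, r)) ∂(κ n)) f := by
  have hfA : ∀ {g : W → ℝ}, MemLp g 2 ν → ∀ n, MemLp (fun z => g (A n z)) 2 (μ.prod (κ n)) ∧
      eLpNorm (fun z => g (A n z)) 2 (μ.prod (κ n)) ≤ M ^ (1 / 2 : ℝ) * eLpNorm g 2 ν := by
    intro g hg n
    have h1 : MemLp g 2 (M • ν) := hg.smul_measure hM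
    have h2 : MemLp g 2 ((μ.prod (κ n)).map (A n)) := h1.mono_measure (hmap n)
    refine ⟨(memLp_map_measure_iff h2.1 (hA n).aemeasurable).1 h2, ?_⟩
    have h3 := eLpNorm_map_measure (p := 2) h2.1 (hA n).aemeasurable
    rw [show (fun z => g (A n z)) = g ∘ A n from rfl, ← h3]
    refine (eLpNorm_mono_measure g (hmap n)).trans ?_
    rw [eLpNorm_smul_measure_of_ne_top (by norm_num)]
    norm_num
  have hfst : ∀ {g : W → ℝ}, MemLp g 2 ν → ∀ n, MemLp (fun z : W × Y => g z.1) 2 (μ.prod (κ n)) ∧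
      eLpNorm (fun z : W × Y => g z.1) 2 (μ.prod (κ n)) ≤ eLpNorm g 2 ν := by
    intro g hg n
    have h2 : MemLp g 2 ((μ.prod (κ n)).map Prod.fst) := by
      rw [Measure.map_fst_prod]; simpa using hg.mono_measure hμν
    refine ⟨(memLp_map_measure_iff h2.1 measurable_fst.aemeasurable).1 h2, ?_⟩
    have h3 := eLpNorm_map_measure (p := 2) h2.1 measurable_fst.aemeasurable
    rw [show (fun z : W × Y => g z.1) = g ∘ Prod.fst from rfl, ← h3, Measure.map_fst_prod]
    simpa using eLpNorm_mono_measure g hμν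
  have hdiff : ∀ n, eLpNorm (fun x => (∫ r, f (A n (x, r)) ∂(κ n)) - f x) 2 μ ≤
      eLpNorm (fun z => f (A n z) - f z.1) 2 (μ.prod (κ n)) := by
    intro n
    refine le_trans (le_of_eq (eLpNorm_congr_ae ?_))
      (eLpNorm_integral_le (((hfA hf n).1.sub (hfst hf n).1).1))
    have hint : Integrable (fun z => f (A n z)) (μ.prod (κ n)) :=
      (hfA hf n).1.integrable (by norm_num)
    filter_upwards [hint.prod_right_ae] with x hx
    rw [integral_sub hx (integrable_const _)]
    simp
  refine ⟨fun n => ?_, hf.mono_measure hμν, ?_⟩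
  · have h1 := (hfA hf n).1
    exact ⟨h1.1.integral_prod_right', (eLpNorm_integral_le h1.1).trans_lt h1.2⟩
  rw [ENNReal.tendsto_nhds_zero]
  intro η hη
  have hη0 : η ≠ 0 := hη.ne'
  -- split the error into an approximation by a continuous function and a uniform bound
  have hconst : ∃ δ : ENNReal, δ ≠ 0 ∧ (M ^ (1 / 2 : ℝ) + 1) * δ ≤ η / 2 := by
    obtain ⟨δ, hδ, h⟩ := ENNReal.exists_pos_mul_lt (a := M ^ (1 / 2 : ℝ) + 1) (b := η / 2)
      (by finiteness) (by simpa using hη0)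
    exact ⟨δ, hδ.ne', by rw [mul_comm]; exact h.le⟩
  obtain ⟨δ, hδ, hδη⟩ := hconst
  obtain ⟨g, hgc, hgδ, hgcont, hg⟩ := hf.exists_hasCompactSupport_eLpNorm_sub_le (by norm_num) hδ
  have huc := hgc.uniformContinuous_of_continuous hgcont
  have hconst' : ∃ w : ℝ, 0 < w ∧ (μ univ) ^ (1 / 2 : ℝ) * ENNReal.ofReal w ≤ η / 2 := by
    obtain ⟨w, hw, h⟩ := ENNReal.exists_nnreal_pos_mul_lt (a := (μ univ) ^ (1 / 2 : ℝ))
      (b := η / 2) (by finiteness) (by simpa using hη0)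
    exact ⟨w, hw, by rw [mul_comm, ENNReal.ofReal_coe_nnreal]; exact h.le⟩
  obtain ⟨w, hw, hwη⟩ := hconst'
  obtain ⟨r, hr, hgr⟩ := Metric.uniformContinuous_iff.1 huc w hw
  filter_upwards [hε.eventually (gt_mem_nhds hr)] with n hn
  refine (hdiff n).trans ?_
  have hfg : MemLp (f - g) 2 ν := hf.sub hg
  have e1 := (hfA hfg n)
  have e2 := (hfst hfg n)
  have hgA := (hfA hg n).1.sub (hfst hg n).1
  have e3 : eLpNorm (fun z => g (A n z) - g z.1) 2 (μ.prod (κ n)) ≤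
      (μ univ) ^ (1 / 2 : ℝ) * ENNReal.ofReal w := by
    refine (eLpNorm_le_of_ae_bound (C := w) ?_).trans (le_of_eq ?_)
    · filter_upwards [hdist n] with z hz
      exact (hgr (hz.trans_lt hn)).le
    · rw [Measure.prod_apply MeasurableSet.univ]
      simp
  calc eLpNorm (fun z => f (A n z) - f z.1) 2 (μ.prod (κ n))
      = eLpNorm ((fun z => (f - g) (A n z)) + (fun z => g (A n z) - g z.1)
          - fun z => (f - g) z.1) 2 (μ.prod (κ n)) := by
        congr 1; ext z; simp
    _ ≤ eLpNorm (fun z => (f - g) (A n z)) 2 (μ.prod (κ n))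
          + eLpNorm (fun z => g (A n z) - g z.1) 2 (μ.prod (κ n))
          + eLpNorm (fun z : W × Y => (f - g) z.1) 2 (μ.prod (κ n)) := by
        refine (eLpNorm_sub_le (e1.1.add hgA).1 e2.1.1 (by norm_num)).trans ?_
        gcongr
        exact eLpNorm_add_le e1.1.1 hgA.1 (by norm_num)
    _ ≤ M ^ (1 / 2 : ℝ) * δ + η / 2 + δ := by
        gcongr
        · exact e1.2.trans (by gcongr)
        · exact e3.trans hwη
        · exact e2.2.trans hgδ
    _ = (M ^ (1 / 2 : ℝ) + 1) * δ + η / 2 := by ring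
    _ ≤ η / 2 + η / 2 := by gcongr
    _ = η := ENNReal.add_halves η

end LTwo

/-! ### Weak derivatives -/

section WeakCalculus

set_option linter.unusedSectionVars false

variable {V : Type*} [NormedAddCommGroup V] [NormedSpace ℝ V] [FiniteDimensional ℝ V]
  [MeasureSpace V] [BorelSpace V] [(volume : Measure V).IsAddHaarMeasure]
  {D : Set V} {e : V} {f g a b : V → ℝ}

theorem IsTestFunction.memLp {φ : V → ℝ} (h : IsTestFunction D φ) :
    MemLp φ 2 (volume.restrict D) :=
  (h.1.continuous.memLp_of_hasCompactSupport h.2.1).restrict D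

theorem continuous_fderiv_apply {φ : V → ℝ} (h : ContDiff ℝ ∞ φ) (e : V) :
    Continuous fun x => fderiv ℝ φ x e :=
  (h.continuous_fderiv (by simp)).clm_apply continuous_const

theorem contDiff_fderiv_apply {φ : V → ℝ} (h : ContDiff ℝ ∞ φ) (e : V) :
    ContDiff ℝ ∞ fun x => fderiv ℝ φ x e :=
  (h.fderiv_right (m := ∞) (by simp)).clm_apply contDiff_const

theorem IsTestFunction.fderiv {φ : V → ℝ} (h : IsTestFunction D φ) (e : V) :
    IsTestFunction D fun x => fderiv ℝ φ x e :=
  ⟨contDiff_fderiv_apply h.1 e, h.2.1.fderiv_apply ℝ e,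
    (tsupport_fderiv_apply_subset ℝ e).trans h.2.2⟩

theorem IsTestFunction.mul_left {φ m : V → ℝ} (h : IsTestFunction D φ) (hm : ContDiff ℝ ∞ m) :
    IsTestFunction D fun x => m x * φ x :=
  ⟨hm.mul h.1, h.2.1.mul_left, (tsupport_mul_subset_right).trans h.2.2⟩

theorem IsTestFunction.bounded {φ : V → ℝ} (h : IsTestFunction D φ) : ∃ C, ∀ x, |φ x| ≤ C :=
  h.2.1.exists_bound_of_continuous h.1.continuous

theorem fderiv_mul_apply {φ m : V → ℝ} (hφ : ContDiff ℝ ∞ φ) (hm : ContDiff ℝ ∞ m) (x e : V) :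
    fderiv ℝ (fun x => m x * φ x) x e = m x * fderiv ℝ φ x e + fderiv ℝ m x e * φ x := by
  have h1 := (hm.differentiable (by simp)) x
  have h2 := (hφ.differentiable (by simp)) x
  rw [fderiv_fun_mul h1 h2]
  simp; ring

/-- Weak derivatives are unique. -/
theorem HasWeakDeriv.ae_eq (hD : IsOpen D) (h : HasWeakDeriv D e f a) (h' : HasWeakDeriv D e f b)
    (ha : MemLp a 2 (volume.restrict D)) (hb : MemLp b 2 (volume.restrict D)) :
    a =ᵐ[volume.restrict D] b := by
  have hli : LocallyIntegrableOn (fun x => a x - b x) D :=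
    locallyIntegrableOn_of_locallyIntegrable_restrict
      ((ha.sub hb).locallyIntegrable (by norm_num))
  have := hD.ae_eq_zero_of_integral_contDiff_smul_eq_zero hli (fun φ h1 h2 h3 => by
    have ht : IsTestFunction D φ := ⟨h1, h2, h3⟩
    have e1 : ∫ z in D, a z * φ z = ∫ z in D, b z * φ z := by
      have := (h φ ht).symm.trans (h' φ ht); linarith
    have e2 : ∫ x in D, φ x • (a x - b x) = 0 := by
      have : ∀ x, φ x • (a x - b x) = a x * φ x - b x * φ x := fun x => by
        simp; ring
      simp_rw [this]
      rw [integral_sub (integrable_mul_of_memLp ha ht.memLp) (integrable_mul_of_memLp hb ht.memLp),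
        e1, sub_self]
    rw [← e2, setIntegral_eq_integral_of_forall_compl_eq_zero]
    intro x hx
    rw [image_eq_zero_of_notMem_tsupport fun hx' => hx (h3 hx'), zero_smul])
  filter_upwards [ae_restrict_of_ae this, ae_restrict_mem hD.measurableSet] with x hx hxD
  linarith [hx hxD]

/-- Weak differentiation is closed in `L²`. -/
theorem HasWeakDeriv.of_tendstoL2 {F G : ℕ → V → ℝ} (h : ∀ n, HasWeakDeriv D e (F n) (G n))
    (hF : TendstoL2 (volume.restrict D) F f) (hG : TendstoL2 (volume.restrict D) G g) :
    HasWeakDeriv D e f g := by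
  intro φ hφ
  have h1 := hF.integral_mul (TendstoL2.const (hφ.fderiv e).memLp)
  have h2 := (hG.integral_mul (TendstoL2.const hφ.memLp)).neg
  simp_rw [h _ φ hφ] at h1
  exact tendsto_nhds_unique h1 h2

theorem IsTestFunction.hasWeakDeriv {φ : V → ℝ} (h : IsTestFunction D φ) (e : V) :
    HasWeakDeriv D e φ fun x => _root_.fderiv ℝ φ x e := by
  intro ψ hψ
  have hc : ∀ {a b : V → ℝ}, IsTestFunction D a → IsTestFunction D b →
      Integrable (fun x => a x * b x) := fun ha hb =>
    ((ha.1.continuous.mul hb.1.continuous).integrable_of_hasCompactSupport ha.2.1.mul_right)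
  have key := integral_mul_fderiv_eq_neg_fderiv_mul_of_integrable (𝕜 := ℝ)
    (μ := (volume : Measure V)) (f := φ) (g := ψ) (v := e) (hc (h.fderiv e) hψ)
    (hc h (hψ.fderiv e)) (hc h hψ)
    (fun x _ => h.1.differentiable (by simp) x) (fun x _ => hψ.1.differentiable (by simp) x)
  rw [setIntegral_eq_integral_of_forall_compl_eq_zero, key,
    setIntegral_eq_integral_of_forall_compl_eq_zero]
  · intro x hx
    rw [image_eq_zero_of_notMem_tsupport fun hx' => hx (hψ.2.2 hx'), mul_zero]
  · intro x hx
    rw [image_eq_zero_of_notMem_tsupport fun hx' => hx (h.2.2 hx'), zero_mul]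

theorem HasWeakDeriv.add (hf : MemLp f 2 (volume.restrict D)) (hg : MemLp g 2 (volume.restrict D))
    {f' g' : V → ℝ}
    (hf' : MemLp f' 2 (volume.restrict D)) (hg' : MemLp g' 2 (volume.restrict D))
    (h : HasWeakDeriv D e f f') (h' : HasWeakDeriv D e g g') :
    HasWeakDeriv D e (fun x => f x + g x) (fun x => f' x + g' x) := by
  intro φ hφ
  simp_rw [add_mul]
  rw [integral_add (integrable_mul_of_memLp hf (hφ.fderiv e).memLp)
    (integrable_mul_of_memLp hg (hφ.fderiv e).memLp),
    integral_add (integrable_mul_of_memLp hf' hφ.memLp)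
    (integrable_mul_of_memLp hg' hφ.memLp), h φ hφ, h' φ hφ]
  ring

theorem HasWeakDeriv.const_mul {f' : V → ℝ} (c : ℝ) (h : HasWeakDeriv D e f f') :
    HasWeakDeriv D e (fun x => c * f x) (fun x => c * f' x) := by
  intro φ hφ
  simp_rw [mul_assoc]
  rw [integral_const_mul, integral_const_mul, h φ hφ]
  ring

/-- The product rule with one smooth factor. -/
theorem HasWeakDeriv.smooth_mul (hf : MemLp f 2 (volume.restrict D))
    (hg : MemLp g 2 (volume.restrict D)) (h : HasWeakDeriv D e f g) {m : V → ℝ}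
    (hm : ContDiff ℝ ∞ m) :
    HasWeakDeriv D e (fun x => m x * f x) (fun x => m x * g x + fderiv ℝ m x e * f x) := by
  intro φ hφ
  have h1 := h _ (hφ.mul_left hm)
  simp_rw [fderiv_mul_apply hφ.1 hm] at h1
  have hi1 : Integrable (fun x => f x * (m x * fderiv ℝ φ x e)) (volume.restrict D) :=
    integrable_mul_of_memLp hf ((hφ.fderiv e).mul_left hm).memLp
  have hi2 : Integrable (fun x => f x * (fderiv ℝ m x e * φ x)) (volume.restrict D) :=
    integrable_mul_of_memLp hf (hφ.mul_left (contDiff_fderiv_apply hm e)).memLp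
  have hi3 : Integrable (fun x => g x * (m x * φ x)) (volume.restrict D) :=
    integrable_mul_of_memLp hg (hφ.mul_left hm).memLp
  simp_rw [mul_add] at h1
  rw [integral_add hi1 hi2] at h1
  have e1 : ∫ z in D, m z * f z * fderiv ℝ φ z e = ∫ z in D, f z * (m z * fderiv ℝ φ z e) := by
    congr 1; ext z; ring
  have e2 : ∫ z in D, (m z * g z + fderiv ℝ m z e * f z) * φ z =
      (∫ z in D, g z * (m z * φ z)) + ∫ z in D, f z * (fderiv ℝ m z e * φ z) := by
    rw [← integral_add hi3 hi2]
    congr 1; ext z; ring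
  rw [e1, e2]; linarith

/-- A cut-off Sobolev function is approximated by test functions, together with its derivative. -/
theorem exists_testFunction_approx (hD : IsOpen D) (hDv : volume D ≠ ⊤)
    (ha : MemLp a 2 (volume.restrict D)) (hb : MemLp b 2 (volume.restrict D))
    (h : HasWeakDeriv D e a b) {η : V → ℝ} (hη : IsTestFunction D η) :
    ∃ ψ : ℕ → V → ℝ, (∀ n, IsTestFunction D (ψ n)) ∧
      TendstoL2 (volume.restrict D) ψ (fun x => η x * a x) ∧
      TendstoL2 (volume.restrict D) (fun n x => fderiv ℝ (ψ n) x e)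
        (fun x => η x * b x + fderiv ℝ η x e * a x) := by
  obtain ⟨δ, hδ, hδD⟩ := hη.2.1.exists_cthickening_subset_open hD hη.2.2
  have : IsFiniteMeasure (volume.restrict D) := ⟨by simpa using hDv.lt_top⟩
  have hr : ∀ n : ℕ, 0 < δ / (n + 1) := fun n => by positivity
  let k : ℕ → ContDiffBump (0 : V) := fun n =>
    ⟨δ / (n + 1) / 2, δ / (n + 1), half_pos (hr n), half_lt_self (hr n)⟩
  have hk : ∀ n, (k n).rOut = δ / (n + 1) := fun n => rfl
  have hk_le : ∀ n, (k n).rOut ≤ δ := fun n => by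
    rw [hk]; exact div_le_self hδ.le (by linarith [n.cast_nonneg (α := ℝ)])
  let K : ℕ → V → ℝ := fun n => (k n).normed volume
  have hKc : ∀ n, ContDiff ℝ ∞ (K n) := fun n => (k n).contDiff_normed
  have hKs : ∀ n, HasCompactSupport (K n) := fun n => (k n).hasCompactSupport_normed
  let κ : ℕ → Measure V := fun n => volume.withDensity fun y => ENNReal.ofReal (K n y)
  have hKm : ∀ n, Measurable fun y => ENNReal.ofReal (K n y) := fun n =>
    (hKc n).continuous.measurable.ennreal_ofReal
  have hκp : ∀ n, IsProbabilityMeasure (κ n) := fun n => ⟨by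
    simp only [κ]
    rw [withDensity_apply _ MeasurableSet.univ, Measure.restrict_univ,
      ← ofReal_integral_eq_lintegral_ofReal (k n).integrable_normed
        (Eventually.of_forall (k n).nonneg_normed), (k n).integral_normed, ENNReal.ofReal_one]⟩
  let T : ℕ → (V → ℝ) → V → ℝ := fun n c x => ∫ y, D.indicator c y * K n (x - y)
  have hind : ∀ {c : V → ℝ}, MemLp c 2 (volume.restrict D) → MemLp (D.indicator c) 2 volume :=
    fun hc => (memLp_indicator_iff_restrict hD.measurableSet).2 hc
  have hT : ∀ {c : V → ℝ}, MemLp c 2 (volume.restrict D) →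
      TendstoL2 (volume.restrict D) (fun n => T n c) c := by
    intro c hc
    have := tendstoL2_average (μ := volume.restrict D) (ν := volume) (κ := κ)
      (A := fun _ z => z.1 - z.2) (M := 1) (ε := fun n => δ / (n + 1)) Measure.restrict_le_self
      (fun _ => by fun_prop) (by simp) ?_ ?_ ?_ (hind hc)
    · have h2 : TendstoL2 (volume.restrict D) (fun n => T n c) (D.indicator c) := by
        refine this.congr fun n => Eventually.of_forall fun x => ?_
        simp only [κ, T]
        rw [integral_withDensity_eq_integral_toReal_smul (hKm n) (by simp)]
        rw [← integral_sub_left_eq_self (fun y => D.indicator c y * K n (x - y)) volume x]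
        congr 1; ext y
        rw [ENNReal.toReal_ofReal ((k n).nonneg_normed y), sub_sub_cancel, smul_eq_mul, mul_comm]
      have h3 : D.indicator c =ᵐ[volume.restrict D] c := by
        filter_upwards [ae_restrict_mem hD.measurableSet] with x hx
        rw [indicator_of_mem hx]
      refine ⟨h2.memLp, hc, h2.tendsto.congr fun n => eLpNorm_congr_ae ?_⟩
      filter_upwards [h3] with x hx
      rw [hx]
    · intro n
      rw [one_smul]
      refine Measure.le_iff.2 fun s hs => ?_
      rw [Measure.map_apply (by fun_prop) hs,
        Measure.prod_apply_symm (measurableSet_preimage (by fun_prop) hs)]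
      calc ∫⁻ y, (volume.restrict D)
            ((fun x => (x, y)) ⁻¹' ((fun z : V × V => z.1 - z.2) ⁻¹' s)) ∂κ n
          ≤ ∫⁻ _, volume s ∂κ n := by
            refine lintegral_mono fun y => (Measure.restrict_apply_le _ _).trans (le_of_eq ?_)
            rw [← measure_preimage_add_right volume (-y) s]
            congr 1; ext x; simp [sub_eq_add_neg]
        _ = volume s := by simp
    · simpa [div_eq_mul_inv] using (tendsto_one_div_add_atTop_nhds_zero_nat (𝕜 := ℝ)).const_mul δ
    · intro n
      have h1 : ∀ᵐ y ∂κ n, ‖y‖ ≤ δ / (n + 1) := by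
        refine (ae_withDensity_iff (hKm n)).2 (Eventually.of_forall fun y hy => ?_)
        have hy' : y ∈ Function.support ((k n).normed volume) := by
          intro h0; exact hy (by simp [K, h0])
        rw [(k n).support_normed_eq, hk] at hy'
        exact (mem_ball_zero_iff.1 hy').le
      have h2 := (Measure.quasiMeasurePreserving_snd (μ := volume.restrict D) (ν := κ n)).ae h1
      filter_upwards [h2] with z hz
      simpa [dist_eq_norm] using hz
  have hli : ∀ {c : V → ℝ}, MemLp c 2 (volume.restrict D) →
      LocallyIntegrable (D.indicator c) volume := fun hc =>
    (hind hc).locallyIntegrable (by norm_num)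
  have hTc : ∀ n {c : V → ℝ}, MemLp c 2 (volume.restrict D) → ContDiff ℝ ∞ (T n c) :=
    fun n c hc => (hKs n).contDiff_convolution_right (ContinuousLinearMap.mul ℝ ℝ) (hli hc) (hKc n)
  have hTd : ∀ n, ∀ x ∈ tsupport η, fderiv ℝ (T n a) x e = T n b x := by
    intro n x hx
    have h1 := ((hKs n).hasFDerivAt_convolution_right (ContinuousLinearMap.mul ℝ ℝ) (hli ha)
      ((hKc n).of_le (by simp)) x).fderiv
    have h2 : fderiv ℝ (T n a) x e = ∫ y, D.indicator a y * fderiv ℝ (K n) (x - y) e := by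
      refine (congrArg (fun l => l e) h1).trans ?_
      rw [convolution_precompR_apply _ (hli ha) ((hKs n).fderiv ℝ)
        ((hKc n).continuous_fderiv (by simp))]
      rfl
    have hφ : IsTestFunction D fun y => K n (x - y) := by
      refine ⟨(hKc n).comp (contDiff_const.sub contDiff_id), ?_, ?_⟩
      · exact (hKs n).comp_homeomorph (Homeomorph.subLeft x)
      · refine Subset.trans ?_ ((Metric.closedBall_subset_cthickening hx δ).trans hδD)
        refine closure_minimal (fun y hy => ?_) Metric.isClosed_closedBall
        have hy' : x - y ∈ Function.support ((k n).normed volume) := hy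
        rw [(k n).support_normed_eq, mem_ball_zero_iff] at hy'
        rw [Metric.mem_closedBall, dist_comm, dist_eq_norm]
        exact hy'.le.trans (hk_le n)
    have hφd : ∀ y, fderiv ℝ (fun y => K n (x - y)) y e = - fderiv ℝ (K n) (x - y) e := by
      intro y
      have h3 : HasFDerivAt (fun y => K n (x - y))
          ((fderiv ℝ (K n) (x - y)).comp (-ContinuousLinearMap.id ℝ V)) y :=
        (((hKc n).differentiable (by simp)) (x - y)).hasFDerivAt.comp y
          ((hasFDerivAt_id y).const_sub x)
      rw [h3.fderiv]; simp
    have h4 := h _ hφ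
    simp_rw [hφd, mul_neg, integral_neg, neg_inj] at h4
    have h5 : ∀ c m : V → ℝ, ∫ y, D.indicator c y * m y = ∫ y in D, c y * m y := by
      intro c m
      rw [← integral_indicator hD.measurableSet]
      congr 1; ext y
      by_cases hy : y ∈ D <;> simp [hy]
    rw [h2, h5, h4]
    exact (h5 b fun y => K n (x - y)).symm
  refine ⟨fun n x => T n a x * η x, fun n => hη.mul_left (hTc n ha), ?_, ?_⟩
  · obtain ⟨C, hC⟩ := hη.bounded
    refine ((hT ha).bounded_mul (w := η) hη.1.continuous.aestronglyMeasurable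
      (Eventually.of_forall hC)).congr fun n => Eventually.of_forall fun x => mul_comm _ _
  · obtain ⟨C, hC⟩ := hη.bounded
    obtain ⟨C', hC'⟩ := (hη.fderiv e).bounded
    refine (((hT hb).bounded_mul (w := η) hη.1.continuous.aestronglyMeasurable
      (Eventually.of_forall hC)).add ((hT ha).bounded_mul (w := fun x => fderiv ℝ η x e)
        (hη.fderiv e).1.continuous.aestronglyMeasurable
      (Eventually.of_forall hC'))).congr fun n => Eventually.of_forall fun x => ?_
    dsimp only
    rw [fderiv_mul_apply hη.1 (hTc n ha)]
    by_cases hx : x ∈ tsupport η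
    · rw [hTd n x hx]; ring
    · rw [image_eq_zero_of_notMem_tsupport hx]; ring

/-- The product rule for two Sobolev functions. -/
theorem HasWeakDeriv.mul (hD : IsOpen D) (hDv : volume D ≠ ⊤) {a' b' : V → ℝ}
    (ha : MemLp a 2 (volume.restrict D)) (hb : MemLp b 2 (volume.restrict D))
    (ha' : MemLp a' 2 (volume.restrict D)) (hb' : MemLp b' 2 (volume.restrict D))
    (h : HasWeakDeriv D e a a') (h' : HasWeakDeriv D e b b') :
    HasWeakDeriv D e (fun x => a x * b x) (fun x => a x * b' x + a' x * b x) := by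
  intro η hη
  obtain ⟨ψ, hψ, h1, h2⟩ := exists_testFunction_approx hD hDv ha ha' h hη
  have l1 := (TendstoL2.const hb).integral_mul h2
  have l2 := ((TendstoL2.const hb').integral_mul h1).neg
  simp_rw [h' _ (hψ _)] at l1
  have key := tendsto_nhds_unique l1 l2
  obtain ⟨C, hC⟩ := hη.bounded
  obtain ⟨C', hC'⟩ := (hη.fderiv e).bounded
  have m1 : MemLp (fun x => η x * a' x) 2 (volume.restrict D) :=
    ((TendstoL2.const ha').bounded_mul hη.1.continuous.aestronglyMeasurable
      (Eventually.of_forall hC)).memLp_lim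
  have m2 : MemLp (fun x => fderiv ℝ η x e * a x) 2 (volume.restrict D) :=
    ((TendstoL2.const ha).bounded_mul (hη.fderiv e).1.continuous.aestronglyMeasurable
      (Eventually.of_forall hC')).memLp_lim
  simp_rw [mul_add] at key
  rw [integral_add (integrable_mul_of_memLp hb m1) (integrable_mul_of_memLp hb m2)] at key
  have e1 : ∫ x in D, (a x * b' x + a' x * b x) * η x =
      (∫ x in D, b' x * (η x * a x)) + ∫ x in D, b x * (η x * a' x) := by
    rw [← integral_add (integrable_mul_of_memLp hb' h1.memLp_lim) (integrable_mul_of_memLp hb m1)]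
    congr 1; ext x; ring
  have e2 : ∫ x in D, a x * b x * fderiv ℝ η x e = ∫ x in D, b x * (fderiv ℝ η x e * a x) := by
    congr 1; ext x; ring
  rw [e1, e2]; linarith

end WeakCalculus

/-! ### The outward normal near the boundary -/

section Geometry

variable {d : ℕ} {Ω : Set (Space d)} {x₀ : Space d} {ρ σ : Space d → ℝ}

theorem inner_gradient_eq (ρ : Space d → ℝ) (x a : Space d) :
    inner ℝ (gradient ρ x) a = fderiv ℝ ρ x a := by
  rw [← toDual_gradient (𝕜 := ℝ), InnerProductSpace.toDual_apply_apply]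

theorem contDiff_gradient (h : ContDiff ℝ ∞ ρ) : ContDiff ℝ ∞ (gradient ρ) :=
  (InnerProductSpace.toDual ℝ (Space d)).symm.contDiff.comp (h.fderiv_right (m := ∞) (by simp))

theorem hasDerivAt_line (h : ContDiff ℝ ∞ ρ) (x a : Space d) (t : ℝ) :
    HasDerivAt (fun t : ℝ => ρ (x + t • a)) (inner ℝ (gradient ρ (x + t • a)) a) t := by
  rw [inner_gradient_eq]
  have h1 : HasDerivAt (fun t : ℝ => x + t • a) a t := by
    simpa using ((hasDerivAt_id t).smul_const a).const_add x
  exact ((h.differentiable (by simp)) _).hasFDerivAt.comp_hasDerivAt t h1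

theorem IsLocalDefiningFunction.eq_zero (hΩ : IsOpen Ω) (hx : x₀ ∈ frontier Ω)
    (h : IsLocalDefiningFunction Ω x₀ ρ) : ρ x₀ = 0 := by
  have hx₀ : x₀ ∉ Ω := by
    rw [hΩ.frontier_eq] at hx; exact hx.2
  have h1 : 0 ≤ ρ x₀ := by
    by_contra hlt
    exact hx₀ (h.2.2.self_of_nhds.2 (not_le.1 hlt))
  have h2 : ∃ᶠ y in 𝓝 x₀, ρ y ≤ 0 := by
    have := mem_closure_iff_frequently.1 (frontier_subset_closure hx)
    exact (this.and_eventually h.2.2).mono fun y hy => (hy.2.1 hy.1).le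
  have h3 : ρ x₀ ≤ 0 := by
    by_contra hlt
    have := (h.1.continuous.continuousAt (x := x₀)).eventually (lt_mem_nhds (not_le.1 hlt))
    obtain ⟨y, hy⟩ := (h2.and_eventually this).exists
    linarith [hy.1, hy.2]
  linarith

/-- A direction that enters `Ω` according to one defining function does not leave it according to
another one. -/
theorem IsLocalDefiningFunction.inner_gradient_nonpos (hΩ : IsOpen Ω) (hx : x₀ ∈ frontier Ω)
    (h : IsLocalDefiningFunction Ω x₀ ρ) (h' : IsLocalDefiningFunction Ω x₀ σ) {e : Space d}
    (he : inner ℝ (gradient ρ x₀) e < 0) : inner ℝ (gradient σ x₀) e ≤ 0 := by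
  by_contra hpos
  rw [not_le] at hpos
  have d1 := hasDerivAt_line h.1 x₀ e 0
  have d2 := hasDerivAt_line h'.1 x₀ e 0
  simp only [zero_smul, add_zero] at d1 d2
  have s1 := eventually_nhdsWithin_sign_eq_of_deriv_neg (f := fun t : ℝ => ρ (x₀ + t • e))
    (x₀ := 0) (by rw [d1.deriv]; exact he) (by simpa using h.eq_zero hΩ hx)
  have s2 := eventually_nhdsWithin_sign_eq_of_deriv_pos (f := fun t : ℝ => σ (x₀ + t • e))
    (x₀ := 0) (by rw [d2.deriv]; exact hpos) (by simpa using h'.eq_zero hΩ hx)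
  have hc : Tendsto (fun t : ℝ => x₀ + t • e) (𝓝 0) (𝓝 x₀) := by
    have : Continuous fun t : ℝ => x₀ + t • e := by fun_prop
    simpa using this.tendsto 0
  have s3 := hc.eventually h.2.2
  have s4 := hc.eventually h'.2.2
  have s5 : ∀ᶠ t : ℝ in 𝓝[>] 0, 0 < t := self_mem_nhdsWithin
  obtain ⟨t, ht, h1, h2, h3, h4⟩ :=
    (s5.and (nhdsWithin_le_nhds (s1.and (s2.and (s3.and s4))))).exists
  rw [zero_sub, sign_neg (neg_lt_zero.2 ht), sign_eq_neg_one_iff] at h1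
  rw [sub_zero, sign_pos ht, sign_eq_one_iff] at h2
  have := h4.1 (h3.2 h1)
  linarith

/-- The outward unit normal does not depend on the choice of the defining function. -/
theorem IsOutwardUnitNormal.eq (hΩ : IsOpen Ω) (hx : x₀ ∈ frontier Ω) {n : Space d}
    (hn : IsOutwardUnitNormal Ω x₀ n) (h : IsLocalDefiningFunction Ω x₀ ρ) :
    n = ‖gradient ρ x₀‖⁻¹ • gradient ρ x₀ := by
  obtain ⟨σ, hσ, rfl⟩ := hn
  set a := gradient σ x₀
  set b := gradient ρ x₀
  have ha : a ≠ 0 := hσ.2.1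
  have hb : b ≠ 0 := h.2.1
  set a' := ‖a‖⁻¹ • a
  set b' := ‖b‖⁻¹ • b
  have ha' : ‖a'‖ = 1 := norm_smul_inv_norm ha
  have hb' : ‖b'‖ = 1 := norm_smul_inv_norm hb
  by_contra hne
  -- if the unit normals differ, the direction `b' - a'` enters `Ω` for `σ` and leaves it for `ρ`
  have hlt : inner ℝ a' b' < 1 :=
    (inner_lt_one_iff_real_of_norm_eq_one ha' hb').2 hne
  have e1 : inner ℝ a (b' - a') < 0 := by
    have h1 : inner ℝ a' (b' - a') < 0 := by
      rw [inner_sub_right, real_inner_self_eq_norm_sq, ha']; linarith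
    rw [inner_smul_left] at h1
    simp only [map_inv₀, conj_trivial] at h1
    by_contra hge
    have := mul_nonneg (inv_nonneg.2 (norm_nonneg a)) (not_lt.1 hge)
    linarith
  have e2 : 0 < inner ℝ b (b' - a') := by
    have h1 : 0 < inner ℝ b' (b' - a') := by
      rw [inner_sub_right, real_inner_self_eq_norm_sq, hb', real_inner_comm]; linarith
    rw [inner_smul_left] at h1
    simp only [map_inv₀, conj_trivial] at h1
    exact pos_of_mul_pos_right h1 (inv_nonneg.2 (norm_nonneg b))
  linarith [hσ.inner_gradient_nonpos hΩ hx h e1]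

/-- Close to a boundary point, the part of `∇ρ` that is orthogonal to an extension `N` of the
normal vector is controlled by `|ρ|`: it vanishes on the boundary, and a boundary point
is reached from `x` by moving a distance of order `|ρ(x)|` along a fixed direction. -/
theorem IsLocalDefiningFunction.exists_tangential_bound (hΩ : IsOpen Ω) (hx : x₀ ∈ frontier Ω)
    (h : IsLocalDefiningFunction Ω x₀ ρ) {N : Space d → Space d} (hN : ContDiff ℝ ∞ N)
    (hNn : ∀ x ∈ frontier Ω, IsOutwardUnitNormal Ω x (N x)) :
    ∃ r > 0, ∃ C : ℝ, (∀ x ∈ Metric.ball x₀ r, (x ∈ Ω ↔ ρ x < 0)) ∧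
      ∀ x ∈ Metric.ball x₀ r, x ∈ Ω →
        ‖gradient ρ x - inner ℝ (N x) (gradient ρ x) • N x‖ ≤ C * |ρ x| := by
  have hGc := contDiff_gradient h.1
  set G := gradient ρ
  set a := G x₀
  have ha : 0 < ‖a‖ := norm_pos_iff.2 h.2.1
  set P : Space d → Space d := fun x => G x - inner ℝ (N x) (G x) • N x
  have hP : ContDiff ℝ ∞ P := hGc.sub ((hN.inner ℝ hGc).smul hN)
  obtain ⟨K, t, ht, hK⟩ := ((hP.contDiffAt (x := x₀)).hasStrictFDerivAt
    (by simp)).exists_lipschitzOnWith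
  set c : ℝ := ‖a‖ ^ 2 / 2
  have hc : 0 < c := by positivity
  have hGa : ∀ᶠ y in 𝓝 x₀, c < inner ℝ (G y) a := by
    have h1 : Continuous fun y => inner ℝ (G y) a := hGc.continuous.inner continuous_const
    refine (h1.tendsto x₀).eventually (lt_mem_nhds ?_)
    rw [real_inner_self_eq_norm_sq]; simp only [c]; nlinarith
  obtain ⟨r₁, hr₁, hball⟩ := Metric.eventually_nhds_iff_ball.1 (h.2.2.and (hGa.and ht))
  have hsmall : ∀ᶠ y in 𝓝 x₀, |ρ y| / c * ‖a‖ < r₁ / 2 := by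
    have h1 : Continuous fun y => |ρ y| / c * ‖a‖ :=
      (h.1.continuous.abs.div_const c).mul continuous_const
    refine (h1.tendsto x₀).eventually (gt_mem_nhds ?_)
    rw [h.eq_zero hΩ hx]; simpa using hr₁
  obtain ⟨r₂, hr₂, hball₂⟩ := Metric.eventually_nhds_iff_ball.1 hsmall
  refine ⟨min (r₁ / 2) r₂, lt_min (by positivity) hr₂, K * ‖a‖ / c, fun x hxb => ?_,
    fun y hyb hyΩ => ?_⟩
  · exact (hball x (Metric.ball_subset_ball (by linarith [min_le_left (r₁ / 2) r₂]) hxb)).1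
  have hy₁ : dist y x₀ < r₁ / 2 := lt_of_lt_of_le hyb (min_le_left _ _)
  have hy₂ := hball₂ y (Metric.ball_subset_ball (min_le_right _ _) hyb)
  have hyρ : ρ y < 0 := ((hball y (by rw [Metric.mem_ball]; linarith)).1).1 hyΩ
  -- along `y + s a` the function `ρ` grows with speed at least `c`, so it vanishes for some `s ≤ τ`
  set τ : ℝ := |ρ y| / c
  have hτ : 0 < τ := div_pos (abs_pos.2 hyρ.ne) hc
  have hin : ∀ s ∈ Icc 0 τ, y + s • a ∈ Metric.ball x₀ r₁ := by
    intro s hs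
    rw [Metric.mem_ball]
    calc dist (y + s • a) x₀ ≤ dist (y + s • a) y + dist y x₀ := dist_triangle _ _ _
      _ < r₁ / 2 + r₁ / 2 := by
          refine add_lt_add_of_le_of_lt ?_ hy₁
          rw [dist_eq_norm, add_sub_cancel_left, norm_smul, Real.norm_of_nonneg hs.1]
          exact (mul_le_mul_of_nonneg_right hs.2 (norm_nonneg a)).trans hy₂.le
      _ = r₁ := by ring
  set g : ℝ → ℝ := fun s => ρ (y + s • a)
  have hg : ∀ s, HasDerivAt g (inner ℝ (G (y + s • a)) a) s := hasDerivAt_line h.1 y a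
  have hgc : Continuous g := continuous_iff_continuousAt.2 fun s => (hg s).continuousAt
  have hmono := (convex_Icc 0 τ).mul_sub_le_image_sub_of_le_deriv (f := g) (C := c)
    hgc.continuousOn (fun s _ => (hg s).differentiableAt.differentiableWithinAt)
    (fun s hs => by rw [(hg s).deriv]; exact (hball _ (hin s (interior_subset hs))).2.1.le)
  have hg0 : g 0 = ρ y := by simp [g]
  have hgτ : 0 ≤ g τ := by
    have := hmono 0 ⟨le_rfl, hτ.le⟩ τ ⟨hτ.le, le_rfl⟩ hτ.le
    have h1 : c * τ = |ρ y| := mul_div_cancel₀ _ hc.ne'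
    rw [hg0, sub_zero, h1, abs_of_neg hyρ] at this
    linarith
  obtain ⟨s, hs, hgs⟩ := intermediate_value_Icc hτ.le hgc.continuousOn
    (show (0 : ℝ) ∈ Icc (g 0) (g τ) from ⟨by rw [hg0]; exact hyρ.le, hgτ⟩)
  have hs0 : 0 < s := by
    rcases hs.1.eq_or_lt with h0 | h0
    · rw [← h0, hg0] at hgs; linarith
    · exact h0
  set z := y + s • a
  have hzb := hball z (hin s hs)
  have hzΩ : z ∉ Ω := fun hz => by
    have := hzb.1.1 hz
    change g s < 0 at this
    linarith
  have hzcl : z ∈ closure Ω := by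
    have htend : Tendsto (fun q : ℝ => y + q • a) (𝓝[<] s) (𝓝 z) :=
      ((by fun_prop : Continuous fun q : ℝ => y + q • a).tendsto s).mono_left nhdsWithin_le_nhds
    refine mem_closure_of_tendsto htend ?_
    filter_upwards [Ioo_mem_nhdsLT hs0] with q hq
    have hqm : q ∈ Icc 0 τ := ⟨hq.1.le, hq.2.le.trans hs.2⟩
    refine (hball _ (hin q hqm)).1.2 ?_
    have h1 := hmono q hqm s hs hq.2.le
    have h2 := mul_pos hc (sub_pos.2 hq.2)
    change g q < 0
    linarith
  have hzf : z ∈ frontier Ω := by rw [hΩ.frontier_eq]; exact ⟨hzcl, hzΩ⟩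
  have hGz : G z ≠ 0 := by
    intro h0
    have := hzb.2.1
    rw [h0, inner_zero_left] at this
    linarith
  have hdef : IsLocalDefiningFunction Ω z ρ :=
    ⟨h.1, hGz, by
      filter_upwards [Metric.isOpen_ball.mem_nhds (hin s hs)] with q hq using (hball q hq).1⟩
  have hPz : P z = 0 := by
    have hNz := (hNn z hzf).eq hΩ hzf hdef
    have hGz' : ‖G z‖ ≠ 0 := norm_ne_zero_iff.2 hGz
    simp only [P]
    rw [hNz, inner_smul_left, real_inner_self_eq_norm_sq, smul_smul]
    simp only [map_inv₀, conj_trivial]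
    rw [show ‖G z‖⁻¹ * ‖G z‖ ^ 2 * ‖G z‖⁻¹ = 1 by field_simp, one_smul, sub_self]
  have hyt : y ∈ t := (hball y (by rw [Metric.mem_ball]; linarith)).2.2
  have hL := hK.dist_le_mul y hyt z hzb.2.2
  rw [hPz, dist_zero_right, dist_eq_norm, show y - z = -(s • a) by simp [z], norm_neg, norm_smul,
    Real.norm_of_nonneg hs.1] at hL
  calc ‖P y‖ ≤ K * (s * ‖a‖) := hL
    _ ≤ K * (τ * ‖a‖) := by gcongr; exact hs.2
    _ = K * ‖a‖ / c * |ρ y| := by simp only [τ]; ring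

end Geometry

/-! ### Green's formula for fields with vanishing normal component -/

section Green

variable {d : ℕ} {Ω : Set (Space d)}

/-- The pairing `∫_Ω (∇(ζψ) · R + ζψ div R)` of a vector field `R` with a cut-off `ζψ` of a Sobolev
function `ψ`; here `R' i j` stands for `∂ⱼRᵢ` and `ψ' i` for `∂ᵢψ`. -/
noncomputable def greenPairing (Ω : Set (Space d)) (R : Fin d → Space d → ℝ)
    (R' : Fin d → Fin d → Space d → ℝ) (ψ : Space d → ℝ) (ψ' : Fin d → Space d → ℝ)
    (ζ : Space d → ℝ) : ℝ :=
  ∫ x in Ω, (∑ i, ψ x * R i x * fderiv ℝ ζ x (unitVec i) +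
    ζ x * ∑ i, (ψ x * R' i i x + ψ' i x * R i x))

variable {R : Fin d → Space d → ℝ} {R' : Fin d → Fin d → Space d → ℝ}
    {ψ : Space d → ℝ} {ψ' : Fin d → Space d → ℝ}

theorem exists_bound_of_continuous_of_isBounded {V : Type*} [NormedAddCommGroup V]
    [ProperSpace V] {D : Set V} (hD : Bornology.IsBounded D) {m : V → ℝ} (hm : Continuous m) :
    ∃ C, ∀ x ∈ D, |m x| ≤ C := by
  obtain ⟨C, hC⟩ := hD.isCompact_closure.exists_bound_of_continuousOn hm.continuousOn
  exact ⟨C, fun x hx => hC x (subset_closure hx)⟩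

theorem integrable_bounded_mul {V : Type*} [NormedAddCommGroup V] [ProperSpace V]
    [MeasurableSpace V] [BorelSpace V] {μ : Measure V} {D : Set V} (hDm : MeasurableSet D)
    (hD : Bornology.IsBounded D) {m f : V → ℝ} (hm : Continuous m)
    (hf : Integrable f (μ.restrict D)) : Integrable (fun x => f x * m x) (μ.restrict D) := by
  obtain ⟨C, hC⟩ := exists_bound_of_continuous_of_isBounded hD hm
  refine hf.mul_bdd (c := C) hm.aestronglyMeasurable ?_
  filter_upwards [ae_restrict_mem hDm] with x hx using hC x hx

/-- For a cut-off with compact support in `Ω`, the pairing is the integral of a divergence. -/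
theorem greenPairing_testFunction (hΩo : IsOpen Ω) (hΩv : volume Ω ≠ ⊤)
    (hR : ∀ i, MemLp (R i) 2 (volume.restrict Ω))
    (hR' : ∀ i j, MemLp (R' i j) 2 (volume.restrict Ω))
    (hRR' : ∀ i j, HasWeakDeriv Ω (unitVec j) (R i) (R' i j))
    (hψ : MemLp ψ 2 (volume.restrict Ω)) (hψ' : ∀ i, MemLp (ψ' i) 2 (volume.restrict Ω))
    (hψψ' : ∀ i, HasWeakDeriv Ω (unitVec i) ψ (ψ' i)) {ζ : Space d → ℝ}
    (hζ : IsTestFunction Ω ζ) : greenPairing Ω R R' ψ ψ' ζ = 0 := by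
  have key : ∀ i, ∫ x in Ω, (ψ x * R i x * fderiv ℝ ζ x (unitVec i) +
      ζ x * (ψ x * R' i i x + ψ' i x * R i x)) = 0 := by
    intro i
    have h := (hψψ' i).mul hΩo hΩv hψ (hR i) (hψ' i) (hR' i i) (hRR' i i) ζ hζ
    obtain ⟨C, hC⟩ := hζ.bounded
    obtain ⟨C', hC'⟩ := (hζ.fderiv (unitVec i)).bounded
    rw [integral_add, h]
    · rw [neg_add_eq_zero]; congr 1; ext x; ring
    · exact (integrable_mul_of_memLp hψ (hR i)).mul_bdd (c := C')
        (hζ.fderiv (unitVec i)).1.continuous.aestronglyMeasurable (Eventually.of_forall hC')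
    · exact ((integrable_mul_of_memLp hψ (hR' i i)).add
        (integrable_mul_of_memLp (hψ' i) (hR i))).bdd_mul (c := C)
          hζ.1.continuous.aestronglyMeasurable (Eventually.of_forall hC)
  unfold greenPairing
  simp_rw [Finset.mul_sum, ← Finset.sum_add_distrib]
  rw [integral_finsetSum]
  · exact Finset.sum_eq_zero fun i _ => key i
  · intro i _
    obtain ⟨C, hC⟩ := hζ.bounded
    obtain ⟨C', hC'⟩ := (hζ.fderiv (unitVec i)).bounded
    exact ((integrable_mul_of_memLp hψ (hR i)).mul_bdd (c := C')
        (hζ.fderiv (unitVec i)).1.continuous.aestronglyMeasurable (Eventually.of_forall hC')).add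
      (((integrable_mul_of_memLp hψ (hR' i i)).add
        (integrable_mul_of_memLp (hψ' i) (hR i))).bdd_mul (c := C)
          hζ.1.continuous.aestronglyMeasurable (Eventually.of_forall hC))

theorem integrable_greenPairing (hΩo : IsOpen Ω) (hΩb : Bornology.IsBounded Ω)
    (hR : ∀ i, MemLp (R i) 2 (volume.restrict Ω))
    (hR' : ∀ i j, MemLp (R' i j) 2 (volume.restrict Ω))
    (hψ : MemLp ψ 2 (volume.restrict Ω)) (hψ' : ∀ i, MemLp (ψ' i) 2 (volume.restrict Ω))
    {ζ : Space d → ℝ} (hζ : ContDiff ℝ ∞ ζ) :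
    Integrable (fun x => ∑ i, ψ x * R i x * fderiv ℝ ζ x (unitVec i) +
      ζ x * ∑ i, (ψ x * R' i i x + ψ' i x * R i x)) (volume.restrict Ω) := by
  refine (integrable_finsetSum _ fun i _ => ?_).add ?_
  · exact integrable_bounded_mul hΩo.measurableSet hΩb (continuous_fderiv_apply hζ _)
      (integrable_mul_of_memLp hψ (hR i))
  · simp_rw [mul_comm (ζ _)]
    exact integrable_bounded_mul hΩo.measurableSet hΩb hζ.continuous
      (integrable_finsetSum _ fun i _ => (integrable_mul_of_memLp hψ (hR' i i)).add
        (integrable_mul_of_memLp (hψ' i) (hR i)))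

theorem deriv_smoothTransition_eq_zero {t : ℝ} (ht : t ∉ Icc (0 : ℝ) 1) :
    deriv Real.smoothTransition t = 0 := by
  rcases not_and_or.1 ht with h | h
  · have : Real.smoothTransition =ᶠ[𝓝 t] fun _ => 0 := by
      filter_upwards [gt_mem_nhds (not_le.1 h)] with s hs
      exact Real.smoothTransition.zero_of_nonpos hs.le
    rw [this.deriv_eq, deriv_const]
  · have : Real.smoothTransition =ᶠ[𝓝 t] fun _ => 1 := by
      filter_upwards [lt_mem_nhds (not_le.1 h)] with s hs
      exact Real.smoothTransition.one_of_one_le hs.le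
    rw [this.deriv_eq, deriv_const]

theorem smoothTransition_deriv_bound :
    ∃ B : ℝ, 0 ≤ B ∧ ∀ t, |deriv Real.smoothTransition t| ≤ B := by
  have hcont : Continuous (deriv Real.smoothTransition) :=
    (Real.smoothTransition.contDiff (n := 1)).continuous_deriv le_rfl
  have hsupp : HasCompactSupport (deriv Real.smoothTransition) := by
    refine HasCompactSupport.intro (K := Icc 0 1) isCompact_Icc fun t ht =>
      deriv_smoothTransition_eq_zero ht
  obtain ⟨B, hB⟩ := hsupp.exists_bound_of_continuous hcont
  exact ⟨B, (norm_nonneg _).trans (hB 0), hB⟩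

/-- The Green pairing vanishes near a boundary point when the vector field is tangential to the
boundary in the strong sense that `|R · ∇ρ| ≤ |ρ| H` with `H ∈ L²`: the
boundary layer `∫ ζψ R · ∇η` of a cut-off `η` along the level sets of `ρ` tends to zero. -/
theorem greenPairing_boundary (hΩo : IsOpen Ω) (hΩb : Bornology.IsBounded Ω)
    (hR : ∀ i, MemLp (R i) 2 (volume.restrict Ω))
    (hR' : ∀ i j, MemLp (R' i j) 2 (volume.restrict Ω))
    (hRR' : ∀ i j, HasWeakDeriv Ω (unitVec j) (R i) (R' i j))
    (hψ : MemLp ψ 2 (volume.restrict Ω)) (hψ' : ∀ i, MemLp (ψ' i) 2 (volume.restrict Ω))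
    (hψψ' : ∀ i, HasWeakDeriv Ω (unitVec i) ψ (ψ' i)) {x₀ : Space d} {r : ℝ}
    {ρ : Space d → ℝ} (hρ : ContDiff ℝ ∞ ρ)
    (hρΩ : ∀ x ∈ Metric.ball x₀ r, (x ∈ Ω ↔ ρ x < 0)) {H : Space d → ℝ}
    (hH : MemLp H 2 (volume.restrict Ω))
    (hRρ : ∀ x ∈ Metric.ball x₀ r, x ∈ Ω →
      |∑ i, R i x * fderiv ℝ ρ x (unitVec i)| ≤ |ρ x| * H x) {ζ : Space d → ℝ}
    (hζ : ContDiff ℝ ∞ ζ) (hζc : HasCompactSupport ζ) (hζr : tsupport ζ ⊆ Metric.ball x₀ r) :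
    greenPairing Ω R R' ψ ψ' ζ = 0 := by
  have hΩv : volume Ω ≠ ⊤ := hΩb.measure_lt_top.ne
  obtain ⟨B, hB0, hB⟩ := smoothTransition_deriv_bound
  -- `η n` is `0` where `ρ ≥ -1/(n+1)` and `1` where `ρ ≤ -2/(n+1)`
  set η : ℕ → Space d → ℝ := fun n x => Real.smoothTransition (-((n + 1 : ℝ) * ρ x) - 1)
  have hη : ∀ n, ContDiff ℝ ∞ (η n) := fun n =>
    Real.smoothTransition.contDiff.comp (((contDiff_const.mul hρ).neg).sub contDiff_const)
  have hηd : ∀ n x e, fderiv ℝ (η n) x e =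
      deriv Real.smoothTransition (-((n + 1 : ℝ) * ρ x) - 1) *
        (-((n + 1 : ℝ) * fderiv ℝ ρ x e)) := by
    intro n x e
    have h1 : HasFDerivAt (fun x => -((n + 1 : ℝ) * ρ x) - 1) (-((n + 1 : ℝ) • fderiv ℝ ρ x)) x :=
      ((((hρ.differentiable (by simp)) x).hasFDerivAt.const_mul (n + 1 : ℝ)).neg).sub_const 1
    have h2 := ((Real.smoothTransition.contDiff (n := 1)).differentiable (by simp)
      (-((n + 1 : ℝ) * ρ x) - 1)).hasDerivAt.comp_hasFDerivAt x h1
    rw [show η n = Real.smoothTransition ∘ fun x => -((n + 1 : ℝ) * ρ x) - 1 from rfl, h2.fderiv]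
    simp
  have hη01 : ∀ n x, |η n x| ≤ 1 := fun n x => by
    rw [abs_of_nonneg (Real.smoothTransition.nonneg _)]
    exact Real.smoothTransition.le_one _
  have htest : ∀ n, IsTestFunction Ω fun x => η n x * ζ x := by
    intro n
    refine ⟨(hη n).mul hζ, hζc.mul_left, fun x hx => ?_⟩
    have hxζ : x ∈ tsupport ζ := tsupport_mul_subset_right hx
    have hxη : x ∈ tsupport (η n) := tsupport_mul_subset_left hx
    refine (hρΩ x (hζr hxζ)).2 ?_
    have hcl : IsClosed {y | (n + 1 : ℝ) * ρ y ≤ -1} :=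
      isClosed_le (continuous_const.mul hρ.continuous) continuous_const
    have hsub : tsupport (η n) ⊆ {y | (n + 1 : ℝ) * ρ y ≤ -1} := by
      refine closure_minimal (fun y hy => ?_) hcl
      by_contra hlt
      have hlt' : -1 < (n + 1 : ℝ) * ρ y := not_le.1 hlt
      exact hy (Real.smoothTransition.zero_of_nonpos (by linarith))
    have h1 : (n + 1 : ℝ) * ρ x ≤ -1 := hsub hxη
    have hn : (0 : ℝ) < n + 1 := by positivity
    by_contra hge
    nlinarith [mul_nonneg hn.le (not_lt.1 hge)]
  -- the integrand of the pairing, and the boundary layer created by the cut-off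
  set I : Space d → ℝ := fun x => ∑ i, ψ x * R i x * fderiv ℝ ζ x (unitVec i) +
    ζ x * ∑ i, (ψ x * R' i i x + ψ' i x * R i x)
  set J : ℕ → Space d → ℝ := fun n x => ζ x * ψ x * ∑ i, R i x * fderiv ℝ (η n) x (unitVec i)
  have hI : Integrable I (volume.restrict Ω) :=
    integrable_greenPairing hΩo hΩb hR hR' hψ hψ' hζ
  have hzero : ∀ n, ∫ x in Ω, (η n x * I x + J n x) = 0 := by
    intro n
    rw [← greenPairing_testFunction hΩo hΩv hR hR' hRR' hψ hψ' hψψ' (htest n)]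
    unfold greenPairing
    congr 1; ext x
    simp only [I, J]
    simp_rw [fderiv_mul_apply hζ (hη n)]
    have : ∑ i, ψ x * R i x * (η n x * fderiv ℝ ζ x (unitVec i) +
        fderiv ℝ (η n) x (unitVec i) * ζ x) =
        ∑ i, η n x * (ψ x * R i x * fderiv ℝ ζ x (unitVec i)) +
        ∑ i, ζ x * ψ x * (R i x * fderiv ℝ (η n) x (unitVec i)) := by
      rw [← Finset.sum_add_distrib]
      exact Finset.sum_congr rfl fun i _ => by ring
    rw [this, ← Finset.mul_sum, ← Finset.mul_sum]; ring
  obtain ⟨Cζ, hCζ⟩ := hζc.exists_bound_of_continuous hζ.continuous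
  have hbound : ∀ n, ∀ᵐ x ∂(volume.restrict Ω),
      ‖η n x * I x + J n x‖ ≤ |I x| + 2 * B * Cζ * (|ψ x| * |H x|) := by
    intro n
    filter_upwards [ae_restrict_mem hΩo.measurableSet] with x hxΩ
    have h1 : |η n x * I x| ≤ |I x| := by
      rw [abs_mul]
      exact mul_le_of_le_one_left (abs_nonneg _) (hη01 n x)
    have h2 : |J n x| ≤ 2 * B * Cζ * (|ψ x| * |H x|) := by
      have hCζ0 : 0 ≤ Cζ := (norm_nonneg _).trans (hCζ x)
      by_cases hx : x ∈ tsupport ζ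
      · have h3 : |∑ i, R i x * fderiv ℝ (η n) x (unitVec i)| ≤ 2 * B * |H x| := by
          set q : ℝ := -((n + 1 : ℝ) * ρ x) - 1 with hq
          have h4 : ∑ i, R i x * fderiv ℝ (η n) x (unitVec i) =
              -(deriv Real.smoothTransition q * (n + 1)) *
                ∑ i, R i x * fderiv ℝ ρ x (unitVec i) := by
            rw [Finset.mul_sum]
            refine Finset.sum_congr rfl fun i _ => ?_
            rw [hηd]; ring
          rw [h4]
          by_cases hqI : q ∈ Icc (0 : ℝ) 1
          · have hρn : (n + 1 : ℝ) * |ρ x| ≤ 2 := by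
              rw [abs_of_neg ((hρΩ x (hζr hx)).1 hxΩ)]
              linarith [hqI.2]
            have hn : (0 : ℝ) < n + 1 := by positivity
            rw [abs_mul, abs_neg, abs_mul, abs_of_pos hn]
            calc |deriv Real.smoothTransition q| * (n + 1) * |∑ i, R i x * fderiv ℝ ρ x (unitVec i)|
                ≤ B * (n + 1) * (|ρ x| * |H x|) := by
                  gcongr
                  · exact hB q
                  · exact (hRρ x (hζr hx) hxΩ).trans (by gcongr; exact le_abs_self _)
              _ = B * (((n + 1 : ℝ) * |ρ x|) * |H x|) := by ring
              _ ≤ B * (2 * |H x|) := by gcongr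
              _ = 2 * B * |H x| := by ring
          · rw [deriv_smoothTransition_eq_zero hqI]
            simp; positivity
        calc |J n x| = |ζ x| * |ψ x| * |∑ i, R i x * fderiv ℝ (η n) x (unitVec i)| := by
              simp only [J, abs_mul]
          _ ≤ Cζ * |ψ x| * (2 * B * |H x|) := by gcongr; exact hCζ x
          _ = _ := by ring
      · simp only [J, image_eq_zero_of_notMem_tsupport hx, zero_mul, abs_zero]
        positivity
    rw [Real.norm_eq_abs]
    exact (abs_add_le _ _).trans (add_le_add h1 h2)
  have hlim : ∀ᵐ x ∂(volume.restrict Ω),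
      Tendsto (fun n => η n x * I x + J n x) atTop (𝓝 (I x)) := by
    filter_upwards [ae_restrict_mem hΩo.measurableSet] with x hxΩ
    by_cases hx : x ∈ tsupport ζ
    · have hρx := (hρΩ x (hζr hx)).1 hxΩ
      have ht : Tendsto (fun n : ℕ => -((n + 1 : ℝ) * ρ x) - 1) atTop atTop := by
        have h1 : Tendsto (fun n : ℕ => (n + 1 : ℝ)) atTop atTop :=
          tendsto_atTop_add_const_right _ _ tendsto_natCast_atTop_atTop
        have h2 := h1.atTop_mul_const (neg_pos.2 hρx)
        have h3 := tendsto_atTop_add_const_right _ (-1) h2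
        refine h3.congr fun n => by ring
      refine tendsto_const_nhds.congr' ?_
      filter_upwards [ht.eventually (eventually_gt_atTop 1)] with n hn
      have e1 : η n x = 1 := Real.smoothTransition.one_of_one_le hn.le
      have e2 : deriv Real.smoothTransition (-((n + 1 : ℝ) * ρ x) - 1) = 0 :=
        deriv_smoothTransition_eq_zero fun h => by linarith [h.2]
      simp only [J, e1, hηd, e2, zero_mul, mul_zero, Finset.sum_const_zero, add_zero, one_mul]
    · have hI0 : I x = 0 := by
        simp only [I, image_eq_zero_of_notMem_tsupport hx, zero_mul, add_zero]
        have : ∀ e, fderiv ℝ ζ x e = 0 := fun e => by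
          rw [image_eq_zero_of_notMem_tsupport fun h => hx (tsupport_fderiv_subset ℝ h)]; rfl
        simp [this]
      simp only [J, hI0, image_eq_zero_of_notMem_tsupport hx, zero_mul, mul_zero, add_zero]
      exact tendsto_const_nhds
  have hdom := tendsto_integral_of_dominated_convergence
    (fun x => |I x| + 2 * B * Cζ * (|ψ x| * |H x|)) (fun n => ?_)
    (hI.abs.add ((integrable_mul_of_memLp hψ.abs hH.abs).const_mul _)) hbound hlim
  · simp_rw [hzero] at hdom
    exact (tendsto_nhds_unique hdom tendsto_const_nhds).symm ▸ rfl
  · refine ((hη n).continuous.aestronglyMeasurable.mul hI.1).add ?_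
    refine (hζ.continuous.aestronglyMeasurable.mul hψ.1).mul ?_
    refine Finset.aestronglyMeasurable_fun_sum _ fun i _ => ?_
    exact (hR i).1.mul (continuous_fderiv_apply (hη n) _).aestronglyMeasurable

/-- A finite cover by balls globalizes the vanishing of the Green pairing. -/
theorem greenPairing_of_local (hΩo : IsOpen Ω) (hΩb : Bornology.IsBounded Ω)
    (hR : ∀ i, MemLp (R i) 2 (volume.restrict Ω))
    (hR' : ∀ i j, MemLp (R' i j) 2 (volume.restrict Ω))
    (hψ : MemLp ψ 2 (volume.restrict Ω)) (hψ' : ∀ i, MemLp (ψ' i) 2 (volume.restrict Ω))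
    (hloc : ∀ x₀ ∈ closure Ω, ∃ r > 0, ∀ ζ : Space d → ℝ, ContDiff ℝ ∞ ζ → HasCompactSupport ζ →
      tsupport ζ ⊆ Metric.ball x₀ r → greenPairing Ω R R' ψ ψ' ζ = 0) :
    greenPairing Ω R R' ψ ψ' (fun _ => 1) = 0 := by
  choose! r hr hloc using hloc
  let f : ∀ x₀ : closure Ω, ContDiffBump (x₀ : Space d) := fun x₀ =>
    ⟨r x₀ / 4, r x₀ / 2, by have := hr x₀ x₀.2; positivity, by have := hr x₀ x₀.2; linarith⟩
  obtain ⟨t, ht⟩ := hΩb.isCompact_closure.elim_finite_subcover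
    (fun x₀ : closure Ω => Metric.ball (x₀ : Space d) (r x₀ / 4)) (fun _ => Metric.isOpen_ball)
    (fun x hx => mem_iUnion.2 ⟨⟨x, hx⟩, Metric.mem_ball_self (by have := hr x hx; positivity)⟩)
  have hf : ∀ x₀, ContDiff ℝ ∞ (f x₀) := fun x₀ => (f x₀).contDiff
  have hprod : ∀ s : Finset (closure Ω), ContDiff ℝ ∞ fun x => ∏ k ∈ s, (1 - f k x) := fun s =>
    contDiff_prod fun k _ => contDiff_const.sub (hf k)
  -- multiplying the cut-off by `1 - f k` does not change the pairing
  have hstep : ∀ s : Finset (closure Ω), greenPairing Ω R R' ψ ψ' (fun _ => 1) =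
      greenPairing Ω R R' ψ ψ' (fun x => ∏ k ∈ s, (1 - f k x)) := by
    intro s
    induction s using Finset.induction_on with
    | empty => simp
    | insert k s hk ih =>
      rw [ih]
      set ζ : Space d → ℝ := fun x => ∏ k ∈ s, (1 - f k x) with hζ
      have hζc : ContDiff ℝ ∞ ζ := hprod s
      have h0 := hloc k k.2 (fun x => ζ x * f k x) (hζc.mul (hf k))
        (f k).hasCompactSupport.mul_left (by
          refine (tsupport_mul_subset_right).trans ?_
          rw [(f k).tsupport_eq]
          exact Metric.closedBall_subset_ball (by have := hr k k.2; change r k / 2 < r k; linarith))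
      have h1 : (fun x => ∏ j ∈ insert k s, (1 - f j x)) = fun x => ζ x - ζ x * f k x := by
        ext x; rw [Finset.prod_insert hk]; ring
      rw [h1, ← sub_zero (greenPairing Ω R R' ψ ψ' ζ), ← h0]
      unfold greenPairing
      rw [← integral_sub (integrable_greenPairing hΩo hΩb hR hR' hψ hψ' hζc)
        (integrable_greenPairing hΩo hΩb hR hR' hψ hψ' (hζc.mul (hf k)))]
      congr 1; ext x
      have hd : ∀ e, fderiv ℝ (fun x => ζ x - ζ x * f k x) x e =
          fderiv ℝ ζ x e - fderiv ℝ (fun x => ζ x * f k x) x e := fun e => by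
        rw [fderiv_fun_sub (hζc.differentiable (by simp) x)
          ((hζc.mul (hf k)).differentiable (by simp) x)]
        rfl
      simp_rw [hd, mul_sub, Finset.sum_sub_distrib]
      ring
  -- and after finitely many steps the cut-off vanishes on `Ω`
  rw [hstep t]
  unfold greenPairing
  have hz : ∀ x ∈ Ω, ∏ k ∈ t, (1 - f k x) = 0 := by
    intro x hx
    obtain ⟨k, hkt, hk⟩ := mem_iUnion₂.1 (ht (subset_closure hx))
    refine Finset.prod_eq_zero hkt ?_
    rw [(f k).one_of_mem_closedBall (Metric.ball_subset_closedBall hk), sub_self]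
  refine setIntegral_eq_zero_of_forall_eq_zero fun x hx => ?_
  have hd : fderiv ℝ (fun x => ∏ k ∈ t, (1 - f k x)) x = 0 := by
    have : (fun x => ∏ k ∈ t, (1 - f k x)) =ᶠ[𝓝 x] fun _ => 0 := by
      filter_upwards [hΩo.mem_nhds hx] with y hy using hz y hy
    rw [this.fderiv_eq]; simp
  dsimp only
  rw [hd, hz x hx]; simp

theorem fderiv_unitVec_eq (ρ : Space d → ℝ) (x : Space d) (i : Fin d) :
    fderiv ℝ ρ x (unitVec i) = gradient ρ x i := by
  rw [← inner_gradient_eq, unitVec, EuclideanSpace.inner_single_right]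
  simp

/-- Green's formula `∫_Ω ψ div F + ∇ψ · F = 0` for a vector field `F ∈ H¹(Ω)` whose normal component
`F · N` belongs to `H¹₀(Ω)`, that is, `F · N` is a limit in `H¹` of test functions `φ n`. The field
splits into `(F · N) N`, for which the formula passes to the limit from `φ n`, and a tangential
remainder, which produces no boundary layer. -/
theorem green_of_normal_component_zero (hΩ : IsSmoothBoundedDomain Ω)
    {N : Space d → Space d} (hN : ContDiff ℝ ∞ N)
    (hNn : ∀ x ∈ frontier Ω, IsOutwardUnitNormal Ω x (N x))
    {F : Fin d → Space d → ℝ} {F' : Fin d → Fin d → Space d → ℝ}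
    (hF : ∀ i, MemLp (F i) 2 (volume.restrict Ω))
    (hF' : ∀ i j, MemLp (F' i j) 2 (volume.restrict Ω))
    (hFF' : ∀ i j, HasWeakDeriv Ω (unitVec j) (F i) (F' i j))
    {φ : ℕ → Space d → ℝ} (hφ : ∀ n, IsTestFunction Ω (φ n)) {h : Fin d → Space d → ℝ}
    (hφF : TendstoL2 (volume.restrict Ω) φ (fun x => ∑ i, F i x * N x i))
    (hφh : ∀ i, TendstoL2 (volume.restrict Ω) (fun n x => fderiv ℝ (φ n) x (unitVec i)) (h i))
    (hψ : MemLp ψ 2 (volume.restrict Ω)) (hψ' : ∀ i, MemLp (ψ' i) 2 (volume.restrict Ω))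
    (hψψ' : ∀ i, HasWeakDeriv Ω (unitVec i) ψ (ψ' i)) :
    ∫ x in Ω, ∑ i, (ψ x * F' i i x + ψ' i x * F i x) = 0 := by
  have hΩo := hΩ.isOpen
  have hΩb := hΩ.isBounded
  have hΩv : volume Ω ≠ ⊤ := hΩb.measure_lt_top.ne
  set w : Space d → ℝ := fun x => ∑ i, F i x * N x i with hw
  have hwm : MemLp w 2 (volume.restrict Ω) := hφF.memLp_lim
  have hhm : ∀ i, MemLp (h i) 2 (volume.restrict Ω) := fun i => (hφh i).memLp_lim
  have hwh : ∀ i, HasWeakDeriv Ω (unitVec i) w (h i) := fun i =>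
    HasWeakDeriv.of_tendstoL2 (fun n => (hφ n).hasWeakDeriv _) hφF (hφh i)
  have hNi : ∀ i, ContDiff ℝ ∞ fun x => N x i := fun i =>
    (contDiff_piLp_apply (p := 2) (i := i)).comp hN
  have hbm : ∀ {m f : Space d → ℝ}, Continuous m → MemLp f 2 (volume.restrict Ω) →
      MemLp (fun x => m x * f x) 2 (volume.restrict Ω) := by
    intro m f hm hf
    obtain ⟨C, hC⟩ := exists_bound_of_continuous_of_isBounded hΩb hm
    exact ((TendstoL2.const hf).bounded_mul (C := C) hm.aestronglyMeasurable
      (by filter_upwards [ae_restrict_mem hΩo.measurableSet] with x hx using hC x hx)).memLp_lim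
  have hbt : ∀ {m f : Space d → ℝ} {g : ℕ → Space d → ℝ}, Continuous m →
      TendstoL2 (volume.restrict Ω) g f →
      TendstoL2 (volume.restrict Ω) (fun n x => m x * g n x) (fun x => m x * f x) := by
    intro m f g hm hf
    obtain ⟨C, hC⟩ := exists_bound_of_continuous_of_isBounded hΩb hm
    exact hf.bounded_mul (C := C) hm.aestronglyMeasurable
      (by filter_upwards [ae_restrict_mem hΩo.measurableSet] with x hx using hC x hx)
  -- the normal part
  set W' : Fin d → Fin d → Space d → ℝ := fun i j x =>
    N x i * h j x + fderiv ℝ (fun x => N x i) x (unitVec j) * w x with hW'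
  have hWm : ∀ i, MemLp (fun x => N x i * w x) 2 (volume.restrict Ω) := fun i =>
    hbm (hNi i).continuous hwm
  have hW'm : ∀ i j, MemLp (W' i j) 2 (volume.restrict Ω) := fun i j =>
    (hbm (hNi i).continuous (hhm j)).add (hbm (continuous_fderiv_apply (hNi i) _) hwm)
  have hWW' : ∀ i j, HasWeakDeriv Ω (unitVec j) (fun x => N x i * w x) (W' i j) := fun i j =>
    (hwh j).smooth_mul hwm (hhm j) (hNi i)
  have hnormal : ∀ i, ∫ x in Ω, (ψ x * W' i i x + ψ' i x * (N x i * w x)) = 0 := by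
    intro i
    have l1 := (TendstoL2.const hψ).integral_mul
      ((hbt (hNi i).continuous (hφh i)).add (hbt (continuous_fderiv_apply (hNi i) (unitVec i)) hφF))
    have l2 := ((TendstoL2.const (hψ' i)).integral_mul (hbt (hNi i).continuous hφF)).neg
    have e : ∀ n, ∫ x in Ω, ψ x * (N x i * fderiv ℝ (φ n) x (unitVec i) +
        fderiv ℝ (fun x => N x i) x (unitVec i) * φ n x) =
        - ∫ x in Ω, ψ' i x * (N x i * φ n x) := by
      intro n
      have := hψψ' i _ ((hφ n).mul_left (hNi i))
      simp_rw [fderiv_mul_apply (hφ n).1 (hNi i)] at this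
      exact this
    simp_rw [e] at l1
    have := tendsto_nhds_unique l1 l2
    rw [integral_add (integrable_mul_of_memLp hψ (hW'm i i))
      (integrable_mul_of_memLp (hψ' i) (hWm i))]
    exact add_eq_zero_iff_eq_neg.2 this
  -- the tangential part
  set R : Fin d → Space d → ℝ := fun i x => F i x + (-1) * (N x i * w x) with hRdef
  set R' : Fin d → Fin d → Space d → ℝ := fun i j x => F' i j x + (-1) * W' i j x with hR'def
  have hR : ∀ i, MemLp (R i) 2 (volume.restrict Ω) := fun i => (hF i).add ((hWm i).const_mul _)
  have hR' : ∀ i j, MemLp (R' i j) 2 (volume.restrict Ω) := fun i j =>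
    (hF' i j).add ((hW'm i j).const_mul _)
  have hRR' : ∀ i j, HasWeakDeriv Ω (unitVec j) (R i) (R' i j) := fun i j =>
    HasWeakDeriv.add (hF i) ((hWm i).const_mul _) (hF' i j) ((hW'm i j).const_mul _) (hFF' i j)
      ((hWW' i j).const_mul _)
  have htang : greenPairing Ω R R' ψ ψ' (fun _ => 1) = 0 := by
    refine greenPairing_of_local hΩo hΩb hR hR' hψ hψ' fun x₀ hx₀ => ?_
    by_cases hx₀Ω : x₀ ∈ Ω
    · obtain ⟨r, hr, hball⟩ := Metric.isOpen_iff.1 hΩo x₀ hx₀Ω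
      exact ⟨r, hr, fun ζ h1 h2 h3 => greenPairing_testFunction hΩo hΩv hR hR' hRR' hψ hψ' hψψ'
        ⟨h1, h2, h3.trans hball⟩⟩
    have hx₀f : x₀ ∈ frontier Ω := by rw [hΩo.frontier_eq]; exact ⟨hx₀, hx₀Ω⟩
    obtain ⟨ρ, hρ⟩ := hΩ.smooth_boundary x₀ hx₀f
    obtain ⟨r, hr, C, hrΩ, hC⟩ := hρ.exists_tangential_bound hΩo hx₀f hN hNn
    refine ⟨r, hr, fun ζ h1 h2 h3 => greenPairing_boundary hΩo hΩb hR hR' hRR' hψ hψ' hψψ' hρ.1 hrΩ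
      (H := fun x => ∑ i, |F i x| * C) (memLp_finsetSum _ fun i _ => (hF i).abs.mul_const C)
      (fun x hxb hxΩ => ?_) h1 h2 h3⟩
    -- `R · ∇ρ = F · P` with `P = ∇ρ - (N · ∇ρ) N`
    set P := gradient ρ x - inner ℝ (N x) (gradient ρ x) • N x
    have hP : ∑ i, R i x * fderiv ℝ ρ x (unitVec i) = ∑ i, F i x * P i := by
      have e1 : inner ℝ (N x) (gradient ρ x) = ∑ j, N x j * gradient ρ x j := by
        rw [PiLp.inner_apply]; exact Finset.sum_congr rfl fun j _ => by simp [mul_comm]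
      have e2 : ∀ i, P i = gradient ρ x i - (∑ j, N x j * gradient ρ x j) * N x i := fun i => by
        simp [P, e1]
      simp_rw [e2, fderiv_unitVec_eq, hRdef, hw, add_mul, mul_sub, Finset.sum_add_distrib,
        Finset.sum_sub_distrib]
      have e3 : ∑ i, -1 * (N x i * ∑ i, F i x * N x i) * gradient ρ x i =
          - ((∑ i, F i x * N x i) * ∑ j, N x j * gradient ρ x j) := by
        rw [Finset.mul_sum, ← Finset.sum_neg_distrib]
        exact Finset.sum_congr rfl fun i _ => by ring
      have e4 : ∑ i, F i x * ((∑ j, N x j * gradient ρ x j) * N x i) =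
          (∑ i, F i x * N x i) * ∑ j, N x j * gradient ρ x j := by
        rw [Finset.sum_mul]
        exact Finset.sum_congr rfl fun i _ => by ring
      rw [e3, e4]; ring
    rw [hP, Finset.mul_sum]
    refine (Finset.abs_sum_le_sum_abs _ _).trans (Finset.sum_le_sum fun i _ => ?_)
    rw [abs_mul]
    have h4 : |P i| ≤ C * |ρ x| := (PiLp.norm_apply_le P i).trans (hC x hxb hxΩ)
    calc |F i x| * |P i| ≤ |F i x| * (C * |ρ x|) := by gcongr
      _ = |ρ x| * (|F i x| * C) := by ring
  unfold greenPairing at htang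
  have e : ∀ x, ∑ i, (ψ x * F' i i x + ψ' i x * F i x) =
      (∑ i, ψ x * R i x * fderiv ℝ (fun _ : Space d => (1 : ℝ)) x (unitVec i) +
      1 * ∑ i, (ψ x * R' i i x + ψ' i x * R i x)) +
      ∑ i, (ψ x * W' i i x + ψ' i x * (N x i * w x)) := by
    intro x
    simp only [fderiv_fun_const, Pi.zero_apply, zero_apply, mul_zero,
      Finset.sum_const_zero, zero_add, one_mul, ← Finset.sum_add_distrib, hRdef, hR'def]
    exact Finset.sum_congr rfl fun i _ => by ring
  simp_rw [e]
  have hi : ∀ i, Integrable (fun x => ψ x * W' i i x + ψ' i x * (N x i * w x))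
      (volume.restrict Ω) := fun i =>
    (integrable_mul_of_memLp hψ (hW'm i i)).add (integrable_mul_of_memLp (hψ' i) (hWm i))
  rw [integral_add (integrable_greenPairing hΩo hΩb hR hR' hψ hψ' contDiff_const)
    (integrable_finsetSum _ fun i _ => hi i), htang, integral_finsetSum _ fun i _ => hi i]
  simp [hnormal]

end Green

/-! ### Averages in time -/

section TimeAverage

set_option linter.unusedSectionVars false

variable {X : Type*} [MeasurableSpace X] {μ : Measure X} [IsFiniteMeasure μ] {T : ℝ}

/-- The average `x ↦ ∫₀ᵀ κ(τ) f(x, τ) dτ` of a function of space and time against a weight `κ`. -/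
noncomputable def timeAvg (T : ℝ) (κ : ℝ → ℝ) (f : X × ℝ → ℝ) (x : X) : ℝ :=
  ∫ τ in Ioo 0 T, κ τ * f (x, τ)

/-- The Cauchy-Schwarz inequality in the inner variable of a double integral. -/
theorem eLpNorm_integral_sq_le {Y : Type*} [MeasurableSpace Y] {κ : Measure Y} [IsFiniteMeasure κ]
    {F : X × Y → ℝ} (hF : AEStronglyMeasurable F (μ.prod κ)) :
    eLpNorm (fun x => ∫ r, F (x, r) ∂κ) 2 μ ^ 2 ≤ κ univ * eLpNorm F 2 (μ.prod κ) ^ 2 := by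
  rw [eLpNorm_two_sq]
  calc ∫⁻ x, ‖∫ r, F (x, r) ∂κ‖ₑ ^ 2 ∂μ
      ≤ ∫⁻ x, κ univ * ∫⁻ r, ‖F (x, r)‖ₑ ^ 2 ∂κ ∂μ := by
        apply lintegral_mono_ae
        filter_upwards [hF.prodMk_left] with x hx using enorm_integral_sq_le hx
    _ = κ univ * eLpNorm F 2 (μ.prod κ) ^ 2 := by
        rw [lintegral_const_mul' _ _ (measure_ne_top κ univ), eLpNorm_two_sq,
          lintegral_prod _ (hF.enorm.pow_const 2)]

theorem memLp_integral_right {Y : Type*} [MeasurableSpace Y] {κ : Measure Y} [IsFiniteMeasure κ]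
    {F : X × Y → ℝ} (hF : MemLp F 2 (μ.prod κ)) : MemLp (fun x => ∫ r, F (x, r) ∂κ) 2 μ := by
  refine ⟨hF.1.integral_prod_right', ?_⟩
  have h := (eLpNorm_integral_sq_le hF.1).trans_lt
    (ENNReal.mul_lt_top (measure_lt_top κ univ) (ENNReal.pow_lt_top hF.2))
  exact lt_of_not_ge fun h' => by simp [top_le_iff.1 h'] at h

theorem ae_abs_le_of_continuous {κ : ℝ → ℝ} (hκ : Continuous κ) (T : ℝ) :
    ∃ C, ∀ τ ∈ Ioo 0 T, |κ τ| ≤ C :=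
  exists_bound_of_continuous_of_isBounded (Metric.isBounded_Ioo 0 T) hκ

theorem ae_prod_snd_mem {ν : Measure ℝ} [SFinite ν] {s : Set ℝ} (h : ∀ᵐ t ∂ν, t ∈ s) :
    ∀ᵐ z ∂(μ.prod ν), z.2 ∈ s :=
  (Measure.quasiMeasurePreserving_snd (μ := μ) (ν := ν)).ae h

theorem memLp_time_weight_mul {f : X × ℝ → ℝ}
    (hf : MemLp f 2 (μ.prod (volume.restrict (Ioo 0 T)))) {θ : ℝ → ℝ} (hθ : Continuous θ) :
    MemLp (fun z => θ z.2 * f z) 2 (μ.prod (volume.restrict (Ioo 0 T))) := by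
  obtain ⟨C, hC⟩ := ae_abs_le_of_continuous hθ T
  refine ((TendstoL2.const hf).bounded_mul (w := fun z => θ z.2) (C := C)
    (hθ.measurable.comp measurable_snd).aestronglyMeasurable ?_).memLp_lim
  filter_upwards [ae_prod_snd_mem (μ := μ) (ae_restrict_mem measurableSet_Ioo)] with z hz
    using hC _ hz

theorem memLp_timeAvg {f : X × ℝ → ℝ} (hf : MemLp f 2 (μ.prod (volume.restrict (Ioo 0 T))))
    {κ : ℝ → ℝ} (hκ : Continuous κ) : MemLp (timeAvg T κ f) 2 μ :=
  memLp_integral_right (memLp_time_weight_mul hf hκ)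

theorem ae_integrable_timeAvg {f : X × ℝ → ℝ}
    (hf : MemLp f 2 (μ.prod (volume.restrict (Ioo 0 T)))) :
    ∀ᵐ x ∂μ, Integrable (fun τ => f (x, τ)) (volume.restrict (Ioo 0 T)) :=
  (hf.integrable (by norm_num)).prod_right_ae

theorem integral_timeAvg_mul {f : X × ℝ → ℝ}
    (hf : MemLp f 2 (μ.prod (volume.restrict (Ioo 0 T)))) {κ : ℝ → ℝ} (hκ : Continuous κ)
    {m : X → ℝ} (hm : MemLp m 2 μ) :
    ∫ x, timeAvg T κ f x * m x ∂μ =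
      ∫ z, f z * (κ z.2 * m z.1) ∂(μ.prod (volume.restrict (Ioo 0 T))) := by
  have hm' : MemLp (fun z : X × ℝ => m z.1) 2 (μ.prod (volume.restrict (Ioo 0 T))) := hm.comp_fst _
  have hi := integrable_mul_of_memLp hf (memLp_time_weight_mul hm' hκ)
  rw [integral_prod _ hi]
  congr 1; ext x
  rw [timeAvg, ← integral_mul_const]
  congr 1; ext t; ring

theorem integrable_weight_mul {f : ℝ → ℝ} (hf : Integrable f (volume.restrict (Ioo 0 T)))
    {κ : ℝ → ℝ} (hκ : Continuous κ) :
    Integrable (fun τ => κ τ * f τ) (volume.restrict (Ioo 0 T)) := by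
  obtain ⟨C, hC⟩ := ae_abs_le_of_continuous hκ T
  refine hf.bdd_mul (c := C) hκ.aestronglyMeasurable ?_
  filter_upwards [ae_restrict_mem measurableSet_Ioo] with t ht using hC t ht

theorem timeAvg_sub {f : X × ℝ → ℝ} {x : X}
    (hx : Integrable (fun τ => f (x, τ)) (volume.restrict (Ioo 0 T))) {κ κ' : ℝ → ℝ}
    (hκ : Continuous κ) (hκ' : Continuous κ') :
    timeAvg T (fun τ => κ τ - κ' τ) f x = timeAvg T κ f x - timeAvg T κ' f x := by
  unfold timeAvg
  rw [← integral_sub (integrable_weight_mul hx hκ) (integrable_weight_mul hx hκ')]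
  congr 1; ext τ; ring

/-- A kernel `K(t, τ)`, smooth in time with `∂ₜK = K'`, whose sections at times `t ∈ [0, T]` are
test functions on `(0, T)`.  Averaging against it produces functions that are regular in time up to
`t = 0` and `t = T`. -/
structure IsTimeKernel (T : ℝ) (K K' : ℝ → ℝ → ℝ) : Prop where
  continuous : Continuous (Function.uncurry K)
  continuous' : Continuous (Function.uncurry K')
  bounded : ∃ M, ∀ t τ, |K t τ| ≤ M
  bounded' : ∃ M, ∀ t τ, |K' t τ| ≤ M
  hasDerivAt : ∀ t τ, HasDerivAt (fun t => K t τ) (K' t τ) t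
  test : ∀ t ∈ Icc 0 T, IsTestFunction (Ioo 0 T) (K t)
  test' : ∀ t ∈ Icc 0 T, IsTestFunction (Ioo 0 T) (K' t)

theorem IsTestFunction.sub {V : Type*} [NormedAddCommGroup V] [NormedSpace ℝ V] {D : Set V}
    {φ ψ : V → ℝ} (hφ : IsTestFunction D φ) (hψ : IsTestFunction D ψ) :
    IsTestFunction D fun x => φ x - ψ x :=
  ⟨hφ.1.sub hψ.1, hφ.2.1.sub hψ.2.1, (tsupport_sub φ ψ).trans (union_subset hφ.2.2 hψ.2.2)⟩

namespace IsTimeKernel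

variable {K K' L L' : ℝ → ℝ → ℝ}

theorem sub (hK : IsTimeKernel T K K') (hL : IsTimeKernel T L L') :
    IsTimeKernel T (fun t τ => K t τ - L t τ) (fun t τ => K' t τ - L' t τ) := by
  refine ⟨hK.continuous.sub hL.continuous, hK.continuous'.sub hL.continuous', ?_, ?_,
    fun t τ => (hK.hasDerivAt t τ).sub (hL.hasDerivAt t τ),
    fun t ht => (hK.test t ht).sub (hL.test t ht), fun t ht => (hK.test' t ht).sub (hL.test' t ht)⟩
  · obtain ⟨M, hM⟩ := hK.bounded
    obtain ⟨M', hM'⟩ := hL.bounded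
    exact ⟨M + M', fun t τ => (abs_sub _ _).trans (add_le_add (hM t τ) (hM' t τ))⟩
  · obtain ⟨M, hM⟩ := hK.bounded'
    obtain ⟨M', hM'⟩ := hL.bounded'
    exact ⟨M + M', fun t τ => (abs_sub _ _).trans (add_le_add (hM t τ) (hM' t τ))⟩

theorem continuous_left (hK : IsTimeKernel T K K') (t : ℝ) : Continuous (K t) :=
  hK.continuous.comp (by fun_prop : Continuous fun τ : ℝ => (t, τ))

theorem continuous_left' (hK : IsTimeKernel T K K') (t : ℝ) : Continuous (K' t) :=
  hK.continuous'.comp (by fun_prop : Continuous fun τ : ℝ => (t, τ))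

theorem continuous_right' (hK : IsTimeKernel T K K') (τ : ℝ) : Continuous fun t => K' t τ :=
  hK.continuous'.comp (by fun_prop : Continuous fun t : ℝ => (t, τ))

theorem hasDerivAt_timeAvg (hK : IsTimeKernel T K K') {f : X × ℝ → ℝ} {x : X}
    (hx : Integrable (fun τ => f (x, τ)) (volume.restrict (Ioo 0 T))) (t : ℝ) :
    HasDerivAt (fun t => timeAvg T (K t) f x) (timeAvg T (K' t) f x) t := by
  obtain ⟨M, hM⟩ := hK.bounded
  obtain ⟨M', hM'⟩ := hK.bounded'
  refine (hasDerivAt_integral_of_dominated_loc_of_deriv_le (𝕜 := ℝ)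
    (μ := volume.restrict (Ioo 0 T)) (F := fun t τ => K t τ * f (x, τ))
    (F' := fun t τ => K' t τ * f (x, τ)) (bound := fun τ => M' * |f (x, τ)|) (x₀ := t)
    (s := univ) univ_mem ?_ ?_ ?_ ?_ ?_ ?_).2
  · exact Eventually.of_forall fun s => (hK.continuous_left s).aestronglyMeasurable.mul hx.1
  · exact hx.bdd_mul (c := M) (hK.continuous_left t).aestronglyMeasurable
      (Eventually.of_forall (hM t))
  · exact (hK.continuous_left' t).aestronglyMeasurable.mul hx.1
  · refine Eventually.of_forall fun τ s _ => ?_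
    rw [norm_mul]
    exact mul_le_mul_of_nonneg_right (hM' s τ) (norm_nonneg _)
  · exact hx.abs.const_mul M'
  · exact Eventually.of_forall fun τ s _ => (hK.hasDerivAt s τ).mul_const _

theorem continuous_timeAvg' (hK : IsTimeKernel T K K') {f : X × ℝ → ℝ} {x : X}
    (hx : Integrable (fun τ => f (x, τ)) (volume.restrict (Ioo 0 T))) :
    Continuous fun t => timeAvg T (K' t) f x := by
  obtain ⟨M', hM'⟩ := hK.bounded'
  refine continuous_of_dominated (bound := fun τ => M' * |f (x, τ)|) ?_ ?_ ?_ ?_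
  · exact fun s => (hK.continuous_left' s).aestronglyMeasurable.mul hx.1
  · refine fun s => Eventually.of_forall fun τ => ?_
    rw [norm_mul]
    exact mul_le_mul_of_nonneg_right (hM' s τ) (norm_nonneg _)
  · exact hx.abs.const_mul M'
  · exact Eventually.of_forall fun τ => (hK.continuous_right' τ).mul continuous_const

end IsTimeKernel

theorem memLp_timeAvg_kernel {f : X × ℝ → ℝ}
    (hf : MemLp f 2 (μ.prod (volume.restrict (Ioo 0 T)))) {K : ℝ → ℝ → ℝ}
    (hK : Continuous (Function.uncurry K)) {M : ℝ} (hM : ∀ t τ, |K t τ| ≤ M) :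
    MemLp (fun z : X × ℝ => timeAvg T (K z.2) f z.1) 2
      (μ.prod (volume.restrict (Ioo 0 T))) := by
  set ι : Measure ℝ := volume.restrict (Ioo 0 T)
  have h1 : MemLp (fun y : (X × ℝ) × ℝ => f (y.1.1, y.2)) 2 ((μ.prod ι).prod ι) := by
    have hmap : ((μ.prod ι).prod ι).map (Prod.map Prod.fst id) = (ι univ) • μ.prod ι := by
      rw [← Measure.map_prod_map _ _ measurable_fst measurable_id, Measure.map_fst_prod,
        Measure.map_id, Measure.prod_smul_left]
    have h2 : MemLp f 2 (((μ.prod ι).prod ι).map (Prod.map Prod.fst id)) := by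
      rw [hmap]; exact hf.smul_measure (measure_ne_top ι univ)
    exact (memLp_map_measure_iff h2.1 (by fun_prop)).1 h2
  have h3 : MemLp (fun y : (X × ℝ) × ℝ => K y.1.2 y.2 * f (y.1.1, y.2)) 2 ((μ.prod ι).prod ι) := by
    have hc : Measurable fun y : (X × ℝ) × ℝ => K y.1.2 y.2 :=
      hK.measurable.comp (by fun_prop : Measurable fun y : (X × ℝ) × ℝ => (y.1.2, y.2))
    exact ((TendstoL2.const h1).bounded_mul (C := M) hc.aestronglyMeasurable
      (Eventually.of_forall fun y => hM _ _)).memLp_lim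
  exact memLp_integral_right h3

/-- The fundamental theorem of calculus in time, integrated over space. -/
theorem integral_sub_eq_integral_deriv (hT : 0 ≤ T) {G G' : X × ℝ → ℝ}
    (hG : ∀ᵐ x ∂μ, (∀ t, HasDerivAt (fun t => G (x, t)) (G' (x, t)) t) ∧
      Continuous fun t => G' (x, t))
    (hG' : Integrable G' (μ.prod (volume.restrict (Ioo 0 T))))
    (h0 : Integrable (fun x => G (x, 0)) μ) (h1 : Integrable (fun x => G (x, T)) μ) :
    (∫ x, G (x, T) ∂μ) - ∫ x, G (x, 0) ∂μ = ∫ z, G' z ∂(μ.prod (volume.restrict (Ioo 0 T))) := by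
  rw [← integral_sub h1 h0, integral_prod _ hG']
  refine integral_congr_ae ?_
  filter_upwards [hG] with x hx
  rw [← integral_Ioc_eq_integral_Ioo, ← intervalIntegral.integral_of_le hT,
    intervalIntegral.integral_eq_sub_of_hasDerivAt (f := fun t => G (x, t)) (fun t _ => hx.1 t)
      (hx.2.intervalIntegrable _ _)]

/-- `θ(T) ‖f(T)‖² - θ(0) ‖f(0)‖² = ∫ θ' f² + 2 θ f ∂ₜf` for a function averaged in time. -/
theorem IsTimeKernel.integral_sq (hT : 0 ≤ T) {K K' : ℝ → ℝ → ℝ} (hK : IsTimeKernel T K K')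
    {f : X × ℝ → ℝ} (hf : MemLp f 2 (μ.prod (volume.restrict (Ioo 0 T)))) {θ θ' : ℝ → ℝ}
    (hθ : ∀ t, HasDerivAt θ (θ' t) t) (hθ' : Continuous θ') :
    θ T * (∫ x, timeAvg T (K T) f x ^ 2 ∂μ) - θ 0 * ∫ x, timeAvg T (K 0) f x ^ 2 ∂μ =
      ∫ z, (θ' z.2 * timeAvg T (K z.2) f z.1 ^ 2 +
        2 * θ z.2 * (timeAvg T (K z.2) f z.1 * timeAvg T (K' z.2) f z.1))
        ∂(μ.prod (volume.restrict (Ioo 0 T))) := by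
  obtain ⟨M, hM⟩ := hK.bounded
  obtain ⟨M', hM'⟩ := hK.bounded'
  have hθc : Continuous θ := continuous_iff_continuousAt.2 fun t => (hθ t).continuousAt
  have hm := memLp_timeAvg_kernel hf hK.continuous hM
  have hm' := memLp_timeAvg_kernel hf hK.continuous' hM'
  have hsq : ∀ t, Integrable (fun x => timeAvg T (K t) f x ^ 2) μ := fun t =>
    (memLp_timeAvg hf (hK.continuous_left t)).integrable_sq
  rw [← integral_const_mul, ← integral_const_mul]
  refine integral_sub_eq_integral_deriv hT
    (G := fun z => θ z.2 * timeAvg T (K z.2) f z.1 ^ 2) ?_ ?_ ((hsq 0).const_mul (θ 0))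
    ((hsq T).const_mul (θ T))
  · filter_upwards [ae_integrable_timeAvg hf] with x hx
    have hc : Continuous fun t => timeAvg T (K t) f x :=
      continuous_iff_continuousAt.2 fun t => (hK.hasDerivAt_timeAvg hx t).continuousAt
    have hc' := hK.continuous_timeAvg' hx
    refine ⟨fun t => ?_, by fun_prop⟩
    refine ((hθ t).mul ((hK.hasDerivAt_timeAvg hx t).pow 2)).congr_deriv ?_
    simp; ring
  · refine Integrable.add ?_ ?_
    · have := integrable_mul_of_memLp (memLp_time_weight_mul hm hθ') hm
      refine this.congr (Eventually.of_forall fun z => by ring)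
    · have := (integrable_mul_of_memLp (memLp_time_weight_mul hm hθc) hm').const_mul 2
      refine this.congr (Eventually.of_forall fun z => by ring)

end TimeAverage

/-! ### Time averages of weak derivatives and the weak Neumann condition -/

section ParabolicData

variable {d : ℕ} {Ω : Set (Space d)} {T : ℝ}

theorem volume_restrict_parCylinder (Ω : Set (Space d)) (T : ℝ) :
    (volume.restrict (parCylinder Ω T) : Measure (SpaceTime d)) =
      (volume.restrict Ω).prod (volume.restrict (Ioo 0 T)) := by
  rw [parCylinder, Measure.volume_eq_prod, Measure.prod_restrict]

theorem isOpen_parCylinder (hΩ : IsOpen Ω) : IsOpen (parCylinder Ω T) := hΩ.prod isOpen_Ioo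

theorem fderiv_prod_mul {φ : Space d → ℝ} {κ : ℝ → ℝ} (hφ : ContDiff ℝ ∞ φ) (hκ : ContDiff ℝ ∞ κ)
    (z e : SpaceTime d) : fderiv ℝ (fun z : SpaceTime d => φ z.1 * κ z.2) z e =
      φ z.1 * (e.2 * deriv κ z.2) + fderiv ℝ φ z.1 e.1 * κ z.2 := by
  have h1 : HasFDerivAt (fun z : SpaceTime d => φ z.1) _ z :=
    ((hφ.differentiable (by simp)) z.1).hasFDerivAt.comp z hasFDerivAt_fst
  have h2 : HasFDerivAt (fun z : SpaceTime d => κ z.2) _ z :=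
    ((hκ.differentiable (by simp)) z.2).hasDerivAt.hasFDerivAt.comp z hasFDerivAt_snd
  have h3 : HasFDerivAt (fun z : SpaceTime d => φ z.1 * κ z.2) _ z := h1.mul h2
  rw [h3.fderiv]
  simp
  ring

theorem IsTestFunction.prod_mul {φ : Space d → ℝ} {κ : ℝ → ℝ} (hφ : IsTestFunction Ω φ)
    (hκ : IsTestFunction (Ioo 0 T) κ) :
    IsTestFunction (parCylinder Ω T) fun z => φ z.1 * κ z.2 := by
  have hsub : tsupport (fun z : SpaceTime d => φ z.1 * κ z.2) ⊆ tsupport φ ×ˢ tsupport κ := by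
    refine closure_minimal (fun z hz => ?_) ((isClosed_tsupport φ).prod (isClosed_tsupport κ))
    exact ⟨subset_tsupport _ (left_ne_zero_of_mul hz), subset_tsupport _ (right_ne_zero_of_mul hz)⟩
  refine ⟨(hφ.1.comp contDiff_fst).mul (hκ.1.comp contDiff_snd), ?_, ?_⟩
  · exact (hφ.2.1.prod hκ.2.1).of_isClosed_subset (isClosed_tsupport _) hsub
  · exact hsub.trans (prod_mono hφ.2.2 hκ.2.2)

/-- Averaging in time commutes with weak derivatives in space. -/
theorem hasWeakDeriv_timeAvg (hΩ : IsFiniteMeasure (volume.restrict Ω)) {f g : SpaceTime d → ℝ}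
    (hf : MemLp f 2 (volume.restrict (parCylinder Ω T)))
    (hg : MemLp g 2 (volume.restrict (parCylinder Ω T))) {i : Fin d}
    (h : HasWeakDeriv (parCylinder Ω T) (spaceDir i) f g) {κ : ℝ → ℝ}
    (hκ : IsTestFunction (Ioo 0 T) κ) :
    HasWeakDeriv Ω (unitVec i) (timeAvg T κ f) (timeAvg T κ g) := by
  intro φ hφ
  have h1 := h _ (hφ.prod_mul hκ)
  rw [volume_restrict_parCylinder] at hf hg h1
  rw [integral_timeAvg_mul hf hκ.1.continuous (hφ.fderiv _).memLp,
    integral_timeAvg_mul hg hκ.1.continuous hφ.memLp]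
  simp_rw [fderiv_prod_mul hφ.1 hκ.1, spaceDir, zero_mul, mul_zero, zero_add] at h1
  simp_rw [mul_comm (κ _)]
  exact h1

/-- Integration by parts in time: averaging `f` against `-κ'` is averaging `∂ₜf` against `κ`. -/
theorem timeAvg_deriv (hΩo : IsOpen Ω) (hΩ : IsFiniteMeasure (volume.restrict Ω))
    {f g : SpaceTime d → ℝ}
    (hf : MemLp f 2 (volume.restrict (parCylinder Ω T)))
    (hg : MemLp g 2 (volume.restrict (parCylinder Ω T)))
    (h : HasWeakDeriv (parCylinder Ω T) timeDir f g) {κ : ℝ → ℝ}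
    (hκ : IsTestFunction (Ioo 0 T) κ) (a : ℝ) :
    timeAvg T (fun τ => -(a * deriv κ τ)) f =ᵐ[volume.restrict Ω] fun x => a * timeAvg T κ g x := by
  have hκ' : Continuous (deriv κ) := hκ.1.continuous_deriv (by simp)
  have hκ'' : Continuous fun τ => -(a * deriv κ τ) := by fun_prop
  have h0 : ∀ φ : Space d → ℝ, IsTestFunction Ω φ →
      ∫ x in Ω, timeAvg T (fun τ => -(a * deriv κ τ)) f x * φ x =
        ∫ x in Ω, a * timeAvg T κ g x * φ x := by
    intro φ hφ
    have h1 := h _ (hφ.prod_mul hκ)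
    have hf' := hf
    have hg' := hg
    rw [volume_restrict_parCylinder] at hf' hg' h1
    rw [integral_timeAvg_mul hf' hκ'' hφ.memLp]
    simp_rw [mul_assoc]
    rw [integral_const_mul, integral_timeAvg_mul hg' hκ.1.continuous hφ.memLp]
    simp_rw [fderiv_prod_mul hφ.1 hκ.1, timeDir, map_zero, zero_mul, add_zero, one_mul] at h1
    have e1 : ∀ z : SpaceTime d, f z * (-(a * deriv κ z.2) * φ z.1) =
        (-a) * (f z * (φ z.1 * deriv κ z.2)) := fun z => by ring
    simp_rw [e1, mul_comm (κ _)]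
    rw [integral_const_mul, h1]; ring
  rw [volume_restrict_parCylinder] at hf hg
  have m1 := memLp_timeAvg hf hκ''
  have m2 := (memLp_timeAvg hg hκ.1.continuous).const_mul a
  have key := hΩo.ae_eq_zero_of_integral_contDiff_smul_eq_zero
    (f := fun x => timeAvg T (fun τ => -(a * deriv κ τ)) f x - a * timeAvg T κ g x)
    (locallyIntegrableOn_of_locallyIntegrable_restrict
      ((m1.sub m2).locallyIntegrable (by norm_num))) (fun φ h1 h2 h3 => by
    have ht : IsTestFunction Ω φ := ⟨h1, h2, h3⟩
    have e2 : ∫ x in Ω, φ x • (timeAvg T (fun τ => -(a * deriv κ τ)) f x - a * timeAvg T κ g x)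
        = 0 := by
      have : ∀ x, φ x • (timeAvg T (fun τ => -(a * deriv κ τ)) f x - a * timeAvg T κ g x) =
          timeAvg T (fun τ => -(a * deriv κ τ)) f x * φ x - a * timeAvg T κ g x * φ x :=
        fun x => by simp; ring
      simp_rw [this]
      rw [integral_sub (integrable_mul_of_memLp m1 ht.memLp) (integrable_mul_of_memLp m2 ht.memLp),
        h0 φ ht, sub_self]
    rw [← e2, setIntegral_eq_integral_of_forall_compl_eq_zero]
    intro x hx
    rw [image_eq_zero_of_notMem_tsupport fun hx' => hx (h3 hx'), zero_smul])
  filter_upwards [ae_restrict_of_ae key, ae_restrict_mem hΩo.measurableSet] with x hx hxΩ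
  linarith [hx hxΩ]

/-- The regularity of a function `u` that is used by the energy identities: `u`, its time derivative
`ut`, its spatial gradient `g` and its Laplacian `L` are square integrable, and the Neumann
condition holds in the weak form of Green's formula for time averages. -/
structure IsNeumannRegular (Ω : Set (Space d)) (T : ℝ) (u ut L : SpaceTime d → ℝ)
    (g : Fin d → SpaceTime d → ℝ) : Prop where
  memLp : MemLp u 2 (volume.restrict (parCylinder Ω T))
  memLp_dt : MemLp ut 2 (volume.restrict (parCylinder Ω T))
  memLp_lap : MemLp L 2 (volume.restrict (parCylinder Ω T))
  memLp_grad : ∀ i, MemLp (g i) 2 (volume.restrict (parCylinder Ω T))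
  hasWeakDeriv_dt : HasWeakDeriv (parCylinder Ω T) timeDir u ut
  hasWeakDeriv_grad : ∀ i, HasWeakDeriv (parCylinder Ω T) (spaceDir i) u (g i)
  green : ∀ (κ : ℝ → ℝ) (ψ : Space d → ℝ) (ψ' : Fin d → Space d → ℝ), IsTestFunction (Ioo 0 T) κ →
    MemLp ψ 2 (volume.restrict Ω) → (∀ i, MemLp (ψ' i) 2 (volume.restrict Ω)) →
    (∀ i, HasWeakDeriv Ω (unitVec i) ψ (ψ' i)) →
    ∫ x in Ω, (ψ x * timeAvg T κ L x + ∑ i, ψ' i x * timeAvg T κ (g i) x) = 0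

variable {u ut L : SpaceTime d → ℝ} {g : Fin d → SpaceTime d → ℝ}

/-- Green's formula for two time averages of the same function. -/
theorem IsNeumannRegular.green_timeAvg (hΩ : IsFiniteMeasure (volume.restrict Ω))
    (h : IsNeumannRegular Ω T u ut L g) {κ κ' : ℝ → ℝ} (hκ : IsTestFunction (Ioo 0 T) κ)
    (hκ' : IsTestFunction (Ioo 0 T) κ') :
    ∫ x in Ω, (timeAvg T κ' u x * timeAvg T κ L x +
      ∑ i, timeAvg T κ' (g i) x * timeAvg T κ (g i) x) = 0 := by
  have hu := h.memLp
  have hg := h.memLp_grad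
  simp_rw [volume_restrict_parCylinder] at hu hg
  exact h.green κ _ (fun i => timeAvg T κ' (g i)) hκ (memLp_timeAvg hu hκ'.1.continuous)
    (fun i => memLp_timeAvg (hg i) hκ'.1.continuous)
    (fun i => hasWeakDeriv_timeAvg hΩ h.memLp (h.memLp_grad i) (h.hasWeakDeriv_grad i) hκ')

/-- Green's formula for averages with a kernel depending on time, integrated against `θ(t)`. -/
theorem IsNeumannRegular.integral_green_kernel (hΩ : IsFiniteMeasure (volume.restrict Ω))
    (h : IsNeumannRegular Ω T u ut L g) {K K' J : ℝ → ℝ → ℝ} (hK : IsTimeKernel T K K')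
    (hJc : Continuous (Function.uncurry J)) (hJb : ∃ M, ∀ t τ, |J t τ| ≤ M)
    (hJ : ∀ t ∈ Icc 0 T, IsTestFunction (Ioo 0 T) (J t)) {θ : ℝ → ℝ}
    (hθ : Continuous θ) :
    ∫ z in parCylinder Ω T, θ z.2 * (timeAvg T (J z.2) u z.1 * timeAvg T (K z.2) L z.1) =
      - ∑ i, ∫ z in parCylinder Ω T,
        θ z.2 * (timeAvg T (K z.2) (g i) z.1 * timeAvg T (J z.2) (g i) z.1) := by
  obtain ⟨M, hM⟩ := hK.bounded
  obtain ⟨M', hM'⟩ := hJb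
  have hu := h.memLp
  have hL := h.memLp_lap
  have hg := h.memLp_grad
  simp_rw [volume_restrict_parCylinder] at hu hg hL ⊢
  have i1 : Integrable (fun z : SpaceTime d =>
      θ z.2 * (timeAvg T (J z.2) u z.1 * timeAvg T (K z.2) L z.1))
      ((volume.restrict Ω).prod (volume.restrict (Ioo 0 T))) := by
    refine (integrable_mul_of_memLp (memLp_time_weight_mul (memLp_timeAvg_kernel hu hJc hM') hθ)
      (memLp_timeAvg_kernel hL hK.continuous hM)).congr (Eventually.of_forall fun z => by ring)
  have i2 : ∀ i, Integrable (fun z : SpaceTime d =>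
      θ z.2 * (timeAvg T (K z.2) (g i) z.1 * timeAvg T (J z.2) (g i) z.1))
      ((volume.restrict Ω).prod (volume.restrict (Ioo 0 T))) := by
    intro i
    refine (integrable_mul_of_memLp (memLp_time_weight_mul
      (memLp_timeAvg_kernel (hg i) hK.continuous hM) hθ)
      (memLp_timeAvg_kernel (hg i) hJc hM')).congr (Eventually.of_forall fun z => by ring)
  rw [← integral_finsetSum _ fun i _ => i2 i, ← add_eq_zero_iff_eq_neg,
    ← integral_add i1 (integrable_finsetSum _ fun i _ => i2 i), integral_prod_symm]
  · refine integral_eq_zero_of_ae ?_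
    filter_upwards [ae_restrict_mem measurableSet_Ioo] with t ht
    have ht' : t ∈ Icc 0 T := Ioo_subset_Icc_self ht
    have := h.green_timeAvg hΩ (hK.test t ht') (hJ t ht')
    rw [Pi.zero_apply, ← mul_zero (θ t), ← this, ← integral_const_mul]
    congr 1; ext x
    rw [mul_add, Finset.mul_sum]
    congr 1
    exact Finset.sum_congr rfl fun i _ => by ring
  · exact i1.add (integrable_finsetSum _ fun i _ => i2 i)

/-- The energy identity for the gradient of a time average. -/
theorem IsNeumannRegular.integral_grad_sq_kernel (hT : 0 ≤ T)
    (hΩ : IsFiniteMeasure (volume.restrict Ω))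
    (h : IsNeumannRegular Ω T u ut L g) {K K' : ℝ → ℝ → ℝ} (hK : IsTimeKernel T K K')
    {θ θ' : ℝ → ℝ} (hθ : ∀ t, HasDerivAt θ (θ' t) t) (hθ' : Continuous θ') :
    ∑ i, (θ T * (∫ x in Ω, timeAvg T (K T) (g i) x ^ 2)
        - θ 0 * ∫ x in Ω, timeAvg T (K 0) (g i) x ^ 2) =
      (∑ i, ∫ z in parCylinder Ω T, θ' z.2 * timeAvg T (K z.2) (g i) z.1 ^ 2) -
        2 * ∫ z in parCylinder Ω T,
          θ z.2 * (timeAvg T (K' z.2) u z.1 * timeAvg T (K z.2) L z.1) := by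
  have hθc : Continuous θ := continuous_iff_continuousAt.2 fun t => (hθ t).continuousAt
  rw [h.integral_green_kernel hΩ hK hK.continuous' hK.bounded' hK.test' hθc, mul_neg,
    sub_neg_eq_add,
    Finset.mul_sum, ← Finset.sum_add_distrib]
  refine Finset.sum_congr rfl fun i _ => ?_
  obtain ⟨M, hM⟩ := hK.bounded
  obtain ⟨M', hM'⟩ := hK.bounded'
  have hg := h.memLp_grad i
  rw [volume_restrict_parCylinder] at hg ⊢
  have hm := memLp_timeAvg_kernel hg hK.continuous hM
  have hm' := memLp_timeAvg_kernel hg hK.continuous' hM'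
  rw [hK.integral_sq hT hg hθ hθ', integral_add]
  · rw [← integral_const_mul]
    congr 2; ext z; ring
  · have := integrable_mul_of_memLp (memLp_time_weight_mul hm hθ') hm
    exact this.congr (Eventually.of_forall fun z => by ring)
  · have := (integrable_mul_of_memLp (memLp_time_weight_mul hm hθc) hm').const_mul 2
    exact this.congr (Eventually.of_forall fun z => by ring)

end ParabolicData

/-! ### Mollification in time up to the endpoints -/

section TimeMollification

variable {d : ℕ} {Ω : Set (Space d)} {T : ℝ}

/-- The kernel `K(t, τ) = k(τ - (1 - 2δ) t - δT)` with a bump function `k` supported in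
`[-δT/2, δT/2]`: the affine map `t ↦ (1 - 2δ) t + δT` pushes `[0, T]` into `(0, T)`, so that no
extension of functions beyond `(0, T)` is needed. -/
noncomputable def mollifierKernel (T δ : ℝ) (k : ContDiffBump (0 : ℝ)) (t τ : ℝ) : ℝ :=
  k.normed volume (τ - ((1 - 2 * δ) * t + δ * T))

theorem continuous_mollifierKernel (T δ : ℝ) (k : ContDiffBump (0 : ℝ)) :
    Continuous (Function.uncurry (mollifierKernel T δ k)) :=
  k.continuous_normed.comp
    (by fun_prop : Continuous fun z : ℝ × ℝ => z.2 - ((1 - 2 * δ) * z.1 + δ * T))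

theorem mollifierKernel_bounded (T δ : ℝ) (k : ContDiffBump (0 : ℝ)) :
    ∃ M, ∀ t τ, |mollifierKernel T δ k t τ| ≤ M := by
  obtain ⟨C, hC⟩ := (k.hasCompactSupport_normed (μ := volume)).exists_bound_of_continuous
    k.continuous_normed
  exact ⟨C, fun t τ => hC _⟩

/-- The time derivative of the kernel is a multiple of its derivative in `τ`, which turns it into a
weak time derivative of the averaged function. -/
theorem isTimeKernel_mollifierKernel (hT : 0 < T) {δ : ℝ} (hδ0 : 0 < δ) (hδ4 : δ ≤ 1 / 4)
    {k : ContDiffBump (0 : ℝ)} (hk : k.rOut = δ * T / 2) :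
    IsTimeKernel T (mollifierKernel T δ k)
      (fun t τ => -((1 - 2 * δ) * deriv (mollifierKernel T δ k t) τ)) := by
  set p : ℝ → ℝ := k.normed volume with hpdef
  have hp : ContDiff ℝ ∞ p := k.contDiff_normed
  have hpc : HasCompactSupport p := k.hasCompactSupport_normed
  have hp' : ContDiff ℝ ∞ (deriv p) := (contDiff_infty_iff_deriv.1 hp).2
  have hpt : tsupport p = Metric.closedBall 0 (δ * T / 2) := by
    rw [hpdef, k.tsupport_normed_eq, hk]
  have hpd : ∀ s, HasDerivAt p (deriv p s) s := fun s =>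
    (hp.differentiable (by simp) s).hasDerivAt
  have hδT : 0 < δ * T := mul_pos hδ0 hT
  have hderiv : ∀ t τ, deriv (mollifierKernel T δ k t) τ =
      deriv p (τ - ((1 - 2 * δ) * t + δ * T)) := by
    intro t τ
    have h1 : HasDerivAt (fun τ => τ - ((1 - 2 * δ) * t + δ * T)) 1 τ :=
      (hasDerivAt_id τ).sub_const _
    have h2 := ((hpd _).comp τ h1).deriv
    rw [mul_one] at h2; exact h2
  -- translates of functions supported in the small ball are test functions on `(0, T)`
  have htest : ∀ (q : ℝ → ℝ), ContDiff ℝ ∞ q → tsupport q ⊆ Metric.closedBall 0 (δ * T / 2) →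
      ∀ t ∈ Icc 0 T, IsTestFunction (Ioo 0 T) fun τ => q (τ - ((1 - 2 * δ) * t + δ * T)) := by
    intro q hq hqs t ht
    have hsub : tsupport (fun τ => q (τ - ((1 - 2 * δ) * t + δ * T))) ⊆
        Metric.closedBall ((1 - 2 * δ) * t + δ * T) (δ * T / 2) := by
      refine closure_minimal (fun τ hτ => ?_) Metric.isClosed_closedBall
      have := hqs (subset_tsupport _ hτ)
      rw [mem_closedBall_zero_iff] at this
      rwa [Metric.mem_closedBall, dist_eq_norm]
    refine ⟨hq.comp (contDiff_id.sub contDiff_const), ?_, hsub.trans fun τ hτ => ?_⟩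
    · exact (isCompact_closedBall _ _).of_isClosed_subset (isClosed_tsupport _) hsub
    · rw [Metric.mem_closedBall, Real.dist_eq, abs_le] at hτ
      have h1 := mul_nonneg (by linarith : 0 ≤ 1 - 2 * δ) ht.1
      have h2 := mul_le_mul_of_nonneg_left ht.2 (by linarith : 0 ≤ 1 - 2 * δ)
      constructor <;> nlinarith
  simp_rw [hderiv]
  refine ⟨continuous_mollifierKernel T δ k, ?_, mollifierKernel_bounded T δ k, ?_,
    fun t τ => ?_, fun t ht => htest p hp hpt.le t ht, fun t ht => ?_⟩
  · exact (continuous_const.mul (hp'.continuous.comp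
      (by fun_prop : Continuous fun z : ℝ × ℝ => z.2 - ((1 - 2 * δ) * z.1 + δ * T)))).neg
  · obtain ⟨C, hC⟩ := hpc.deriv.exists_bound_of_continuous hp'.continuous
    refine ⟨|1 - 2 * δ| * C, fun t τ => ?_⟩
    rw [abs_neg, abs_mul]
    exact mul_le_mul_of_nonneg_left (hC _) (abs_nonneg _)
  · have h1 : HasDerivAt (fun t => τ - ((1 - 2 * δ) * t + δ * T)) (-(1 - 2 * δ)) t := by
      simpa using (((hasDerivAt_id t).const_mul (1 - 2 * δ)).add_const (δ * T)).const_sub τ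
    exact ((hpd _).comp t h1).congr_deriv (by ring)
  · have h1 := htest _ hp' ((tsupport_deriv_subset).trans hpt.le) t ht
    have h2 := h1.mul_left (m := fun _ => -(1 - 2 * δ)) contDiff_const
    simpa only [neg_mul] using h2

/-- The affine change of time `t ↦ a t + c` with `a ≥ 1/2` at most doubles measures. -/
theorem volume_preimage_affine_time_le {a : ℝ} (ha : 1 / 2 ≤ a) (c : ℝ) {s : Set (SpaceTime d)}
    (hs : MeasurableSet s) :
    volume ((fun z : SpaceTime d => (z.1, a * z.2 + c)) ⁻¹' s) ≤ 2 * volume s := by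
  have han : 0 < a := by linarith
  have hmr : Measurable fun z : SpaceTime d => (z.1, a * z.2 + c) := by fun_prop
  rw [Measure.volume_eq_prod, Measure.prod_apply (hmr hs), Measure.prod_apply hs,
    ← lintegral_const_mul' _ _ (by simp)]
  refine lintegral_mono fun x => ?_
  have e1 : Prod.mk x ⁻¹' ((fun z : SpaceTime d => (z.1, a * z.2 + c)) ⁻¹' s) =
      (a * ·) ⁻¹' ((· + c) ⁻¹' (Prod.mk x ⁻¹' s)) := rfl
  dsimp only
  rw [e1, Real.volume_preimage_mul_left han.ne', measure_preimage_add_right]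
  gcongr
  rw [abs_of_pos (inv_pos.2 han)]
  calc ENNReal.ofReal a⁻¹ ≤ ENNReal.ofReal 2 := by
        apply ENNReal.ofReal_le_ofReal
        rw [inv_le_comm₀ han (by norm_num)]; linarith
    _ = 2 := by simp

/-- Averages with mollifier kernels converge in `L²(Q)` as `δ → 0`: they are averages over
the points `(x, (1 - 2δ) t + δT + r)`, which are at a distance of order `δ` from `(x, t)`. -/
theorem tendstoL2_mollifierKernel (hΩo : IsOpen Ω) (hΩ : IsFiniteMeasure (volume.restrict Ω))
    (hT : 0 < T) {δ : ℕ → ℝ} (hδ0 : ∀ n, 0 < δ n) (hδ4 : ∀ n, δ n ≤ 1 / 4)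
    (hδlim : Tendsto δ atTop (𝓝 0)) {k : ℕ → ContDiffBump (0 : ℝ)}
    (hk : ∀ n, (k n).rOut = δ n * T / 2) {f : SpaceTime d → ℝ}
    (hf : MemLp f 2 (volume.restrict (parCylinder Ω T))) :
    TendstoL2 (volume.restrict (parCylinder Ω T))
      (fun n z => timeAvg T (mollifierKernel T (δ n) (k n) z.2) f z.1) f := by
  set Q := parCylinder Ω T with hQ
  have hQm : MeasurableSet Q := (isOpen_parCylinder hΩo).measurableSet
  have hQf : IsFiniteMeasure (volume.restrict Q) := by
    rw [hQ, volume_restrict_parCylinder]; infer_instance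
  set p : ℕ → ℝ → ℝ := fun n => (k n).normed volume with hpdef
  let κ : ℕ → Measure ℝ := fun n => volume.withDensity fun y => ENNReal.ofReal (p n y)
  have hpm : ∀ n, Measurable fun y => ENNReal.ofReal (p n y) := fun n =>
    (k n).continuous_normed.measurable.ennreal_ofReal
  have hκp : ∀ n, IsProbabilityMeasure (κ n) := fun n => ⟨by
    simp only [κ]
    rw [withDensity_apply _ MeasurableSet.univ, Measure.restrict_univ,
      ← ofReal_integral_eq_lintegral_ofReal (k n).integrable_normed
        (Eventually.of_forall (k n).nonneg_normed), (k n).integral_normed, ENNReal.ofReal_one]⟩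
  have hfi : MemLp (Q.indicator f) 2 volume := (memLp_indicator_iff_restrict hQm).2 hf
  have hzQ : ∀ᵐ z ∂(volume.restrict Q), z ∈ Q := ae_restrict_mem hQm
  set A : ℕ → SpaceTime d × ℝ → SpaceTime d := fun n z =>
    (z.1.1, (1 - 2 * δ n) * z.1.2 + (z.2 + δ n * T)) with hA
  have hAm : ∀ n, Measurable (A n) := fun n => by simp only [hA]; fun_prop
  have hmap : ∀ n, ((volume.restrict Q).prod (κ n)).map (A n) ≤ (2 : ENNReal) • volume := by
    intro n
    refine Measure.le_iff.2 fun s hs => ?_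
    rw [Measure.map_apply (hAm n) hs, Measure.prod_apply_symm (hAm n hs)]
    calc ∫⁻ r, (volume.restrict Q) ((fun z => (z, r)) ⁻¹' (A n ⁻¹' s)) ∂κ n
        ≤ ∫⁻ _, 2 * volume s ∂κ n := by
          refine lintegral_mono fun r => (Measure.restrict_apply_le _ _).trans ?_
          exact volume_preimage_affine_time_le (a := 1 - 2 * δ n) (by linarith [hδ4 n])
            (r + δ n * T) hs
      _ = ((2 : ENNReal) • volume) s := by simp
  have hdist : ∀ n, ∀ᵐ z ∂((volume.restrict Q).prod (κ n)), dist (A n z) z.1 ≤ 2 * T * δ n := by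
    intro n
    have hδT : 0 < δ n * T := mul_pos (hδ0 n) hT
    have h1 : ∀ᵐ y ∂κ n, |y| ≤ δ n * T / 2 := by
      refine (ae_withDensity_iff (hpm n)).2 (Eventually.of_forall fun y hy => ?_)
      have hy' : y ∈ Function.support ((k n).normed volume) := by
        intro h0; exact hy (by simp [hpdef, h0])
      rw [(k n).support_normed_eq, hk, mem_ball_zero_iff] at hy'
      exact hy'.le
    have h2 := (Measure.quasiMeasurePreserving_snd (μ := volume.restrict Q) (ν := κ n)).ae h1
    have h3 := (Measure.quasiMeasurePreserving_fst (μ := volume.restrict Q) (ν := κ n)).ae hzQ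
    filter_upwards [h2, h3] with z hz hzQ'
    rw [Prod.dist_eq, dist_self, Real.dist_eq]
    refine max_le (by nlinarith) ?_
    have ht : z.1.2 ∈ Ioo 0 T := hzQ'.2
    rw [abs_le] at hz ⊢
    have h4 := mul_pos (hδ0 n) ht.1
    have h5 := mul_pos (hδ0 n) (sub_pos.2 ht.2)
    constructor <;> nlinarith
  have havg := tendstoL2_average (μ := volume.restrict Q) (ν := volume) (κ := κ) (A := A) (M := 2)
    (ε := fun n => 2 * T * δ n) Measure.restrict_le_self hAm (by simp) hmap
    (by simpa using hδlim.const_mul (2 * T)) hdist hfi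
  refine ⟨fun n => ?_, hf, ?_⟩
  · obtain ⟨C, hC⟩ := mollifierKernel_bounded T (δ n) (k n)
    rw [hQ, volume_restrict_parCylinder] at hf ⊢
    exact memLp_timeAvg_kernel hf (continuous_mollifierKernel T (δ n) (k n)) hC
  refine havg.tendsto.congr fun n => eLpNorm_congr_ae ?_
  filter_upwards [hzQ] with z hz
  rw [indicator_of_mem hz]
  congr 1
  simp only [κ, timeAvg]
  rw [integral_withDensity_eq_integral_toReal_smul (hpm n) (by simp),
    ← integral_sub_right_eq_self _ ((1 - 2 * δ n) * z.2 + δ n * T),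
    ← integral_indicator measurableSet_Ioo]
  congr 1; ext τ
  have e : A n (z, τ - ((1 - 2 * δ n) * z.2 + δ n * T)) = (z.1, τ) := by
    simp only [hA]; congr 1; ring
  rw [ENNReal.toReal_ofReal ((k n).nonneg_normed _), smul_eq_mul, e]
  by_cases hτ : τ ∈ Ioo 0 T
  · rw [indicator_of_mem hτ, indicator_of_mem (show (z.1, τ) ∈ Q from ⟨hz.1, hτ⟩)]
    rfl
  · rw [indicator_of_notMem hτ, indicator_of_notMem (fun h => hτ h.2), mul_zero]

/-- Mollification in time, up to `t = 0` and `t = T`. -/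
theorem exists_timeKernel_seq (hΩo : IsOpen Ω) (hΩ : IsFiniteMeasure (volume.restrict Ω))
    (hT : 0 < T) :
    ∃ (K K' : ℕ → ℝ → ℝ → ℝ) (a : ℕ → ℝ), (∀ n, IsTimeKernel T (K n) (K' n)) ∧
      (∀ n t, K' n t = fun τ => -(a n * deriv (K n t) τ)) ∧ Tendsto a atTop (𝓝 1) ∧
      ∀ f : SpaceTime d → ℝ, MemLp f 2 (volume.restrict (parCylinder Ω T)) →
        TendstoL2 (volume.restrict (parCylinder Ω T))
          (fun n z => timeAvg T (K n z.2) f z.1) f := by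
  set δ : ℕ → ℝ := fun n => 1 / ((n : ℝ) + 4) with hδ
  have hδ0 : ∀ n, 0 < δ n := fun n => by simp only [hδ]; positivity
  have hδ4 : ∀ n, δ n ≤ 1 / 4 := fun n => by
    simp only [hδ]
    exact one_div_le_one_div_of_le (by norm_num) (by linarith [n.cast_nonneg (α := ℝ)])
  have hδlim : Tendsto δ atTop (𝓝 0) := by
    have : Tendsto (fun n : ℕ => (n : ℝ) + 4) atTop atTop :=
      tendsto_atTop_add_const_right _ _ tendsto_natCast_atTop_atTop
    refine this.inv_tendsto_atTop.congr fun n => by simp [hδ]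
  have hδT : ∀ n, 0 < δ n * T := fun n => mul_pos (hδ0 n) hT
  let k : ℕ → ContDiffBump (0 : ℝ) := fun n =>
    ⟨δ n * T / 4, δ n * T / 2, by have := hδT n; positivity, by have := hδT n; linarith⟩
  refine ⟨fun n => mollifierKernel T (δ n) (k n), _, fun n => 1 - 2 * δ n,
    fun n => isTimeKernel_mollifierKernel hT (hδ0 n) (hδ4 n) rfl, fun n t => rfl, ?_,
    fun f hf => tendstoL2_mollifierKernel hΩo hΩ hT hδ0 hδ4 hδlim (fun n => rfl) hf⟩
  simpa using (tendsto_const_nhds (x := (1 : ℝ))).sub (hδlim.const_mul 2)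

end TimeMollification

/-! ### Bounds at the endpoints in time -/

section Traces

variable {d : ℕ} {Ω : Set (Space d)} {T : ℝ}

theorem ae_eq_prod_of_ae_ae_eq {X Y : Type*} [MeasurableSpace X] [MeasurableSpace Y]
    {μ : Measure X} {ν : Measure Y} [SFinite μ] [SFinite ν] {F G : X × Y → ℝ}
    (hF : AEStronglyMeasurable F (μ.prod ν)) (hG : AEStronglyMeasurable G (μ.prod ν))
    (h : ∀ᵐ t ∂ν, ∀ᵐ x ∂μ, F (x, t) = G (x, t)) : F =ᵐ[μ.prod ν] G := by
  have hm : AEMeasurable (fun z => ‖F z - G z‖ₑ) (μ.prod ν) := (hF.sub hG).enorm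
  have h0 : ∫⁻ z, ‖F z - G z‖ₑ ∂(μ.prod ν) = 0 := by
    rw [lintegral_prod_symm _ hm]
    refine lintegral_eq_zero_of_ae_eq_zero ?_
    filter_upwards [h] with t ht
    refine lintegral_eq_zero_of_ae_eq_zero ?_
    filter_upwards [ht] with x hx
    simp [hx]
  filter_upwards [(lintegral_eq_zero_iff' hm).1 h0] with z hz
  exact sub_eq_zero.1 (enorm_eq_zero.1 hz)

theorem hasDerivAt_decreasing_ramp (T t : ℝ) : HasDerivAt (fun t => 1 - t / T) (-(1 / T)) t := by
  simpa using ((hasDerivAt_id t).div_const T).const_sub 1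

theorem hasDerivAt_increasing_ramp (T t : ℝ) : HasDerivAt (fun t => t / T) (1 / T) t := by
  simpa using (hasDerivAt_id t).div_const T

theorem two_mul_mul_le_of_abs_le_one {c : ℝ} (hc : |c| ≤ 1) (x y : ℝ) :
    2 * c * (x * y) ≤ x ^ 2 + y ^ 2 := by
  have h1 := abs_le.1 hc
  nlinarith [sq_nonneg (x - y), sq_nonneg (x + y)]

/-- The values of a time average at `t = 0` and `t = T` are controlled by norms on `Q`, by the
energy identity with the linear weights `-(1 - t/T)` and `t/T`, which select one endpoint each. -/
theorem IsTimeKernel.integral_sq_endpoint_le {X : Type*} [MeasurableSpace X] {μ : Measure X}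
    [IsFiniteMeasure μ] (hT : 0 < T) {K K' : ℝ → ℝ → ℝ} (hK : IsTimeKernel T K K')
    {f : X × ℝ → ℝ} (hf : MemLp f 2 (μ.prod (volume.restrict (Ioo 0 T)))) :
    ∀ t ∈ ({0, T} : Set ℝ), ∫ x, timeAvg T (K t) f x ^ 2 ∂μ ≤
      (1 / T + 1) * (∫ z, timeAvg T (K z.2) f z.1 ^ 2 ∂(μ.prod (volume.restrict (Ioo 0 T)))) +
        ∫ z, timeAvg T (K' z.2) f z.1 ^ 2 ∂(μ.prod (volume.restrict (Ioo 0 T))) := by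
  obtain ⟨M, hM⟩ := hK.bounded
  obtain ⟨M', hM'⟩ := hK.bounded'
  have hm := memLp_timeAvg_kernel hf hK.continuous hM
  have hm' := memLp_timeAvg_kernel hf hK.continuous' hM'
  have hbound : ∀ θ θ' : ℝ → ℝ, Continuous θ → (∀ t ∈ Ioo 0 T, |θ t| ≤ 1) → (∀ t, θ' t ≤ 1 / T) →
      Continuous θ' →
      ∫ z, (θ' z.2 * timeAvg T (K z.2) f z.1 ^ 2 +
        2 * θ z.2 * (timeAvg T (K z.2) f z.1 * timeAvg T (K' z.2) f z.1))
        ∂(μ.prod (volume.restrict (Ioo 0 T))) ≤ (1 / T + 1) *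
        (∫ z, timeAvg T (K z.2) f z.1 ^ 2 ∂(μ.prod (volume.restrict (Ioo 0 T)))) +
        ∫ z, timeAvg T (K' z.2) f z.1 ^ 2 ∂(μ.prod (volume.restrict (Ioo 0 T))) := by
    intro θ θ' hθ hθ1 hθ' hθ'c
    rw [← integral_const_mul, ← integral_add (hm.integrable_sq.const_mul _) hm'.integrable_sq]
    refine integral_mono_ae ?_ ((hm.integrable_sq.const_mul _).add hm'.integrable_sq) ?_
    · refine Integrable.add ?_ ?_
      · have := integrable_mul_of_memLp (memLp_time_weight_mul hm hθ'c) hm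
        exact this.congr (Eventually.of_forall fun z => by ring)
      · have := (integrable_mul_of_memLp (memLp_time_weight_mul hm hθ) hm').const_mul 2
        exact this.congr (Eventually.of_forall fun z => by ring)
    · filter_upwards [ae_prod_snd_mem (μ := μ) (ae_restrict_mem measurableSet_Ioo)] with z hz
      have h1 := two_mul_mul_le_of_abs_le_one (hθ1 _ hz) (timeAvg T (K z.2) f z.1)
        (timeAvg T (K' z.2) f z.1)
      have h2 := mul_le_mul_of_nonneg_right (hθ' z.2) (sq_nonneg (timeAvg T (K z.2) f z.1))
      linarith
  have hTi : ∀ t ∈ Ioo 0 T, 0 < t / T ∧ t / T < 1 := fun t ht =>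
    ⟨div_pos ht.1 hT, (div_lt_one hT).2 ht.2⟩
  have hT' : 0 < 1 / T := by positivity
  rintro t (rfl | rfl)
  · have h1 := hK.integral_sq hT.le hf (θ := fun t => -(1 - t / T)) (θ' := fun _ => 1 / T)
      (fun t => by
        have := (hasDerivAt_decreasing_ramp T t).fun_neg
        rwa [neg_neg] at this) continuous_const
    rw [div_self hT.ne'] at h1
    simp only [sub_self, neg_zero, zero_mul, zero_div, sub_zero, neg_mul, one_mul, sub_neg_eq_add,
      zero_add] at h1
    rw [h1]
    refine hbound (fun t => -(1 - t / T)) (fun _ => 1 / T) (by fun_prop) (fun t ht => ?_)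
      (fun _ => le_rfl) continuous_const
    have := hTi t ht
    rw [abs_le]; constructor <;> linarith
  · have h1 := hK.integral_sq hT.le hf (θ := fun s => s / t) (θ' := fun _ => 1 / t)
      (hasDerivAt_increasing_ramp t) continuous_const
    rw [div_self hT.ne'] at h1
    simp only [zero_mul, zero_div, sub_zero, one_mul] at h1
    rw [h1]
    refine hbound (fun s => s / t) (fun _ => 1 / t) (by fun_prop) (fun t ht => ?_)
      (fun _ => le_rfl) continuous_const
    have := hTi t ht
    rw [abs_le]; constructor <;> linarith

variable {u ut L : SpaceTime d → ℝ} {g : Fin d → SpaceTime d → ℝ}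

/-- The gradients of a time average at `t = 0` and `t = T` are controlled by norms on `Q`; of
the second derivatives only the Laplacian enters. -/
theorem IsNeumannRegular.integral_grad_sq_endpoint_le (hT : 0 < T)
    (hΩ : IsFiniteMeasure (volume.restrict Ω))
    (h : IsNeumannRegular Ω T u ut L g) {K K' : ℝ → ℝ → ℝ} (hK : IsTimeKernel T K K') :
    ∀ t ∈ ({0, T} : Set ℝ), ∑ i, ∫ x in Ω, timeAvg T (K t) (g i) x ^ 2 ≤
      1 / T * (∑ i, ∫ z in parCylinder Ω T, timeAvg T (K z.2) (g i) z.1 ^ 2) +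
        ((∫ z in parCylinder Ω T, timeAvg T (K' z.2) u z.1 ^ 2) +
        ∫ z in parCylinder Ω T, timeAvg T (K z.2) L z.1 ^ 2) := by
  obtain ⟨M, hM⟩ := hK.bounded
  obtain ⟨M', hM'⟩ := hK.bounded'
  have hbound : ∀ θ : ℝ → ℝ, Continuous θ → (∀ t ∈ Ioo 0 T, |θ t| ≤ 1) →
      -(2 * ∫ z in parCylinder Ω T,
          θ z.2 * (timeAvg T (K' z.2) u z.1 * timeAvg T (K z.2) L z.1)) ≤
      (∫ z in parCylinder Ω T, timeAvg T (K' z.2) u z.1 ^ 2) +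
        ∫ z in parCylinder Ω T, timeAvg T (K z.2) L z.1 ^ 2 := by
    intro θ hθ hθ1
    have hu := h.memLp
    have hL := h.memLp_lap
    rw [volume_restrict_parCylinder] at hu hL ⊢
    have m1 := memLp_timeAvg_kernel hu hK.continuous' hM'
    have m2 := memLp_timeAvg_kernel hL hK.continuous hM
    rw [← neg_mul, ← integral_const_mul, ← integral_add m1.integrable_sq m2.integrable_sq]
    refine integral_mono_ae ?_ (m1.integrable_sq.add m2.integrable_sq) ?_
    · have := (integrable_mul_of_memLp (memLp_time_weight_mul m1 hθ) m2).const_mul (-2)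
      exact this.congr (Eventually.of_forall fun z => by ring)
    · filter_upwards [ae_prod_snd_mem (μ := volume.restrict Ω)
        (ae_restrict_mem measurableSet_Ioo)] with z hz
      have h1 := two_mul_mul_le_of_abs_le_one (c := -θ z.2) (by rw [abs_neg]; exact hθ1 _ hz)
        (timeAvg T (K' z.2) u z.1) (timeAvg T (K z.2) L z.1)
      linarith
  have hTi : ∀ t ∈ Ioo 0 T, 0 < t / T ∧ t / T < 1 := fun t ht =>
    ⟨div_pos ht.1 hT, (div_lt_one hT).2 ht.2⟩
  rintro t (rfl | rfl)
  · have h1 := h.integral_grad_sq_kernel hT.le hΩ hK (θ := fun t => -(1 - t / T))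
      (θ' := fun _ => 1 / T)
      (fun t => by
        have := (hasDerivAt_decreasing_ramp T t).fun_neg
        rwa [neg_neg] at this) continuous_const
    have h2 := hbound (fun t => -(1 - t / T)) (by fun_prop) (fun t ht => by
      have := hTi t ht
      rw [abs_le]; constructor <;> linarith)
    rw [div_self hT.ne'] at h1
    simp only [sub_self, neg_zero, zero_mul, zero_div, sub_zero, neg_mul, one_mul, sub_neg_eq_add,
      zero_add] at h1
    simp only [neg_mul] at h2
    rw [h1]
    simp_rw [integral_const_mul, ← Finset.mul_sum]
    linarith
  · have h1 := h.integral_grad_sq_kernel hT.le hΩ hK (θ := fun s => s / t) (θ' := fun _ => 1 / t)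
      (hasDerivAt_increasing_ramp t) continuous_const
    have h2 := hbound (fun s => s / t) (by fun_prop) (fun t ht => by
      have := hTi t ht
      rw [abs_le]; constructor <;> linarith)
    rw [div_self hT.ne'] at h1
    simp only [zero_mul, zero_div, sub_zero, one_mul] at h1
    rw [h1]
    simp_rw [integral_const_mul, ← Finset.mul_sum]
    linarith

/-- For a time average, differentiating the kernel amounts to averaging the weak derivative. -/
theorem timeAvg_kernel_deriv_ae_eq (hΩo : IsOpen Ω) (hΩ : IsFiniteMeasure (volume.restrict Ω))
    {f f' : SpaceTime d → ℝ}
    (hf : MemLp f 2 (volume.restrict (parCylinder Ω T)))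
    (hf' : MemLp f' 2 (volume.restrict (parCylinder Ω T)))
    (h : HasWeakDeriv (parCylinder Ω T) timeDir f f') {K K' : ℝ → ℝ → ℝ}
    (hK : IsTimeKernel T K K') {a : ℝ} (ha : ∀ t, K' t = fun τ => -(a * deriv (K t) τ)) :
    (fun z : SpaceTime d => a * timeAvg T (K z.2) f' z.1) =ᵐ[volume.restrict (parCylinder Ω T)]
      fun z => timeAvg T (K' z.2) f z.1 := by
  obtain ⟨M, hM⟩ := hK.bounded
  obtain ⟨M', hM'⟩ := hK.bounded'
  have m := hf
  have m' := hf'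
  rw [volume_restrict_parCylinder] at m m' ⊢
  refine ae_eq_prod_of_ae_ae_eq ((memLp_timeAvg_kernel m' hK.continuous hM).const_mul a).1
    (memLp_timeAvg_kernel m hK.continuous' hM').1 ?_
  filter_upwards [ae_restrict_mem measurableSet_Ioo] with t ht
  filter_upwards [timeAvg_deriv hΩo hΩ hf hf' h (hK.test t (Ioo_subset_Icc_self ht)) a] with x hx
  rw [ha, hx]

theorem integral_timeAvg_kernel_sub_sq (hΩ : IsFiniteMeasure (volume.restrict Ω))
    {f : SpaceTime d → ℝ}
    (hf : MemLp f 2 (volume.restrict (parCylinder Ω T))) {K J : ℝ → ℝ → ℝ}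
    (hK : ∀ t, Continuous (K t)) (hJ : ∀ t, Continuous (J t)) :
    ∫ z in parCylinder Ω T, timeAvg T (fun τ => K z.2 τ - J z.2 τ) f z.1 ^ 2 =
      ∫ z in parCylinder Ω T, (timeAvg T (K z.2) f z.1 - timeAvg T (J z.2) f z.1) ^ 2 := by
  rw [volume_restrict_parCylinder] at hf ⊢
  refine integral_congr_ae ?_
  filter_upwards [(Measure.quasiMeasurePreserving_fst (μ := volume.restrict Ω)
    (ν := volume.restrict (Ioo 0 T))).ae (ae_integrable_timeAvg hf)] with z hz
  rw [timeAvg_sub hz (hK _) (hJ _)]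

theorem integral_timeAvg_slice_sub_sq (hΩ : IsFiniteMeasure (volume.restrict Ω))
    {f : SpaceTime d → ℝ}
    (hf : MemLp f 2 (volume.restrict (parCylinder Ω T))) {κ κ' : ℝ → ℝ}
    (hκ : Continuous κ) (hκ' : Continuous κ') :
    ∫ x in Ω, timeAvg T (fun τ => κ τ - κ' τ) f x ^ 2 =
      ∫ x in Ω, (timeAvg T κ f x - timeAvg T κ' f x) ^ 2 := by
  rw [volume_restrict_parCylinder] at hf
  refine integral_congr_ae ?_
  filter_upwards [ae_integrable_timeAvg hf] with x hx
  rw [timeAvg_sub hx hκ hκ']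

end Traces

/-! ### Traces in time and energy identities -/

section TraceIdentities

variable {d : ℕ} {Ω : Set (Space d)} {T : ℝ}

instance : (volume : Measure (SpaceTime d)).IsAddHaarMeasure := by
  rw [Measure.volume_eq_prod]; infer_instance

/-- Products of two functions converging in `L²(Q)` have converging integrals against `θ(t)`. -/
theorem tendsto_integral_time_weight (hΩ : IsFiniteMeasure (volume.restrict Ω))
    {f f' : ℕ → SpaceTime d → ℝ} {g g' : SpaceTime d → ℝ}
    (h : TendstoL2 (volume.restrict (parCylinder Ω T)) f g)
    (h' : TendstoL2 (volume.restrict (parCylinder Ω T)) f' g') {θ : ℝ → ℝ} (hθ : Continuous θ) :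
    Tendsto (fun n => ∫ z in parCylinder Ω T, θ z.2 * (f n z * f' n z)) atTop
      (𝓝 (∫ z in parCylinder Ω T, θ z.2 * (g z * g' z))) := by
  obtain ⟨C, hC⟩ := ae_abs_le_of_continuous hθ T
  have hb : TendstoL2 (volume.restrict (parCylinder Ω T)) (fun n z => θ z.2 * f n z)
      (fun z => θ z.2 * g z) := by
    refine h.bounded_mul (w := fun z => θ z.2) (C := C)
      (hθ.measurable.comp measurable_snd).aestronglyMeasurable ?_
    rw [volume_restrict_parCylinder]
    filter_upwards [ae_prod_snd_mem (μ := volume.restrict Ω) (ae_restrict_mem measurableSet_Ioo)]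
      with z hz using hC _ hz
  simpa only [mul_assoc] using hb.integral_mul h'

theorem integrable_time_weight {f g : SpaceTime d → ℝ}
    (hΩ : IsFiniteMeasure (volume.restrict Ω))
    (h : MemLp f 2 (volume.restrict (parCylinder Ω T)))
    (h' : MemLp g 2 (volume.restrict (parCylinder Ω T))) {θ : ℝ → ℝ} (hθ : Continuous θ) :
    Integrable (fun z => θ z.2 * (f z * g z)) (volume.restrict (parCylinder Ω T)) := by
  rw [volume_restrict_parCylinder] at *
  exact (integrable_mul_of_memLp (memLp_time_weight_mul h hθ) h').congr
    (Eventually.of_forall fun z => by ring)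

/-- The traces of `u` and of its gradient at the times `0` and `T`, together with the energy
identities that they satisfy for every smooth weight `θ` depending on time alone. -/
structure HasEnergyIdentities (Ω : Set (Space d)) (T : ℝ) (u ut L : SpaceTime d → ℝ)
    (g : Fin d → SpaceTime d → ℝ) (u0 uT : Space d → ℝ) (g0 gT : Fin d → Space d → ℝ) : Prop where
  memLp_zero : MemLp u0 2 (volume.restrict Ω)
  memLp_end : MemLp uT 2 (volume.restrict Ω)
  memLp_grad_zero : ∀ i, MemLp (g0 i) 2 (volume.restrict Ω)
  memLp_grad_end : ∀ i, MemLp (gT i) 2 (volume.restrict Ω)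
  hasWeakDeriv_zero : ∀ i, HasWeakDeriv Ω (unitVec i) u0 (g0 i)
  hasWeakDeriv_end : ∀ i, HasWeakDeriv Ω (unitVec i) uT (gT i)
  integral_test : ∀ ψ : SpaceTime d → ℝ, IsTestFunction (Ω ×ˢ (univ : Set ℝ)) ψ →
    ∫ z in parCylinder Ω T, (u z * fderiv ℝ ψ z timeDir + ut z * ψ z) =
      (∫ x in Ω, uT x * ψ (x, T)) - ∫ x in Ω, u0 x * ψ (x, 0)
  integral_sq : ∀ θ θ' : ℝ → ℝ, (∀ t, HasDerivAt θ (θ' t) t) → Continuous θ' →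
    θ T * (∫ x in Ω, uT x ^ 2) - θ 0 * ∫ x in Ω, u0 x ^ 2 =
      (∫ z in parCylinder Ω T, θ' z.2 * u z ^ 2) +
        2 * ∫ z in parCylinder Ω T, θ z.2 * (u z * ut z)
  integral_grad_sq : ∀ θ θ' : ℝ → ℝ, (∀ t, HasDerivAt θ (θ' t) t) → Continuous θ' →
    θ T * (∑ i, ∫ x in Ω, gT i x ^ 2) - θ 0 * (∑ i, ∫ x in Ω, g0 i x ^ 2) =
      (∑ i, ∫ z in parCylinder Ω T, θ' z.2 * g i z ^ 2) -
        2 * ∫ z in parCylinder Ω T, θ z.2 * (ut z * L z)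
  integral_green : ∀ θ : ℝ → ℝ, Continuous θ →
    ∫ z in parCylinder Ω T, θ z.2 * (u z * L z) =
      - ∑ i, ∫ z in parCylinder Ω T, θ z.2 * g i z ^ 2

theorem IsTestFunction.memLp_slice (hΩ : IsFiniteMeasure (volume.restrict Ω))
    {D : Set (SpaceTime d)} {ψ : SpaceTime d → ℝ} (hψ : IsTestFunction D ψ) (t : ℝ) :
    MemLp (fun x => ψ (x, t)) 2 (volume.restrict Ω) := by
  obtain ⟨C, hC⟩ := hψ.bounded
  exact MemLp.of_bound (hψ.1.continuous.comp (by fun_prop)).aestronglyMeasurable C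
    (Eventually.of_forall fun x => hC _)

/-- The formula that characterizes time traces holds for averages in time. -/
theorem IsTimeKernel.integral_test (hT : 0 ≤ T) (hΩ : IsFiniteMeasure (volume.restrict Ω))
    {K K' : ℝ → ℝ → ℝ} (hK : IsTimeKernel T K K') {f : SpaceTime d → ℝ}
    (hf : MemLp f 2 (volume.restrict (parCylinder Ω T))) {D : Set (SpaceTime d)}
    {ψ : SpaceTime d → ℝ} (hψ : IsTestFunction D ψ) :
    (∫ x in Ω, timeAvg T (K T) f x * ψ (x, T)) - ∫ x in Ω, timeAvg T (K 0) f x * ψ (x, 0) =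
      (∫ z in parCylinder Ω T, timeAvg T (K z.2) f z.1 * fderiv ℝ ψ z timeDir) +
        ∫ z in parCylinder Ω T, timeAvg T (K' z.2) f z.1 * ψ z := by
  obtain ⟨M, hM⟩ := hK.bounded
  obtain ⟨M', hM'⟩ := hK.bounded'
  rw [volume_restrict_parCylinder] at hf ⊢
  have hm := memLp_timeAvg_kernel hf hK.continuous hM
  have hm' := memLp_timeAvg_kernel hf hK.continuous' hM'
  have hψm : ∀ {φ : SpaceTime d → ℝ}, IsTestFunction D φ →
      MemLp φ 2 ((volume.restrict Ω).prod (volume.restrict (Ioo 0 T))) := fun hφ => by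
    obtain ⟨C, hC⟩ := hφ.bounded
    exact MemLp.of_bound hφ.1.continuous.aestronglyMeasurable C (Eventually.of_forall hC)
  have i1 := integrable_mul_of_memLp hm (hψm (hψ.fderiv timeDir))
  have i2 := integrable_mul_of_memLp hm' (hψm hψ)
  rw [← integral_add i1 i2]
  refine integral_sub_eq_integral_deriv hT
    (G := fun z : SpaceTime d => timeAvg T (K z.2) f z.1 * ψ z) ?_ (i1.add i2)
    (integrable_mul_of_memLp (memLp_timeAvg hf (hK.continuous_left 0)) (hψ.memLp_slice hΩ 0))
    (integrable_mul_of_memLp (memLp_timeAvg hf (hK.continuous_left T)) (hψ.memLp_slice hΩ T))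
  filter_upwards [ae_integrable_timeAvg hf] with x hx
  have hc : Continuous fun t => timeAvg T (K t) f x :=
    continuous_iff_continuousAt.2 fun t => (hK.hasDerivAt_timeAvg hx t).continuousAt
  have hc' := hK.continuous_timeAvg' hx
  have hψc : Continuous fun t : ℝ => ψ (x, t) := hψ.1.continuous.comp (by fun_prop)
  have hψc' : Continuous fun t : ℝ => fderiv ℝ ψ (x, t) timeDir :=
    (hψ.fderiv timeDir).1.continuous.comp (by fun_prop)
  refine ⟨fun t => ?_, (hc.mul hψc').add (hc'.mul hψc)⟩
  have h1 : HasDerivAt (fun t : ℝ => ψ (x, t)) (fderiv ℝ ψ (x, t) timeDir) t :=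
    ((hψ.1.differentiable (by simp)) (x, t)).hasFDerivAt.comp_hasDerivAt t
      ((hasDerivAt_const t x).prodMk (hasDerivAt_id t))
  refine ((hK.hasDerivAt_timeAvg hx t).mul h1).congr_deriv ?_
  ring

variable {u ut L : SpaceTime d → ℝ} {g : Fin d → SpaceTime d → ℝ}

/-- Time averages of `u` with kernels concentrating on the diagonal satisfy the energy identities
exactly.  Applied to differences, the identities show that their values at `t = 0` and `t = T`
are Cauchy sequences, and the limits are the traces. -/
theorem IsNeumannRegular.exists_traces (hΩo : IsOpen Ω) (hΩ : IsFiniteMeasure (volume.restrict Ω))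
    (hT : 0 < T) (h : IsNeumannRegular Ω T u ut L g) :
    ∃ u0 uT g0 gT, HasEnergyIdentities Ω T u ut L g u0 uT g0 gT := by
  obtain ⟨K, K', a, hK, hKa, ha, hlim⟩ := exists_timeKernel_seq hΩo hΩ hT
  have lu := hlim u h.memLp
  have lL := hlim L h.memLp_lap
  have lg := fun i => hlim (g i) (h.memLp_grad i)
  have lu' : TendstoL2 (volume.restrict (parCylinder Ω T))
      (fun n z => timeAvg T (K' n z.2) u z.1) ut := by
    have := ((hlim ut h.memLp_dt).const_mul_tendsto ha).congr fun n =>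
      timeAvg_kernel_deriv_ae_eq hΩo hΩ h.memLp h.memLp_dt h.hasWeakDeriv_dt (hK n) (hKa n)
    simpa only [one_mul] using this
  have hup : MemLp u 2 ((volume.restrict Ω).prod (volume.restrict (Ioo 0 T))) := by
    rw [← volume_restrict_parCylinder]; exact h.memLp
  have hgp : ∀ i, MemLp (g i) 2 ((volume.restrict Ω).prod (volume.restrict (Ioo 0 T))) := by
    rw [← volume_restrict_parCylinder]; exact h.memLp_grad
  have hend : ∀ t ∈ ({0, T} : Set ℝ), t ∈ Icc 0 T := by
    rintro t (rfl | rfl)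
    exacts [left_mem_Icc.2 hT.le, right_mem_Icc.2 hT.le]
  have cu : ∀ t ∈ ({0, T} : Set ℝ), ∃ b, TendstoL2 (volume.restrict Ω)
      (fun n => timeAvg T (K n t) u) b := by
    intro t ht
    refine TendstoL2.exists_of_cauchy
      (fun n => memLp_timeAvg hup ((hK n).continuous_left t)) ?_
    have hs := ((lu.tendsto_integral_sq_sub).const_mul (1 / T + 1)).add lu'.tendsto_integral_sq_sub
    rw [mul_zero, zero_add] at hs
    refine squeeze_zero (fun p => integral_nonneg fun x => sq_nonneg _) (fun p => ?_) hs
    have := ((hK p.1).sub (hK p.2)).integral_sq_endpoint_le hT hup t ht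
    rw [← volume_restrict_parCylinder, integral_timeAvg_kernel_sub_sq hΩ h.memLp
      (hK p.1).continuous_left (hK p.2).continuous_left, integral_timeAvg_kernel_sub_sq hΩ h.memLp
      (hK p.1).continuous_left' (hK p.2).continuous_left', integral_timeAvg_slice_sub_sq hΩ h.memLp
      ((hK p.1).continuous_left t) ((hK p.2).continuous_left t)] at this
    exact this
  have cg : ∀ t ∈ ({0, T} : Set ℝ), ∀ i, ∃ b, TendstoL2 (volume.restrict Ω)
      (fun n => timeAvg T (K n t) (g i)) b := by
    intro t ht i
    refine TendstoL2.exists_of_cauchy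
      (fun n => memLp_timeAvg (hgp i) ((hK n).continuous_left t)) ?_
    have hs := ((tendsto_finsetSum Finset.univ fun i _ =>
      (lg i).tendsto_integral_sq_sub).const_mul (1 / T)).add
      (lu'.tendsto_integral_sq_sub.add lL.tendsto_integral_sq_sub)
    rw [Finset.sum_const_zero, mul_zero, zero_add, zero_add] at hs
    refine squeeze_zero (fun p => integral_nonneg fun x => sq_nonneg _) (fun p => ?_) hs
    have := h.integral_grad_sq_endpoint_le hT hΩ ((hK p.1).sub (hK p.2)) t ht
    rw [integral_timeAvg_kernel_sub_sq hΩ h.memLp_lap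
      (hK p.1).continuous_left (hK p.2).continuous_left, integral_timeAvg_kernel_sub_sq hΩ h.memLp
      (hK p.1).continuous_left' (hK p.2).continuous_left'] at this
    simp_rw [integral_timeAvg_kernel_sub_sq hΩ (h.memLp_grad _)
      (hK p.1).continuous_left (hK p.2).continuous_left,
      integral_timeAvg_slice_sub_sq hΩ (h.memLp_grad _)
      ((hK p.1).continuous_left t) ((hK p.2).continuous_left t)] at this
    refine le_trans ?_ this
    exact Finset.single_le_sum (f := fun i => ∫ x in Ω, (timeAvg T (K p.1 t) (g i) x -
      timeAvg T (K p.2 t) (g i) x) ^ 2) (fun i _ => integral_nonneg fun x => sq_nonneg _)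
      (Finset.mem_univ i)
  obtain ⟨u0, hu0⟩ := cu 0 (by simp)
  obtain ⟨uT, huT⟩ := cu T (by simp)
  choose g0 hg0 using cg 0 (by simp)
  choose gT hgT using cg T (by simp)
  have hweak : ∀ t ∈ Icc 0 T, ∀ (b : Space d → ℝ) (b' : Space d → ℝ) i,
      TendstoL2 (volume.restrict Ω) (fun n => timeAvg T (K n t) u) b →
      TendstoL2 (volume.restrict Ω) (fun n => timeAvg T (K n t) (g i)) b' →
      HasWeakDeriv Ω (unitVec i) b b' := fun t ht b b' i hb hb' =>
    HasWeakDeriv.of_tendstoL2 (fun n => hasWeakDeriv_timeAvg hΩ h.memLp (h.memLp_grad i)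
      (h.hasWeakDeriv_grad i) ((hK n).test t ht)) hb hb'
  refine ⟨u0, uT, g0, gT, hu0.memLp_lim, huT.memLp_lim, fun i => (hg0 i).memLp_lim,
    fun i => (hgT i).memLp_lim, fun i => hweak 0 (hend 0 (by simp)) _ _ i hu0 (hg0 i),
    fun i => hweak T (hend T (by simp)) _ _ i huT (hgT i), ?_, ?_, ?_, ?_⟩
  · intro ψ hψ
    have hψm : ∀ {φ : SpaceTime d → ℝ}, IsTestFunction (Ω ×ˢ (univ : Set ℝ)) φ →
        MemLp φ 2 (volume.restrict (parCylinder Ω T)) := fun hφ => by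
      rw [volume_restrict_parCylinder]
      obtain ⟨C, hC⟩ := hφ.bounded
      exact MemLp.of_bound hφ.1.continuous.aestronglyMeasurable C (Eventually.of_forall hC)
    rw [integral_add (integrable_mul_of_memLp h.memLp (hψm (hψ.fderiv _)))
      (integrable_mul_of_memLp h.memLp_dt (hψm hψ))]
    refine tendsto_nhds_unique ((lu.integral_mul (TendstoL2.const (hψm (hψ.fderiv timeDir)))).add
      (lu'.integral_mul (TendstoL2.const (hψm hψ)))) ?_
    refine Tendsto.congr (fun n => (hK n).integral_test hT.le hΩ h.memLp hψ) ?_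
    exact (huT.integral_mul (TendstoL2.const (hψ.memLp_slice hΩ T))).sub
      (hu0.integral_mul (TendstoL2.const (hψ.memLp_slice hΩ 0)))
  · intro θ θ' hθ hθ'
    have hθc : Continuous θ := continuous_iff_continuousAt.2 fun t => (hθ t).continuousAt
    have l1 := ((huT.integral_mul huT).const_mul (θ T)).sub ((hu0.integral_mul hu0).const_mul (θ 0))
    have l2 := (tendsto_integral_time_weight hΩ lu lu hθ').add
      ((tendsto_integral_time_weight hΩ lu lu' hθc).const_mul 2)
    simp only [← sq] at l1 l2
    refine tendsto_nhds_unique l1 (l2.congr fun n => ?_)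
    rw [(hK n).integral_sq hT.le hup hθ hθ', ← volume_restrict_parCylinder, ← integral_const_mul,
      ← integral_add]
    · congr 1; ext z; ring
    · simp only [sq]; exact integrable_time_weight hΩ (lu.memLp n) (lu.memLp n) hθ'
    · exact (integrable_time_weight hΩ (lu.memLp n) (lu'.memLp n) hθc).const_mul 2
  · intro θ θ' hθ hθ'
    have hθc : Continuous θ := continuous_iff_continuousAt.2 fun t => (hθ t).continuousAt
    have l1 := ((tendsto_finsetSum Finset.univ fun i _ =>
      (hgT i).integral_mul (hgT i)).const_mul (θ T)).sub
      ((tendsto_finsetSum Finset.univ fun i _ => (hg0 i).integral_mul (hg0 i)).const_mul (θ 0))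
    have l2 := (tendsto_finsetSum Finset.univ fun i _ =>
      tendsto_integral_time_weight hΩ (lg i) (lg i) hθ').sub
      ((tendsto_integral_time_weight hΩ lu' lL hθc).const_mul 2)
    simp only [← sq] at l1 l2
    refine tendsto_nhds_unique l1 (l2.congr fun n => ?_)
    rw [← h.integral_grad_sq_kernel hT.le hΩ (hK n) hθ hθ', Finset.sum_sub_distrib,
      Finset.mul_sum, Finset.mul_sum]
  · intro θ hθ
    have l1 := tendsto_integral_time_weight hΩ lu lL hθ
    have l2 := (tendsto_finsetSum Finset.univ fun i _ =>
      tendsto_integral_time_weight hΩ (lg i) (lg i) hθ).neg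
    simp only [← sq] at l2
    refine tendsto_nhds_unique l1 (l2.congr fun n => ?_)
    rw [h.integral_green_kernel hΩ (hK n) (hK n).continuous (hK n).bounded (hK n).test hθ]
    simp only [← sq]

end TraceIdentities

/-! ### Averaging the Neumann condition in time -/

section TimeAverageLimits

set_option linter.unusedSectionVars false

variable {X : Type*} [MeasurableSpace X] {μ : Measure X} [IsFiniteMeasure μ] {T : ℝ}

theorem TendstoL2.congr_lim {f : ℕ → X → ℝ} {g g' : X → ℝ} (h : TendstoL2 μ f g)
    (hg : g =ᵐ[μ] g') : TendstoL2 μ f g' := by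
  refine ⟨h.memLp, h.memLp_lim.ae_eq hg, h.tendsto.congr fun n => eLpNorm_congr_ae ?_⟩
  filter_upwards [hg] with x hx
  rw [hx]

theorem timeAvg_finsetSum {J : Type*} (s : Finset J) {f : J → X × ℝ → ℝ}
    (hf : ∀ i ∈ s, MemLp (f i) 2 (μ.prod (volume.restrict (Ioo 0 T)))) {κ : ℝ → ℝ}
    (hκ : Continuous κ) :
    timeAvg T κ (fun z => ∑ i ∈ s, f i z) =ᵐ[μ] fun x => ∑ i ∈ s, timeAvg T κ (f i) x := by
  have h : ∀ᵐ x ∂μ, ∀ i ∈ s, Integrable (fun τ => f i (x, τ)) (volume.restrict (Ioo 0 T)) :=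
    (ae_ball_iff s.countable_toSet).2 fun i hi => ae_integrable_timeAvg (hf i hi)
  filter_upwards [h] with x hx
  simp only [timeAvg, Finset.mul_sum]
  exact integral_finsetSum _ fun i hi => integrable_weight_mul (hx i hi) hκ

theorem timeAvg_mul_left (κ : ℝ → ℝ) (f : X × ℝ → ℝ) (m : X → ℝ) (x : X) :
    timeAvg T κ (fun z => f z * m z.1) x = timeAvg T κ f x * m x := by
  rw [timeAvg, timeAvg, ← integral_mul_const]
  congr 1; ext τ; ring

/-- Averaging in time is continuous from `L²(Q)` to `L²(Ω)`. -/
theorem TendstoL2.average_in_time {f : ℕ → X × ℝ → ℝ} {g : X × ℝ → ℝ}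
    (h : TendstoL2 (μ.prod (volume.restrict (Ioo 0 T))) f g) {κ : ℝ → ℝ} (hκ : Continuous κ) :
    TendstoL2 μ (fun n => timeAvg T κ (f n)) (timeAvg T κ g) := by
  obtain ⟨C, hC⟩ := ae_abs_le_of_continuous hκ T
  have hw := h.bounded_mul (w := fun z => κ z.2) (C := C)
    (hκ.measurable.comp measurable_snd).aestronglyMeasurable (by
      filter_upwards [ae_prod_snd_mem (μ := μ) (ae_restrict_mem measurableSet_Ioo)] with z hz
        using hC _ hz)
  refine ⟨fun n => memLp_timeAvg (h.memLp n) hκ, memLp_timeAvg h.memLp_lim hκ, ?_⟩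
  have h1 : Tendsto (fun n => (volume.restrict (Ioo 0 T) univ) *
      eLpNorm (fun z => κ z.2 * f n z - κ z.2 * g z) 2 (μ.prod (volume.restrict (Ioo 0 T))) ^ 2)
      atTop (𝓝 0) := by
    have := ENNReal.Tendsto.const_mul (a := volume.restrict (Ioo 0 T) univ)
      ((ENNReal.continuous_pow 2).tendsto _ |>.comp hw.tendsto) (Or.inr (measure_ne_top _ _))
    simpa using this
  have h2 : Tendsto (fun n => eLpNorm (fun x => timeAvg T κ (f n) x -
      timeAvg T κ g x) 2 μ ^ 2) atTop (𝓝 0) := by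
    refine tendsto_of_tendsto_of_tendsto_of_le_of_le tendsto_const_nhds h1 (fun _ => zero_le) ?_
    intro n
    have hm : AEStronglyMeasurable (fun z => κ z.2 * f n z - κ z.2 * g z)
        (μ.prod (volume.restrict (Ioo 0 T))) := (hw.memLp n).1.sub hw.memLp_lim.1
    refine le_trans (le_of_eq ?_) (eLpNorm_integral_sq_le hm)
    rw [eLpNorm_congr_ae]
    filter_upwards [ae_integrable_timeAvg (h.memLp n), ae_integrable_timeAvg h.memLp_lim]
      with x hx hx'
    exact integral_sub (integrable_weight_mul hx hκ) (integrable_weight_mul hx' hκ)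
  have h3 := (ENNReal.continuous_rpow_const (y := 1 / 2)).tendsto _ |>.comp h2
  rw [ENNReal.zero_rpow_of_pos (by norm_num)] at h3
  refine h3.congr fun n => ?_
  rw [Function.comp_apply, ← ENNReal.rpow_natCast, ← ENNReal.rpow_mul]
  norm_num

end TimeAverageLimits

section NeumannRegular

variable {d : ℕ} {Ω : Set (Space d)} {T : ℝ}

/-- Averages in time of test functions on `Q` are test functions on `Ω`; they are smooth as
convolutions in time, depending smoothly on the parameter `x`, evaluated at time `0`. -/
theorem IsTestFunction.average_in_time {φ : SpaceTime d → ℝ}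
    (hφ : IsTestFunction (parCylinder Ω T) φ)
    {κ : ℝ → ℝ} (hκ : Continuous κ) : IsTestFunction Ω (timeAvg T κ φ) := by
  have hsupp : ∀ x τ, φ (x, τ) ≠ 0 → (x, τ) ∈ tsupport φ := fun x τ h => subset_tsupport _ h
  have hsub : tsupport (timeAvg T κ φ) ⊆ Prod.fst '' tsupport φ := by
    refine closure_minimal (fun x hx => ?_) (hφ.2.1.image continuous_fst).isClosed
    by_contra hx'
    refine hx (integral_eq_zero_of_ae (Eventually.of_forall fun τ => ?_))
    by_cases h0 : φ (x, τ) = 0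
    · simp [h0]
    · exact absurd ⟨(x, τ), hsupp x τ h0, rfl⟩ hx'
  refine ⟨?_, (hφ.2.1.image continuous_fst).of_isClosed_subset (isClosed_tsupport _) hsub, ?_⟩
  · have h1 : ContDiffOn ℝ ((⊤ : ℕ∞) : WithTop ℕ∞)
        (fun x : Space d => convolution κ (fun σ => φ (x, -σ))
          (ContinuousLinearMap.mul ℝ ℝ) volume ((fun _ => (0 : ℝ)) x)) univ := by
      refine contDiffOn_convolution_right_with_param_comp (ContinuousLinearMap.mul ℝ ℝ)
        (g := fun (x : Space d) (σ : ℝ) => φ (x, -σ))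
        (k := (fun z : SpaceTime d => -z.2) '' tsupport φ)
        contDiffOn_const isOpen_univ (hφ.2.1.image (by fun_prop)) ?_ hκ.locallyIntegrable ?_
      · intro x σ _ hσ
        by_contra h0
        exact hσ ⟨(x, -σ), hsupp _ _ h0, neg_neg σ⟩
      · exact (hφ.1.comp (contDiff_fst.prodMk contDiff_snd.neg)).contDiffOn
    rw [contDiffOn_univ] at h1
    refine (congrArg (ContDiff ℝ ∞) (funext fun x => ?_)).mp h1
    rw [convolution_def, timeAvg, setIntegral_eq_integral_of_forall_compl_eq_zero]
    · congr 1; ext τ; simp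
    · intro τ hτ
      by_cases h0 : φ (x, τ) = 0
      · simp [h0]
      · exact absurd (hφ.2.2 (hsupp x τ h0)).2 hτ
  · rintro x hx
    obtain ⟨z, hz, rfl⟩ := hsub hx
    exact (hφ.2.2 hz).1

theorem isFiniteMeasure_restrict (hΩ : Bornology.IsBounded Ω) :
    IsFiniteMeasure (volume.restrict Ω) :=
  ⟨by simpa using hΩ.measure_lt_top⟩

/-- Functions in `H^{2,1}(Q)` with zero normal derivative: averaging the Neumann condition in time
puts the normal component of the averaged gradient in `H¹₀(Ω)`, and Green's formula on `Ω` has no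
boundary term. -/
theorem MemH21.isNeumannRegular (hΩ : IsSmoothBoundedDomain Ω) {u : SpaceTime d → ℝ}
    (hu : MemH21 (parCylinder Ω T) u) (hν : NeumannZero Ω T u) :
    IsNeumannRegular Ω T u (dt (parCylinder Ω T) u) (laplacianX (parCylinder Ω T) u)
      (fun i => weakDeriv (parCylinder Ω T) (spaceDir i) u) := by
  have hfin := isFiniteMeasure_restrict hΩ.isBounded
  set Q := parCylinder Ω T with hQ
  have hG := fun i => weakDeriv_spec (hu.space_deriv i)
  have hH := fun i j => weakDeriv_spec (hu.space_deriv₂ i j)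
  refine ⟨hu.memLp, (weakDeriv_spec hu.time_deriv).1, ?_, fun i => (hG i).1,
    (weakDeriv_spec hu.time_deriv).2, fun i => (hG i).2, ?_⟩
  · exact memLp_finsetSum _ fun i _ => (hH i i).1
  intro κ ψ ψ' hκ hψ hψ' hψψ'
  obtain ⟨N, hN, hNn, φ, q, hφ, hq, hφw, hφq⟩ := hν
  have hκc := hκ.1.continuous
  have hNi : ∀ i, Continuous fun x => N x i := fun i =>
    ((contDiff_piLp_apply (p := 2) (i := i)).comp hN).continuous
  have hw : (fun z : SpaceTime d => inner ℝ (gradX Q u z) (N z.1)) =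
      fun z => ∑ i, weakDeriv Q (spaceDir i) u z * N z.1 i := by
    ext z
    simp [gradX, PiLp.inner_apply, mul_comm]
  rw [hw] at hφw
  have hGm : ∀ i, MemLp (fun z : SpaceTime d => weakDeriv Q (spaceDir i) u z * N z.1 i) 2
      (volume.restrict Q) := by
    intro i
    obtain ⟨C, hC⟩ := exists_bound_of_continuous_of_isBounded hΩ.isBounded (hNi i)
    have := ((TendstoL2.const (hG i).1).bounded_mul (w := fun z : SpaceTime d => N z.1 i) (C := C)
      ((hNi i).comp continuous_fst).aestronglyMeasurable (by
        filter_upwards [ae_restrict_mem (isOpen_parCylinder hΩ.isOpen).measurableSet] with z hz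
          using hC _ hz.1)).memLp_lim
    simpa only [mul_comm] using this
  have hφm : ∀ n, MemLp (φ n) 2 (volume.restrict Q) := fun n => (hφ n).memLp
  have hφt : TendstoL2 (volume.restrict Q) φ
      (fun z => ∑ i, weakDeriv Q (spaceDir i) u z * N z.1 i) :=
    ⟨hφm, memLp_finsetSum _ fun i _ => hGm i, hφw⟩
  have hφ't : ∀ i, TendstoL2 (volume.restrict Q)
      (fun n z => fderiv ℝ (φ n) z (spaceDir i)) (q i) := fun i =>
    ⟨fun n => ((hφ n).fderiv _).memLp, hq i, hφq i⟩
  have hcong : ∀ n i, timeAvg T κ (fun z => fderiv ℝ (φ n) z (spaceDir i)) =ᵐ[volume.restrict Ω]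
      fun x => fderiv ℝ (timeAvg T κ (φ n)) x (unitVec i) := by
    intro n i
    have h1 := hasWeakDeriv_timeAvg hfin (hφm n) ((hφ n).fderiv (spaceDir i)).memLp
      ((hφ n).hasWeakDeriv (spaceDir i)) hκ
    have h2 := ((hφ n).average_in_time hκc).hasWeakDeriv (unitVec i)
    refine HasWeakDeriv.ae_eq hΩ.isOpen h1 h2 ?_ (((hφ n).average_in_time hκc).fderiv _).memLp
    have := (hφ't i).memLp n
    rw [hQ, volume_restrict_parCylinder] at this
    exact memLp_timeAvg this hκc
  have hprod : (volume.restrict Q : Measure (SpaceTime d)) =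
      (volume.restrict Ω).prod (volume.restrict (Ioo 0 T)) := volume_restrict_parCylinder Ω T
  have green := green_of_normal_component_zero hΩ hN hNn
    (F := fun i => timeAvg T κ (weakDeriv Q (spaceDir i) u))
    (F' := fun i j => timeAvg T κ (weakDeriv Q (spaceDir j) (weakDeriv Q (spaceDir i) u)))
    (fun i => memLp_timeAvg (hprod ▸ (hG i).1) hκc)
    (fun i j => memLp_timeAvg (hprod ▸ (hH i j).1) hκc)
    (fun i j => hasWeakDeriv_timeAvg hfin (hG i).1 (hH i j).1 (hH i j).2 hκ)
    (φ := fun n => timeAvg T κ (φ n)) (h := fun i => timeAvg T κ (q i))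
    (fun n => (hφ n).average_in_time hκc)
    ((TendstoL2.average_in_time (hprod ▸ hφt) hκc).congr_lim (by
      refine (timeAvg_finsetSum _ (fun i _ => hprod ▸ hGm i) hκc).trans ?_
      refine Eventually.of_forall fun x => Finset.sum_congr rfl fun i _ => ?_
      exact timeAvg_mul_left κ _ (fun x => N x i) x))
    (fun i => (TendstoL2.average_in_time (hprod ▸ hφ't i) hκc).congr fun n => hcong n i)
    hψ hψ' hψψ'
  rw [← green]
  refine integral_congr_ae ?_
  filter_upwards [timeAvg_finsetSum (μ := volume.restrict Ω) Finset.univ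
    (fun i _ => hprod ▸ (hH i i).1) hκc] with x hx
  rw [show timeAvg T κ (laplacianX Q u) x = _ from hx, Finset.mul_sum, Finset.sum_add_distrib]

end NeumannRegular

/-! ### Weighted identities and the Carleman weight -/

section WeightedIdentities

variable {d : ℕ} {Ω : Set (Space d)} {T : ℝ}

theorem integrable_time_weight_sq (hΩ : IsFiniteMeasure (volume.restrict Ω)) {f : SpaceTime d → ℝ}
    (h : MemLp f 2 (volume.restrict (parCylinder Ω T))) {θ : ℝ → ℝ} (hθ : Continuous θ) :
    Integrable (fun z => θ z.2 * f z ^ 2) (volume.restrict (parCylinder Ω T)) := by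
  simpa only [sq] using integrable_time_weight hΩ h h hθ

theorem memLp_time_mul (hΩ : IsFiniteMeasure (volume.restrict Ω)) {f : SpaceTime d → ℝ}
    (h : MemLp f 2 (volume.restrict (parCylinder Ω T))) {θ : ℝ → ℝ} (hθ : Continuous θ) :
    MemLp (fun z => θ z.2 * f z) 2 (volume.restrict (parCylinder Ω T)) := by
  rw [volume_restrict_parCylinder] at *
  exact memLp_time_weight_mul h hθ

theorem integrable_time_weight_sq_add (hΩ : IsFiniteMeasure (volume.restrict Ω))
    {f g : SpaceTime d → ℝ} (hf : MemLp f 2 (volume.restrict (parCylinder Ω T)))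
    (hg : MemLp g 2 (volume.restrict (parCylinder Ω T))) {θ q : ℝ → ℝ} (hθ : Continuous θ)
    (hq : Continuous q) :
    Integrable (fun z => θ z.2 * (f z + q z.2 * g z) ^ 2) (volume.restrict (parCylinder Ω T)) :=
  integrable_time_weight_sq hΩ (hf.add (memLp_time_mul hΩ hg hq)) hθ

theorem integrable_time_weight_sum_sq (hΩ : IsFiniteMeasure (volume.restrict Ω))
    {g : Fin d → SpaceTime d → ℝ} (hg : ∀ i, MemLp (g i) 2 (volume.restrict (parCylinder Ω T)))
    {θ : ℝ → ℝ} (hθ : Continuous θ) :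
    Integrable (fun z => θ z.2 * ∑ i, g i z ^ 2) (volume.restrict (parCylinder Ω T)) := by
  simp only [Finset.mul_sum]
  exact integrable_finsetSum _ fun i _ => integrable_time_weight_sq hΩ (hg i) hθ

theorem integral_time_weight_sum_sq (hΩ : IsFiniteMeasure (volume.restrict Ω))
    {g : Fin d → SpaceTime d → ℝ} (hg : ∀ i, MemLp (g i) 2 (volume.restrict (parCylinder Ω T)))
    {θ : ℝ → ℝ} (hθ : Continuous θ) :
    ∫ z in parCylinder Ω T, θ z.2 * ∑ i, g i z ^ 2 =
      ∑ i, ∫ z in parCylinder Ω T, θ z.2 * g i z ^ 2 := by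
  simp only [Finset.mul_sum]
  exact integral_finsetSum _ fun i _ => integrable_time_weight_sq hΩ (hg i) hθ

variable {u ut L : SpaceTime d → ℝ} {g : Fin d → SpaceTime d → ℝ} {u0 uT : Space d → ℝ}
  {g0 gT : Fin d → Space d → ℝ}

/-- The weighted norm of `∂ₜu + Δu`, written as a sum of squares and boundary terms. -/
theorem HasEnergyIdentities.integral_backward_sq (hΩ : IsFiniteMeasure (volume.restrict Ω))
    (hr : IsNeumannRegular Ω T u ut L g) (h : HasEnergyIdentities Ω T u ut L g u0 uT g0 gT)
    {θ θ' q q' : ℝ → ℝ} (hθ : ∀ t, HasDerivAt θ (θ' t) t) (hθ' : Continuous θ')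
    (hq : ∀ t, HasDerivAt q (q' t) t) (hq' : Continuous q') :
    ∫ z in parCylinder Ω T, θ z.2 * (ut z + L z) ^ 2 =
      (∫ z in parCylinder Ω T, θ z.2 * (ut z + q z.2 * u z) ^ 2) +
      (∫ z in parCylinder Ω T, θ z.2 * L z ^ 2) +
      (∫ z in parCylinder Ω T, θ' z.2 * ∑ i, g i z ^ 2) +
      (∫ z in parCylinder Ω T, (q' z.2 * θ z.2 + q z.2 * θ' z.2 - q z.2 ^ 2 * θ z.2) * u z ^ 2) -
      (θ T * ((∑ i, ∫ x in Ω, gT i x ^ 2) + q T * ∫ x in Ω, uT x ^ 2) -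
        θ 0 * ((∑ i, ∫ x in Ω, g0 i x ^ 2) + q 0 * ∫ x in Ω, u0 x ^ 2)) := by
  have hθc : Continuous θ := continuous_iff_continuousAt.2 fun t => (hθ t).continuousAt
  have hqc : Continuous q := continuous_iff_continuousAt.2 fun t => (hq t).continuousAt
  have hqθ : ∀ t, HasDerivAt (fun t => q t * θ t) (q' t * θ t + q t * θ' t) t := fun t =>
    (hq t).mul (hθ t)
  have e1 := h.integral_sq _ _ hqθ (by fun_prop)
  have e2 := h.integral_grad_sq θ θ' hθ hθ'
  rw [← integral_time_weight_sum_sq hΩ hr.memLp_grad hθ'] at e2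
  have i1 := integrable_time_weight_sq_add hΩ hr.memLp_dt hr.memLp hθc hqc
  have i2 := integrable_time_weight_sq hΩ hr.memLp_lap hθc
  have i3 := integrable_time_weight hΩ hr.memLp_dt hr.memLp_lap hθc
  have i4 := integrable_time_weight hΩ hr.memLp hr.memLp_dt
    (θ := fun t => q t * θ t) (by fun_prop)
  have i5 := integrable_time_weight_sq hΩ hr.memLp
    (θ := fun t => q t ^ 2 * θ t) (by fun_prop)
  have i6 := integrable_time_weight_sq hΩ hr.memLp
    (θ := fun t => q' t * θ t + q t * θ' t) (by fun_prop)
  have e3 : ∫ z in parCylinder Ω T, θ z.2 * (ut z + L z) ^ 2 =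
      (∫ z in parCylinder Ω T, θ z.2 * (ut z + q z.2 * u z) ^ 2) +
      (∫ z in parCylinder Ω T, θ z.2 * L z ^ 2) +
      2 * (∫ z in parCylinder Ω T, θ z.2 * (ut z * L z)) -
      2 * (∫ z in parCylinder Ω T, (q z.2 * θ z.2) * (u z * ut z)) -
      ∫ z in parCylinder Ω T, (q z.2 ^ 2 * θ z.2) * u z ^ 2 := by
    have e : ∀ z : SpaceTime d, θ z.2 * (ut z + L z) ^ 2 =
        θ z.2 * (ut z + q z.2 * u z) ^ 2 + θ z.2 * L z ^ 2 + 2 * (θ z.2 * (ut z * L z)) -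
        2 * ((q z.2 * θ z.2) * (u z * ut z)) - (q z.2 ^ 2 * θ z.2) * u z ^ 2 := fun z => by ring
    simp_rw [e]
    rw [integral_sub, integral_sub, integral_add, integral_add i1 i2, integral_const_mul,
      integral_const_mul]
    exacts [i1.add i2, i3.const_mul 2, (i1.add i2).add (i3.const_mul 2), i4.const_mul 2,
      ((i1.add i2).add (i3.const_mul 2)).sub (i4.const_mul 2), i5]
  have e4 : ∫ z in parCylinder Ω T,
      (q' z.2 * θ z.2 + q z.2 * θ' z.2 - q z.2 ^ 2 * θ z.2) * u z ^ 2 =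
      (∫ z in parCylinder Ω T, (q' z.2 * θ z.2 + q z.2 * θ' z.2) * u z ^ 2) -
      ∫ z in parCylinder Ω T, (q z.2 ^ 2 * θ z.2) * u z ^ 2 := by
    rw [← integral_sub i6 i5]
    congr 1; ext z; ring
  rw [e3, e4]
  linarith

/-- The weighted norm of `∂ₜu - Δu`, written as a sum of squares and boundary terms. -/
theorem HasEnergyIdentities.integral_forward_sq (hΩ : IsFiniteMeasure (volume.restrict Ω))
    (hr : IsNeumannRegular Ω T u ut L g) (h : HasEnergyIdentities Ω T u ut L g u0 uT g0 gT)
    {θ q q' : ℝ → ℝ} (hθ : ∀ t, HasDerivAt θ (2 * (q t * θ t)) t)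
    (hq : ∀ t, HasDerivAt q (q' t) t) (hq' : Continuous q') :
    ∫ z in parCylinder Ω T, θ z.2 * (ut z - L z) ^ 2 =
      (∫ z in parCylinder Ω T, θ z.2 * (ut z + q z.2 * u z) ^ 2) +
      (∫ z in parCylinder Ω T, θ z.2 * (L z + q z.2 * u z) ^ 2) +
      (∫ z in parCylinder Ω T, (q' z.2 * θ z.2) * u z ^ 2) +
      (θ T * ((∑ i, ∫ x in Ω, gT i x ^ 2) - q T * ∫ x in Ω, uT x ^ 2) -
        θ 0 * ((∑ i, ∫ x in Ω, g0 i x ^ 2) - q 0 * ∫ x in Ω, u0 x ^ 2)) := by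
  have hθc : Continuous θ := continuous_iff_continuousAt.2 fun t => (hθ t).continuousAt
  have hqc : Continuous q := continuous_iff_continuousAt.2 fun t => (hq t).continuousAt
  have hqθ : ∀ t, HasDerivAt (fun t => q t * θ t) (q' t * θ t + 2 * (q t ^ 2 * θ t)) t := fun t =>
    ((hq t).mul (hθ t)).congr_deriv (by ring)
  have e1 := h.integral_sq _ _ hqθ (by fun_prop)
  have e2 := h.integral_grad_sq θ _ hθ (by fun_prop)
  have e0 := h.integral_green (fun t => q t * θ t) (by fun_prop)
  rw [← integral_time_weight_sum_sq hΩ hr.memLp_grad (θ := fun t => q t * θ t) (by fun_prop)] at e0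
  rw [← integral_time_weight_sum_sq hΩ hr.memLp_grad (θ := fun t => 2 * (q t * θ t))
    (by fun_prop)] at e2
  simp only [mul_assoc (2 : ℝ), integral_const_mul] at e2
  have i1 := integrable_time_weight_sq_add hΩ hr.memLp_dt hr.memLp hθc hqc
  have i2 := integrable_time_weight_sq_add hΩ hr.memLp_lap hr.memLp hθc hqc
  have i3 := integrable_time_weight hΩ hr.memLp_dt hr.memLp_lap hθc
  have i4 := integrable_time_weight hΩ hr.memLp hr.memLp_dt
    (θ := fun t => q t * θ t) (by fun_prop)
  have i4' := integrable_time_weight hΩ hr.memLp hr.memLp_lap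
    (θ := fun t => q t * θ t) (by fun_prop)
  have i5 := integrable_time_weight_sq hΩ hr.memLp
    (θ := fun t => q t ^ 2 * θ t) (by fun_prop)
  have i6 := integrable_time_weight_sq hΩ hr.memLp
    (θ := fun t => q' t * θ t) (by fun_prop)
  have e3 : ∫ z in parCylinder Ω T, θ z.2 * (ut z - L z) ^ 2 =
      (∫ z in parCylinder Ω T, θ z.2 * (ut z + q z.2 * u z) ^ 2) +
      (∫ z in parCylinder Ω T, θ z.2 * (L z + q z.2 * u z) ^ 2) -
      2 * (∫ z in parCylinder Ω T, θ z.2 * (ut z * L z)) -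
      2 * (∫ z in parCylinder Ω T, (q z.2 * θ z.2) * (u z * ut z)) -
      2 * (∫ z in parCylinder Ω T, (q z.2 * θ z.2) * (u z * L z)) -
      2 * ∫ z in parCylinder Ω T, (q z.2 ^ 2 * θ z.2) * u z ^ 2 := by
    have e : ∀ z : SpaceTime d, θ z.2 * (ut z - L z) ^ 2 =
        θ z.2 * (ut z + q z.2 * u z) ^ 2 + θ z.2 * (L z + q z.2 * u z) ^ 2 -
        2 * (θ z.2 * (ut z * L z)) - 2 * ((q z.2 * θ z.2) * (u z * ut z)) -
        2 * ((q z.2 * θ z.2) * (u z * L z)) - 2 * ((q z.2 ^ 2 * θ z.2) * u z ^ 2) :=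
      fun z => by ring
    simp_rw [e]
    have j3 := (i1.add i2).sub (i3.const_mul 2)
    have j4 := j3.sub (i4.const_mul 2)
    rw [integral_sub, integral_sub, integral_sub, integral_sub, integral_add i1 i2,
      integral_const_mul, integral_const_mul, integral_const_mul, integral_const_mul]
    exacts [i1.add i2, i3.const_mul 2, j3, i4.const_mul 2, j4, i4'.const_mul 2,
      j4.sub (i4'.const_mul 2), i5.const_mul 2]
  have e4 : ∫ z in parCylinder Ω T, (q' z.2 * θ z.2 + 2 * (q z.2 ^ 2 * θ z.2)) * u z ^ 2 =
      (∫ z in parCylinder Ω T, (q' z.2 * θ z.2) * u z ^ 2) +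
      2 * ∫ z in parCylinder Ω T, (q z.2 ^ 2 * θ z.2) * u z ^ 2 := by
    rw [← integral_const_mul, ← integral_add i6 (i5.const_mul 2)]
    congr 1; ext z; ring
  rw [e4] at e1
  rw [e3]
  linarith

end WeightedIdentities

section CarlemanWeight

/-- The exponent `s φ(t) = s e^{λ t}` of the Carleman weight. -/
noncomputable def carlemanPhase (s lam t : ℝ) : ℝ := s * weight lam t

/-- The Carleman weight `e^{2 s φ(t)}`. -/
noncomputable def carlemanWeight (s lam t : ℝ) : ℝ := Real.exp (2 * s * weight lam t)

variable {s lam : ℝ}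

theorem hasDerivAt_carlemanPhase (s lam t : ℝ) :
    HasDerivAt (carlemanPhase s lam) (lam * carlemanPhase s lam t) t := by
  have h := (((hasDerivAt_id t).const_mul lam).exp).const_mul s
  refine h.congr_deriv ?_
  simp [carlemanPhase, weight]; ring

theorem hasDerivAt_carlemanWeight (s lam t : ℝ) :
    HasDerivAt (carlemanWeight s lam)
      (2 * (lam * carlemanPhase s lam t * carlemanWeight s lam t)) t := by
  have h := ((hasDerivAt_carlemanPhase s lam t).const_mul 2).exp
  have he : (fun t => Real.exp (2 * carlemanPhase s lam t)) = carlemanWeight s lam := by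
    ext t; simp only [carlemanPhase, carlemanWeight, mul_assoc]
  rw [he] at h
  refine h.congr_deriv ?_
  rw [← he]; ring

@[fun_prop]
theorem continuous_carlemanPhase (s lam : ℝ) : Continuous (carlemanPhase s lam) :=
  continuous_iff_continuousAt.2 fun t => (hasDerivAt_carlemanPhase s lam t).continuousAt

@[fun_prop]
theorem continuous_carlemanWeight (s lam : ℝ) : Continuous (carlemanWeight s lam) :=
  continuous_iff_continuousAt.2 fun t => (hasDerivAt_carlemanWeight s lam t).continuousAt

theorem carlemanWeight_pos (s lam t : ℝ) : 0 < carlemanWeight s lam t := Real.exp_pos _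

theorem one_le_weight (hlam : 0 ≤ lam) {t : ℝ} (ht : 0 ≤ t) : 1 ≤ weight lam t :=
  Real.one_le_exp (mul_nonneg hlam ht)

theorem one_le_carlemanPhase (hs : 1 ≤ s) (hlam : 0 ≤ lam) {t : ℝ} (ht : 0 ≤ t) :
    1 ≤ carlemanPhase s lam t := one_le_mul_of_one_le_of_one_le hs (one_le_weight hlam ht)

theorem carlemanPhase_zero : carlemanPhase s lam 0 = s := by simp [carlemanPhase, weight]

theorem carlemanWeight_zero : carlemanWeight s lam 0 = Real.exp (2 * s) := by
  simp [carlemanWeight, weight]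

end CarlemanWeight

/-! ### Carleman estimates -/

section CarlemanEstimates

variable {d : ℕ} {Ω : Set (Space d)} {T : ℝ} {u ut L : SpaceTime d → ℝ}
  {g : Fin d → SpaceTime d → ℝ} {u0 uT : Space d → ℝ} {g0 gT : Fin d → Space d → ℝ} {s lam : ℝ}

theorem setIntegral_nonneg_parCylinder (hΩo : IsOpen Ω) {f : SpaceTime d → ℝ}
    (hf : ∀ z ∈ parCylinder Ω T, 0 ≤ f z) : 0 ≤ ∫ z in parCylinder Ω T, f z :=
  setIntegral_nonneg (isOpen_parCylinder hΩo).measurableSet hf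

theorem carlemanPhase_pos (hs : 1 ≤ s) (lam t : ℝ) : 0 < carlemanPhase s lam t :=
  mul_pos (by linarith) (Real.exp_pos _)

theorem continuous_carlemanWeight_div_phase (hs : 1 ≤ s) (lam : ℝ) :
    Continuous fun t => 1 / carlemanPhase s lam t * carlemanWeight s lam t :=
  (continuous_const.div (continuous_carlemanPhase s lam)
    fun t => (carlemanPhase_pos hs lam t).ne').mul (continuous_carlemanWeight s lam)

/-- Carleman estimate for `∂ₜu + Δu`, with all derivatives of `u` on the left and boundary terms at
`t = T` on the right. -/
theorem HasEnergyIdentities.carleman_backward (hΩo : IsOpen Ω)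
    (hΩ : IsFiniteMeasure (volume.restrict Ω)) (hr : IsNeumannRegular Ω T u ut L g)
    (h : HasEnergyIdentities Ω T u ut L g u0 uT g0 gT) (hs : 1 ≤ s) (hlam : 1 ≤ lam) :
    (∫ z in parCylinder Ω T, carlemanWeight s lam z.2 * ut z ^ 2) +
      (∫ z in parCylinder Ω T, carlemanWeight s lam z.2 * L z ^ 2) +
      lam * (∫ z in parCylinder Ω T,
        carlemanPhase s lam z.2 * carlemanWeight s lam z.2 * ∑ i, g i z ^ 2) +
      lam ^ 2 * (∫ z in parCylinder Ω T,
        carlemanPhase s lam z.2 ^ 2 * carlemanWeight s lam z.2 * u z ^ 2) ≤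
    3 * ((∫ z in parCylinder Ω T, carlemanWeight s lam z.2 * (ut z + L z) ^ 2) +
      carlemanWeight s lam T * ((∑ i, ∫ x in Ω, gT i x ^ 2) +
        lam * carlemanPhase s lam T * ∫ x in Ω, uT x ^ 2)) := by
  have hPc := continuous_carlemanPhase s lam
  have hEc := continuous_carlemanWeight s lam
  have hP := carlemanPhase_pos hs lam
  have hE := carlemanWeight_pos s lam
  have hP0 : carlemanPhase s lam 0 = s := carlemanPhase_zero
  have hdP := hasDerivAt_carlemanPhase s lam
  have hdE := hasDerivAt_carlemanWeight s lam
  set P := carlemanPhase s lam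
  set E := carlemanWeight s lam
  have hdq : ∀ t, HasDerivAt (fun t => lam * P t) (lam * (lam * P t)) t := fun t =>
    (hdP t).const_mul lam
  -- with the phase `q = λ s φ` the zeroth order coefficient `q' θ + q θ' - q² θ` is positive
  have key := h.integral_backward_sq hΩ hr hdE (by fun_prop) hdq (by fun_prop)
  have i1 := integrable_time_weight_sq hΩ hr.memLp (θ := fun t => P t * E t) (by fun_prop)
  have i2 := integrable_time_weight_sq hΩ hr.memLp (θ := fun t => P t ^ 2 * E t) (by fun_prop)
  have iX := integrable_time_weight_sq_add hΩ hr.memLp_dt hr.memLp hEc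
    (q := fun t => lam * P t) (by fun_prop)
  have r1 : ∫ z in parCylinder Ω T, 2 * (lam * P z.2 * E z.2) * ∑ i, g i z ^ 2 =
      2 * (lam * ∫ z in parCylinder Ω T, P z.2 * E z.2 * ∑ i, g i z ^ 2) := by
    rw [← integral_const_mul, ← integral_const_mul]
    congr 1; ext z; ring
  have r2 : ∫ z in parCylinder Ω T, (lam * (lam * P z.2) * E z.2 +
      lam * P z.2 * (2 * (lam * P z.2 * E z.2)) - (lam * P z.2) ^ 2 * E z.2) * u z ^ 2 =
      lam ^ 2 * (∫ z in parCylinder Ω T, P z.2 * E z.2 * u z ^ 2) +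
      lam ^ 2 * ∫ z in parCylinder Ω T, P z.2 ^ 2 * E z.2 * u z ^ 2 := by
    rw [← integral_const_mul, ← integral_const_mul,
      ← integral_add (i1.const_mul _) (i2.const_mul _)]
    congr 1; ext z; ring
  -- `∂ₜu` is recovered from the square of `∂ₜu + q u`
  have hA : ∫ z in parCylinder Ω T, E z.2 * ut z ^ 2 ≤
      2 * (∫ z in parCylinder Ω T, E z.2 * (ut z + lam * P z.2 * u z) ^ 2) +
      2 * (lam ^ 2 * ∫ z in parCylinder Ω T, P z.2 ^ 2 * E z.2 * u z ^ 2) := by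
    rw [← integral_const_mul, ← integral_const_mul, ← integral_const_mul,
      ← integral_add (iX.const_mul 2) ((i2.const_mul _).const_mul 2)]
    refine integral_mono (integrable_time_weight_sq hΩ hr.memLp_dt hEc)
      ((iX.const_mul 2).add ((i2.const_mul _).const_mul 2)) fun z => ?_
    have := mul_nonneg (hE z.2).le (sq_nonneg (ut z + 2 * (lam * P z.2 * u z)))
    linarith
  rw [r1, r2, hP0] at key
  have n1 := setIntegral_nonneg_parCylinder (T := T) hΩo (f := fun z => E z.2 * L z ^ 2)
    fun z _ => mul_nonneg (hE _).le (sq_nonneg _)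
  have n2 := setIntegral_nonneg_parCylinder (T := T) hΩo
    (f := fun z => P z.2 * E z.2 * ∑ i, g i z ^ 2)
    fun z _ => mul_nonneg (mul_pos (hP _) (hE _)).le (Finset.sum_nonneg fun i _ => sq_nonneg _)
  have n3 := setIntegral_nonneg_parCylinder (T := T) hΩo (f := fun z => P z.2 * E z.2 * u z ^ 2)
    fun z _ => mul_nonneg (mul_pos (hP _) (hE _)).le (sq_nonneg _)
  have n4 := setIntegral_nonneg_parCylinder (T := T) hΩo
    (f := fun z => E z.2 * (ut z + lam * P z.2 * u z) ^ 2)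
    fun z _ => mul_nonneg (hE _).le (sq_nonneg _)
  have n5 : 0 ≤ E 0 * ((∑ i, ∫ x in Ω, g0 i x ^ 2) + lam * s * ∫ x in Ω, u0 x ^ 2) :=
    mul_nonneg (hE 0).le (add_nonneg
      (Finset.sum_nonneg fun i _ => integral_nonneg fun x => sq_nonneg _)
      (mul_nonneg (by positivity) (integral_nonneg fun x => sq_nonneg _)))
  have n2' := mul_nonneg (zero_le_one.trans hlam) n2
  have n3' := mul_nonneg (sq_nonneg lam) n3
  linarith

/-- The initial values of `u` are controlled by the equation `∂ₜu + Δu = f`: the weight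
`θ = s φ (1 - t/T) e^{2sφ}` of the energy identity vanishes at `t = T`. -/
theorem HasEnergyIdentities.carleman_backward_initial (hΩo : IsOpen Ω) (hT : 0 < T)
    (hΩ : IsFiniteMeasure (volume.restrict Ω)) (hr : IsNeumannRegular Ω T u ut L g)
    (h : HasEnergyIdentities Ω T u ut L g u0 uT g0 gT) (hs : 1 ≤ s) (hlam : 1 ≤ lam) :
    s * Real.exp (2 * s) * ((∑ i, ∫ x in Ω, g0 i x ^ 2) + lam * s * ∫ x in Ω, u0 x ^ 2) ≤
      (∫ z in parCylinder Ω T,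
        carlemanPhase s lam z.2 * carlemanWeight s lam z.2 * (ut z + L z) ^ 2) +
      1 / T * ((∫ z in parCylinder Ω T,
        carlemanPhase s lam z.2 * carlemanWeight s lam z.2 * ∑ i, g i z ^ 2) +
      lam * (∫ z in parCylinder Ω T,
        carlemanPhase s lam z.2 ^ 2 * carlemanWeight s lam z.2 * u z ^ 2)) := by
  have hPc := continuous_carlemanPhase s lam
  have hEc := continuous_carlemanWeight s lam
  have hP := carlemanPhase_pos hs lam
  have hE := carlemanWeight_pos s lam
  have hP0 : carlemanPhase s lam 0 = s := carlemanPhase_zero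
  have hE0 : carlemanWeight s lam 0 = Real.exp (2 * s) := carlemanWeight_zero
  have hdP := hasDerivAt_carlemanPhase s lam
  have hdE := hasDerivAt_carlemanWeight s lam
  set P := carlemanPhase s lam
  set E := carlemanWeight s lam
  have hlam0 : 0 ≤ lam := zero_le_one.trans hlam
  have hdq : ∀ t, HasDerivAt (fun t => lam * P t) (lam * (lam * P t)) t := fun t =>
    (hdP t).const_mul lam
  have hdθ : ∀ t, HasDerivAt (fun t => P t * E t * (1 - t / T))
      ((lam + 2 * (lam * P t)) * (P t * E t * (1 - t / T)) - P t * E t / T) t := fun t =>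
    (((hdP t).mul (hdE t)).mul (hasDerivAt_decreasing_ramp T t)).congr_deriv (by
      simp only [Pi.mul_apply]; ring)
  have key := h.integral_backward_sq hΩ hr hdθ (by fun_prop) hdq (by fun_prop)
  simp only [div_self hT.ne', sub_self, mul_zero, zero_mul, zero_div, sub_zero, mul_one, hP0, hE0,
    zero_sub, sub_neg_eq_add] at key
  have hQ := (isOpen_parCylinder (T := T) hΩo).measurableSet
  have hramp : ∀ z ∈ parCylinder Ω T, 0 ≤ 1 - z.2 / T ∧ 1 - z.2 / T ≤ 1 := fun z hz => by
    have h1 : z.2 / T ≤ 1 := (div_le_one hT).2 hz.2.2.le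
    have h2 : 0 ≤ z.2 / T := div_nonneg hz.2.1.le hT.le
    constructor <;> linarith
  have hθ0 : ∀ z ∈ parCylinder Ω T, 0 ≤ P z.2 * E z.2 * (1 - z.2 / T) := fun z hz =>
    mul_nonneg (mul_pos (hP _) (hE _)).le (hramp z hz).1
  have n1 := setIntegral_nonneg_parCylinder (T := T) hΩo
    (f := fun z => P z.2 * E z.2 * (1 - z.2 / T) * (ut z + lam * P z.2 * u z) ^ 2)
    fun z hz => mul_nonneg (hθ0 z hz) (sq_nonneg _)
  have n2 := setIntegral_nonneg_parCylinder (T := T) hΩo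
    (f := fun z => P z.2 * E z.2 * (1 - z.2 / T) * L z ^ 2)
    fun z hz => mul_nonneg (hθ0 z hz) (sq_nonneg _)
  have c1 : ∫ z in parCylinder Ω T, P z.2 * E z.2 * (1 - z.2 / T) * (ut z + L z) ^ 2 ≤
      ∫ z in parCylinder Ω T, P z.2 * E z.2 * (ut z + L z) ^ 2 := by
    refine setIntegral_mono_on
      (integrable_time_weight_sq hΩ (hr.memLp_dt.add hr.memLp_lap)
        (θ := fun t => P t * E t * (1 - t / T)) (by fun_prop))
      (integrable_time_weight_sq hΩ (hr.memLp_dt.add hr.memLp_lap)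
        (θ := fun t => P t * E t) (by fun_prop)) hQ fun z hz => ?_
    exact mul_le_mul_of_nonneg_right
      (mul_le_of_le_one_right (mul_pos (hP _) (hE _)).le (hramp z hz).2) (sq_nonneg _)
  have c2 : -(1 / T * ∫ z in parCylinder Ω T, P z.2 * E z.2 * ∑ i, g i z ^ 2) ≤
      ∫ z in parCylinder Ω T, ((lam + 2 * (lam * P z.2)) * (P z.2 * E z.2 * (1 - z.2 / T)) -
        P z.2 * E z.2 / T) * ∑ i, g i z ^ 2 := by
    rw [← integral_const_mul, ← integral_neg]
    refine setIntegral_mono_on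
      ((integrable_time_weight_sum_sq hΩ hr.memLp_grad
        (θ := fun t => P t * E t) (by fun_prop)).const_mul _).neg
      (integrable_time_weight_sum_sq hΩ hr.memLp_grad (θ := fun t => (lam + 2 * (lam * P t)) *
        (P t * E t * (1 - t / T)) - P t * E t / T) (by fun_prop)) hQ fun z hz => ?_
    have m1 := hP z.2
    have m2 := mul_nonneg (mul_nonneg (by positivity : 0 ≤ lam + 2 * (lam * P z.2)) (hθ0 z hz))
      (Finset.sum_nonneg fun i (_ : i ∈ Finset.univ) => sq_nonneg (g i z))
    calc -(1 / T * (P z.2 * E z.2 * ∑ i, g i z ^ 2))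
        ≤ -(1 / T * (P z.2 * E z.2 * ∑ i, g i z ^ 2)) +
          (lam + 2 * (lam * P z.2)) * (P z.2 * E z.2 * (1 - z.2 / T)) * ∑ i, g i z ^ 2 := by
          linarith
      _ = _ := by ring
  have c3 : -(1 / T * (lam * ∫ z in parCylinder Ω T, P z.2 ^ 2 * E z.2 * u z ^ 2)) ≤
      ∫ z in parCylinder Ω T, (lam * (lam * P z.2) * (P z.2 * E z.2 * (1 - z.2 / T)) +
        lam * P z.2 * ((lam + 2 * (lam * P z.2)) * (P z.2 * E z.2 * (1 - z.2 / T)) -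
        P z.2 * E z.2 / T) - (lam * P z.2) ^ 2 * (P z.2 * E z.2 * (1 - z.2 / T))) * u z ^ 2 := by
    rw [← integral_const_mul, ← integral_const_mul, ← integral_neg]
    refine setIntegral_mono_on
      (((integrable_time_weight_sq hΩ hr.memLp
        (θ := fun t => P t ^ 2 * E t) (by fun_prop)).const_mul _).const_mul _).neg
      (integrable_time_weight_sq hΩ hr.memLp (θ := fun t =>
        lam * (lam * P t) * (P t * E t * (1 - t / T)) +
        lam * P t * ((lam + 2 * (lam * P t)) * (P t * E t * (1 - t / T)) -
        P t * E t / T) - (lam * P t) ^ 2 * (P t * E t * (1 - t / T))) (by fun_prop)) hQ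
      fun z hz => ?_
    have m1 := hP z.2
    have m2 := mul_nonneg (mul_nonneg
      (by positivity : 0 ≤ 2 * lam ^ 2 * P z.2 + lam ^ 2 * P z.2 ^ 2) (hθ0 z hz)) (sq_nonneg (u z))
    calc -(1 / T * (lam * (P z.2 ^ 2 * E z.2 * u z ^ 2)))
        ≤ -(1 / T * (lam * (P z.2 ^ 2 * E z.2 * u z ^ 2))) +
          (2 * lam ^ 2 * P z.2 + lam ^ 2 * P z.2 ^ 2) *
            (P z.2 * E z.2 * (1 - z.2 / T)) * u z ^ 2 := by linarith
      _ = _ := by ring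
  rw [mul_add (1 / T)]
  linarith

/-- Carleman estimate for `∂ₜu - Δu`.  Compared with the backward equation a factor `sφ` is lost,
because the square of `Δu + λsφ u` replaces that of `Δu`. -/
theorem HasEnergyIdentities.carleman_forward (hΩo : IsOpen Ω)
    (hΩ : IsFiniteMeasure (volume.restrict Ω)) (hr : IsNeumannRegular Ω T u ut L g)
    (h : HasEnergyIdentities Ω T u ut L g u0 uT g0 gT) (hs : 1 ≤ s) (hlam : 1 ≤ lam) :
    (∫ z in parCylinder Ω T,
        1 / carlemanPhase s lam z.2 * carlemanWeight s lam z.2 * ut z ^ 2) +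
      (∫ z in parCylinder Ω T,
        1 / carlemanPhase s lam z.2 * carlemanWeight s lam z.2 * L z ^ 2) +
      lam * (∫ z in parCylinder Ω T, carlemanWeight s lam z.2 * ∑ i, g i z ^ 2) +
      lam ^ 2 * (∫ z in parCylinder Ω T,
        carlemanPhase s lam z.2 * carlemanWeight s lam z.2 * u z ^ 2) +
      (Real.exp (2 * s) * (lam * s * ∫ x in Ω, u0 x ^ 2) +
        carlemanWeight s lam T * ∑ i, ∫ x in Ω, gT i x ^ 2) ≤
    7 * ((∫ z in parCylinder Ω T, carlemanWeight s lam z.2 * (ut z - L z) ^ 2) +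
      (Real.exp (2 * s) * (∑ i, ∫ x in Ω, g0 i x ^ 2) +
        carlemanWeight s lam T * (lam * carlemanPhase s lam T * ∫ x in Ω, uT x ^ 2))) := by
  have hPc := continuous_carlemanPhase s lam
  have hEc := continuous_carlemanWeight s lam
  have hPE := continuous_carlemanWeight_div_phase hs lam
  have hP := carlemanPhase_pos hs lam
  have hP1 : ∀ z ∈ parCylinder Ω T, 1 ≤ carlemanPhase s lam z.2 := fun z hz =>
    one_le_carlemanPhase hs (zero_le_one.trans hlam) hz.2.1.le
  have hE := carlemanWeight_pos s lam
  have hP0 : carlemanPhase s lam 0 = s := carlemanPhase_zero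
  have hE0 : carlemanWeight s lam 0 = Real.exp (2 * s) := carlemanWeight_zero
  have hdP := hasDerivAt_carlemanPhase s lam
  have hdE := hasDerivAt_carlemanWeight s lam
  set P := carlemanPhase s lam
  set E := carlemanWeight s lam
  have hQ := (isOpen_parCylinder (T := T) hΩo).measurableSet
  have hdq : ∀ t, HasDerivAt (fun t => lam * P t) (lam * (lam * P t)) t := fun t =>
    (hdP t).const_mul lam
  have key := h.integral_forward_sq hΩ hr hdE hdq (by fun_prop)
  have i1 := integrable_time_weight_sq hΩ hr.memLp (θ := fun t => P t * E t) (by fun_prop)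
  have iX := integrable_time_weight_sq_add hΩ hr.memLp_dt hr.memLp hEc
    (q := fun t => lam * P t) (by fun_prop)
  have iY := integrable_time_weight_sq_add hΩ hr.memLp_lap hr.memLp hEc
    (q := fun t => lam * P t) (by fun_prop)
  have r1 : ∫ z in parCylinder Ω T, lam * (lam * P z.2) * E z.2 * u z ^ 2 =
      lam ^ 2 * ∫ z in parCylinder Ω T, P z.2 * E z.2 * u z ^ 2 := by
    rw [← integral_const_mul]
    congr 1; ext z; ring
  rw [r1, hP0, hE0] at key
  -- `∂ₜu` and `Δu` are recovered from `∂ₜu + q u` and `Δu + q u` at the price of a factor `1/(sφ)`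
  have hA : ∀ f : SpaceTime d → ℝ, MemLp f 2 (volume.restrict (parCylinder Ω T)) →
      ∫ z in parCylinder Ω T, 1 / P z.2 * E z.2 * f z ^ 2 ≤
      2 * (∫ z in parCylinder Ω T, E z.2 * (f z + lam * P z.2 * u z) ^ 2) +
      2 * (lam ^ 2 * ∫ z in parCylinder Ω T, P z.2 * E z.2 * u z ^ 2) := by
    intro f hf
    have iF := integrable_time_weight_sq_add hΩ hf hr.memLp hEc
      (q := fun t => lam * P t) (by fun_prop)
    rw [← integral_const_mul, ← integral_const_mul, ← integral_const_mul,
      ← integral_add (iF.const_mul 2) ((i1.const_mul _).const_mul 2)]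
    refine setIntegral_mono_on (integrable_time_weight_sq hΩ hf hPE)
      ((iF.const_mul 2).add ((i1.const_mul _).const_mul 2)) hQ fun z hz => ?_
    have m0 := hP z.2
    have m1 : 1 / P z.2 ≤ 1 := (div_le_one m0).2 (hP1 z hz)
    have m2 : 1 / P z.2 * f z ^ 2 ≤ 2 * (1 / P z.2 * (f z + lam * P z.2 * u z) ^ 2) +
        2 * (lam ^ 2 * (P z.2 * u z ^ 2)) := by
      have m3 := mul_nonneg (one_div_pos.2 m0).le (sq_nonneg (f z + 2 * (lam * P z.2 * u z)))
      have m4 : 1 / P z.2 * (2 * (f z + lam * P z.2 * u z) ^ 2 + 2 * (lam * P z.2 * u z) ^ 2) =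
          2 * (1 / P z.2 * (f z + lam * P z.2 * u z) ^ 2) + 2 * (lam ^ 2 * (P z.2 * u z ^ 2)) := by
        field_simp
      rw [← m4]
      linarith
    have m5 := mul_le_mul_of_nonneg_right m1 (sq_nonneg (f z + lam * P z.2 * u z))
    have m6 := mul_le_mul_of_nonneg_left (m2.trans (by linarith :
      _ ≤ 2 * (f z + lam * P z.2 * u z) ^ 2 + 2 * (lam ^ 2 * (P z.2 * u z ^ 2)))) (hE z.2).le
    linarith
  -- the gradient is recovered from Green's formula `∫ E |∇u|² = -∫ E u Δu`
  have hG : lam * ∫ z in parCylinder Ω T, E z.2 * ∑ i, g i z ^ 2 ≤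
      1 / 2 * (∫ z in parCylinder Ω T, E z.2 * (L z + lam * P z.2 * u z) ^ 2) +
      3 / 2 * (lam ^ 2 * ∫ z in parCylinder Ω T, P z.2 * E z.2 * u z ^ 2) := by
    have iUL := integrable_time_weight hΩ hr.memLp hr.memLp_lap hEc
    rw [integral_time_weight_sum_sq hΩ hr.memLp_grad hEc,
      ← neg_eq_iff_eq_neg.2 (h.integral_green E hEc), ← integral_neg,
      ← integral_const_mul, ← integral_const_mul, ← integral_const_mul, ← integral_const_mul,
      ← integral_add (iY.const_mul _) ((i1.const_mul _).const_mul _)]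
    refine setIntegral_mono_on (iUL.neg.const_mul lam)
      ((iY.const_mul _).add ((i1.const_mul _).const_mul _)) hQ fun z hz => ?_
    have m1 := mul_nonneg (hE z.2).le (sq_nonneg (L z + lam * P z.2 * u z + lam * u z))
    have m2 := mul_nonneg (mul_nonneg (hE z.2).le (sq_nonneg (lam * u z)))
      (sub_nonneg.2 (hP1 z hz))
    linarith
  have hAt := hA ut hr.memLp_dt
  have hAL := hA L hr.memLp_lap
  have n1 := setIntegral_nonneg_parCylinder (T := T) hΩo
    (f := fun z => E z.2 * (ut z + lam * P z.2 * u z) ^ 2)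
    fun z _ => mul_nonneg (hE _).le (sq_nonneg _)
  have n2 := setIntegral_nonneg_parCylinder (T := T) hΩo
    (f := fun z => E z.2 * (L z + lam * P z.2 * u z) ^ 2)
    fun z _ => mul_nonneg (hE _).le (sq_nonneg _)
  have n3 := setIntegral_nonneg_parCylinder (T := T) hΩo (f := fun z => P z.2 * E z.2 * u z ^ 2)
    fun z _ => mul_nonneg (mul_pos (hP _) (hE _)).le (sq_nonneg _)
  have n3' := mul_nonneg (sq_nonneg lam) n3
  have n4 : 0 ≤ Real.exp (2 * s) * (lam * s * ∫ x in Ω, u0 x ^ 2) :=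
    mul_nonneg (Real.exp_pos _).le
      (mul_nonneg (by positivity) (integral_nonneg fun x => sq_nonneg _))
  have n5 : 0 ≤ E T * ∑ i, ∫ x in Ω, gT i x ^ 2 :=
    mul_nonneg (hE T).le (Finset.sum_nonneg fun i _ => integral_nonneg fun x => sq_nonneg _)
  linarith

end CarlemanEstimates

/-! ### Coupling and absorption of lower order terms -/

section Coupling

variable {d : ℕ} {Ω : Set (Space d)} {T : ℝ}

/-- A bound of the slices `f(·, t)` in `L²(Ω)` by the slices `v(·, t)` carries over to all norms
with a weight depending on time alone. -/
theorem integral_time_weight_sq_le_of_slices (hΩ : IsFiniteMeasure (volume.restrict Ω))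
    {f v : SpaceTime d → ℝ} (hf : AEStronglyMeasurable f (volume.restrict (parCylinder Ω T)))
    (hv : MemLp v 2 (volume.restrict (parCylinder Ω T))) {C : ℝ} (hC : 0 ≤ C)
    (h : ∀ᵐ t ∂(volume.restrict (Ioo 0 T)), eLpNorm (fun x => f (x, t)) 2 (volume.restrict Ω) ≤
      ENNReal.ofReal C * eLpNorm (fun x => v (x, t)) 2 (volume.restrict Ω)) :
    MemLp f 2 (volume.restrict (parCylinder Ω T)) ∧
    ∀ θ : ℝ → ℝ, Continuous θ → (∀ t, 0 ≤ θ t) →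
      ∫ z in parCylinder Ω T, θ z.2 * f z ^ 2 ≤
        C ^ 2 * ∫ z in parCylinder Ω T, θ z.2 * v z ^ 2 := by
  have hfm : MemLp f 2 (volume.restrict (parCylinder Ω T)) := by
    refine ⟨hf, ?_⟩
    have hv2 := ENNReal.pow_lt_top (n := 2) hv.2
    have h2 : eLpNorm f 2 (volume.restrict (parCylinder Ω T)) ^ 2 < ⊤ := by
      rw [volume_restrict_parCylinder] at hf hv hv2 ⊢
      rw [eLpNorm_two_sq, lintegral_prod_symm _ (hv.1.enorm.pow_const 2)] at hv2
      rw [eLpNorm_two_sq, lintegral_prod_symm _ (hf.enorm.pow_const 2)]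
      calc ∫⁻ t in Ioo 0 T, ∫⁻ x in Ω, ‖f (x, t)‖ₑ ^ 2
          ≤ ∫⁻ t in Ioo 0 T, ENNReal.ofReal C ^ 2 * ∫⁻ x in Ω, ‖v (x, t)‖ₑ ^ 2 := by
            refine lintegral_mono_ae ?_
            filter_upwards [h] with t ht
            rw [← eLpNorm_two_sq fun x => f (x, t), ← eLpNorm_two_sq fun x => v (x, t), ← mul_pow]
            gcongr
        _ = ENNReal.ofReal C ^ 2 * ∫⁻ t in Ioo 0 T, ∫⁻ x in Ω, ‖v (x, t)‖ₑ ^ 2 :=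
            lintegral_const_mul' _ _ (by finiteness)
        _ < ⊤ := ENNReal.mul_lt_top (by finiteness) hv2
    exact lt_of_not_ge fun h' => by simp [top_le_iff.1 h'] at h2
  refine ⟨hfm, fun θ hθ hθ0 => ?_⟩
  have i1 := integrable_time_weight_sq hΩ hfm hθ
  have i2 := integrable_time_weight_sq hΩ hv hθ
  have slice : ∀ {a : SpaceTime d → ℝ}, MemLp a 2 (volume.restrict (parCylinder Ω T)) →
      ∀ᵐ t ∂(volume.restrict (Ioo 0 T)), MemLp (fun x => a (x, t)) 2 (volume.restrict Ω) := by
    intro a ha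
    have hsq := ha.integrable_sq
    rw [volume_restrict_parCylinder] at ha hsq
    filter_upwards [ha.1.prod_swap.prodMk_left, hsq.prod_left_ae] with t h1 h2
    exact (memLp_two_iff_integrable_sq h1).2 h2
  have s1 := slice hfm
  have s2 := slice hv
  rw [← integral_const_mul]
  have i2' := i2.const_mul (C ^ 2)
  rw [volume_restrict_parCylinder] at i1 i2' ⊢
  rw [integral_prod_symm _ i1, integral_prod_symm _ i2']
  refine integral_mono_ae i1.integral_prod_right i2'.integral_prod_right ?_
  filter_upwards [h, s1, s2] with t ht h1 h2
  have h3 : √(∫ x in Ω, f (x, t) ^ 2) ≤ C * √(∫ x in Ω, v (x, t) ^ 2) := by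
    rw [← norm_toLp_eq_sqrt h1, ← norm_toLp_eq_sqrt h2, Lp.norm_toLp, Lp.norm_toLp,
      ← ENNReal.toReal_ofReal hC, ← ENNReal.toReal_mul]
    exact ENNReal.toReal_mono (ENNReal.mul_ne_top ENNReal.ofReal_ne_top h2.2.ne) ht
  have h4 := pow_le_pow_left₀ (Real.sqrt_nonneg _) h3 2
  rw [mul_pow, Real.sq_sqrt (integral_nonneg fun x => sq_nonneg _),
    Real.sq_sqrt (integral_nonneg fun x => sq_nonneg _)] at h4
  simp only [integral_const_mul]
  calc θ t * ∫ x in Ω, f (x, t) ^ 2 ≤ θ t * (C ^ 2 * ∫ x in Ω, v (x, t) ^ 2) :=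
        mul_le_mul_of_nonneg_left h4 (hθ0 t)
    _ = _ := by ring

/-- A pointwise bound implies the bound of almost all slices, so that slice bounds cover both
hypotheses on the coupling operator `S`. -/
theorem eLpNorm_slice_le_of_pointwise {f v : SpaceTime d → ℝ} {C : ℝ}
    (h : ∀ᵐ z ∂(volume.restrict (parCylinder Ω T)), |f z| ≤ C * |v z|) :
    ∀ᵐ t ∂(volume.restrict (Ioo 0 T)), eLpNorm (fun x => f (x, t)) 2 (volume.restrict Ω) ≤
      ENNReal.ofReal C * eLpNorm (fun x => v (x, t)) 2 (volume.restrict Ω) := by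
  rw [volume_restrict_parCylinder] at h
  have h' := (Measure.measurePreserving_swap (μ := volume.restrict (Ioo 0 T))
    (ν := volume.restrict Ω)).quasiMeasurePreserving.ae h
  filter_upwards [Measure.ae_ae_of_ae_prod h'] with t ht
  exact eLpNorm_le_mul_eLpNorm_of_ae_le_mul ht 2

/-- The algebra of the absorption: the lower order terms on the right are smaller than the left by
a factor `1/λ`, except for the term `ρ₀² a` that the estimate of `a` takes care of. -/
theorem absorb_lower_order {a b c F G BT Bv C K lam : ℝ} (hC : 0 < C) (hK : 0 ≤ K) (ha0 : 0 ≤ a)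
    (hb0 : 0 ≤ b) (hBT : 0 ≤ BT) (hBv : 0 ≤ Bv) (hF : 0 ≤ F) (hG : 0 ≤ G)
    (hlam : 2 * ((1 + K) * 12 + 56) * C ^ 2 ≤ lam)
    (hFab : lam * F ≤ 4 * C ^ 2 * (a + b)) (hGab : lam * G ≤ 8 * C ^ 2 * (a + b))
    (ha : a ≤ 3 * (F + BT)) (hb : b ≤ 7 * (G + Bv) + K * a) (hc : c ≤ F + a) :
    a + b + c ≤ 42 * (1 + K) * (BT + Bv) := by
  have hC2 : 0 < C ^ 2 := by positivity
  have hF1 : ((1 + K) * 12 + 56) * F ≤ 2 * (a + b) := by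
    refine le_of_mul_le_mul_left ?_ hC2
    linarith [mul_le_mul_of_nonneg_right hlam hF]
  have hG1 : ((1 + K) * 12 + 56) * G ≤ 4 * (a + b) := by
    refine le_of_mul_le_mul_left ?_ hC2
    linarith [mul_le_mul_of_nonneg_right hlam hG]
  have hK1 : 0 ≤ 1 + K := by linarith
  have h1 : a + b ≤ (1 + K) * (3 * F + 3 * BT) + 7 * G + 7 * Bv := by
    linarith [mul_le_mul_of_nonneg_left ha hK1]
  have h2 : a + b ≤ 6 * (1 + K) * BT + 14 * Bv := by
    have hm : 0 < (1 + K) * 12 + 56 := by positivity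
    refine le_of_mul_le_mul_left ?_ hm
    have e1 := mul_le_mul_of_nonneg_left h1 hm.le
    have e2 := mul_le_mul_of_nonneg_left hF1 (mul_nonneg zero_le_three hK1)
    linarith
  have h3 : F ≤ a + b := by nlinarith [mul_nonneg hK hF]
  nlinarith [mul_nonneg hK hBT, mul_nonneg hK hBv]

theorem integral_time_weight_mono (hΩo : IsOpen Ω) {F : SpaceTime d → ℝ} (hF : ∀ z, 0 ≤ F z)
    {θ η : ℝ → ℝ} (hθη : ∀ t ∈ Ioo 0 T, θ t ≤ η t)
    (hθ : Integrable (fun z => θ z.2 * F z) (volume.restrict (parCylinder Ω T)))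
    (hη : Integrable (fun z => η z.2 * F z) (volume.restrict (parCylinder Ω T))) :
    ∫ z in parCylinder Ω T, θ z.2 * F z ≤ ∫ z in parCylinder Ω T, η z.2 * F z :=
  setIntegral_mono_on hθ hη (isOpen_parCylinder hΩo).measurableSet fun z hz =>
    mul_le_mul_of_nonneg_right (hθη _ hz.2) (hF z)

variable {u ut L v vt Lv : SpaceTime d → ℝ} {g gv : Fin d → SpaceTime d → ℝ}
  {u0 uT v0 vT : Space d → ℝ} {g0 gT gv0 gvT : Fin d → Space d → ℝ} {s lam C ρ : ℝ}

/-- The Carleman estimates of the two equations, added up, absorb the lower order terms for large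
`λ`.  The coupling term `ρ Δu` of the second equation is controlled by the first estimate. -/
theorem coupled_carleman (hΩo : IsOpen Ω) (hT : 0 < T) (hΩ : IsFiniteMeasure (volume.restrict Ω))
    (hru : IsNeumannRegular Ω T u ut L g) (hu : HasEnergyIdentities Ω T u ut L g u0 uT g0 gT)
    (hrv : IsNeumannRegular Ω T v vt Lv gv)
    (hv : HasEnergyIdentities Ω T v vt Lv gv v0 vT gv0 gvT) (hC : 0 < C)
    (hs : 1 ≤ s) (hlam : 1 ≤ lam) (hlamT : 1 / T ≤ lam)
    (hlamC : 2 * ((1 + 14 * ρ ^ 2) * 12 + 56) * C ^ 2 ≤ lam)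
    (hsu : ∀ θ : ℝ → ℝ, Continuous θ → (∀ t, 0 ≤ θ t) →
      ∫ z in parCylinder Ω T, θ z.2 * (ut z + L z) ^ 2 ≤
        4 * C ^ 2 * ((∫ z in parCylinder Ω T, θ z.2 * u z ^ 2) +
          ∫ z in parCylinder Ω T, θ z.2 * ∑ i, g i z ^ 2) +
        2 * C ^ 2 * ∫ z in parCylinder Ω T, θ z.2 * v z ^ 2)
    (hsv : ∀ θ : ℝ → ℝ, Continuous θ → (∀ t, 0 ≤ θ t) →
      ∫ z in parCylinder Ω T, θ z.2 * (vt z - Lv z) ^ 2 ≤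
        8 * C ^ 2 * ((∫ z in parCylinder Ω T, θ z.2 * u z ^ 2) +
          (∫ z in parCylinder Ω T, θ z.2 * v z ^ 2) +
          (∫ z in parCylinder Ω T, θ z.2 * ∑ i, g i z ^ 2) +
          ∫ z in parCylinder Ω T, θ z.2 * ∑ i, gv i z ^ 2) +
        2 * ρ ^ 2 * ∫ z in parCylinder Ω T, θ z.2 * L z ^ 2) :
    ((∫ z in parCylinder Ω T, carlemanWeight s lam z.2 * ut z ^ 2) +
      (∫ z in parCylinder Ω T, carlemanWeight s lam z.2 * L z ^ 2) +
      lam * (∫ z in parCylinder Ω T,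
        carlemanPhase s lam z.2 * carlemanWeight s lam z.2 * ∑ i, g i z ^ 2) +
      lam ^ 2 * (∫ z in parCylinder Ω T,
        carlemanPhase s lam z.2 ^ 2 * carlemanWeight s lam z.2 * u z ^ 2)) +
    ((∫ z in parCylinder Ω T,
        1 / carlemanPhase s lam z.2 * carlemanWeight s lam z.2 * vt z ^ 2) +
      (∫ z in parCylinder Ω T,
        1 / carlemanPhase s lam z.2 * carlemanWeight s lam z.2 * Lv z ^ 2) +
      lam * (∫ z in parCylinder Ω T, carlemanWeight s lam z.2 * ∑ i, gv i z ^ 2) +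
      lam ^ 2 * (∫ z in parCylinder Ω T,
        carlemanPhase s lam z.2 * carlemanWeight s lam z.2 * v z ^ 2) +
      (Real.exp (2 * s) * (lam * s * ∫ x in Ω, v0 x ^ 2) +
        carlemanWeight s lam T * ∑ i, ∫ x in Ω, gvT i x ^ 2)) +
    s * Real.exp (2 * s) * ((∑ i, ∫ x in Ω, g0 i x ^ 2) + lam * s * ∫ x in Ω, u0 x ^ 2) ≤
    42 * (1 + 14 * ρ ^ 2) *
      (carlemanWeight s lam T * ((∑ i, ∫ x in Ω, gT i x ^ 2) +
        lam * carlemanPhase s lam T * ∫ x in Ω, uT x ^ 2) +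
      (Real.exp (2 * s) * (∑ i, ∫ x in Ω, gv0 i x ^ 2) +
        carlemanWeight s lam T * (lam * carlemanPhase s lam T * ∫ x in Ω, vT x ^ 2))) := by
  have ea := hu.carleman_backward hΩo hΩ hru hs hlam
  have eb := hv.carleman_forward hΩo hΩ hrv hs hlam
  have ec := hu.carleman_backward_initial hΩo hT hΩ hru hs hlam
  have hPc := continuous_carlemanPhase s lam
  have hEc := continuous_carlemanWeight s lam
  have hP := carlemanPhase_pos hs lam
  have hP1 : ∀ t ∈ Ioo 0 T, 1 ≤ carlemanPhase s lam t := fun t ht =>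
    one_le_carlemanPhase hs (zero_le_one.trans hlam) ht.1.le
  have hE := carlemanWeight_pos s lam
  have hPT : 0 < carlemanPhase s lam T := hP T
  set P := carlemanPhase s lam
  set E := carlemanWeight s lam
  have hPE0 : ∀ t, 0 ≤ P t * E t := fun t => (mul_pos (hP t) (hE t)).le
  have hPPE0 : ∀ t, 0 ≤ P t ^ 2 * E t := fun t => mul_nonneg (sq_nonneg _) (hE t).le
  have hPE0' : ∀ t, 0 ≤ 1 / P t * E t := fun t => mul_nonneg (one_div_pos.2 (hP t)).le (hE t).le
  have hE_le : ∀ t ∈ Ioo 0 T, E t ≤ P t * E t := fun t ht =>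
    le_mul_of_one_le_left (hE t).le (hP1 t ht)
  have hPE_le : ∀ t ∈ Ioo 0 T, P t * E t ≤ P t ^ 2 * E t := fun t ht => by
    rw [sq, mul_assoc]; exact le_mul_of_one_le_left (hPE0 t) (hP1 t ht)
  have hsqs : ∀ (k : Fin d → SpaceTime d → ℝ) z, 0 ≤ ∑ i, k i z ^ 2 := fun k z =>
    Finset.sum_nonneg fun i _ => sq_nonneg _
  have cPE : Continuous fun t => P t * E t := by fun_prop
  have cPPE : Continuous fun t => P t ^ 2 * E t := by fun_prop
  have nn : ∀ {θ : ℝ → ℝ} {f : SpaceTime d → ℝ}, (∀ t, 0 ≤ θ t) → (∀ z, 0 ≤ f z) →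
      0 ≤ ∫ z in parCylinder Ω T, θ z.2 * f z := fun hθ hf =>
    setIntegral_nonneg_parCylinder hΩo fun z _ => mul_nonneg (hθ _) (hf z)
  have sq0 : ∀ (f : SpaceTime d → ℝ) z, 0 ≤ f z ^ 2 := fun f z => sq_nonneg _
  have iE := fun {f : SpaceTime d → ℝ} (hf : MemLp f 2 (volume.restrict (parCylinder Ω T))) =>
    integrable_time_weight_sq hΩ hf hEc
  have iPE := fun {f : SpaceTime d → ℝ} (hf : MemLp f 2 (volume.restrict (parCylinder Ω T))) =>
    integrable_time_weight_sq hΩ hf cPE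
  have iPPE := fun {f : SpaceTime d → ℝ} (hf : MemLp f 2 (volume.restrict (parCylinder Ω T))) =>
    integrable_time_weight_sq hΩ hf cPPE
  have mF := integral_time_weight_mono hΩo (sq0 fun z => ut z + L z) hE_le
    (iE (hru.memLp_dt.add hru.memLp_lap)) (iPE (hru.memLp_dt.add hru.memLp_lap))
  have mU := integral_time_weight_mono hΩo (sq0 u) hE_le (iE hru.memLp) (iPE hru.memLp)
  have mU' := integral_time_weight_mono hΩo (sq0 u) hPE_le (iPE hru.memLp) (iPPE hru.memLp)
  have mV := integral_time_weight_mono hΩo (sq0 v) hE_le (iE hrv.memLp) (iPE hrv.memLp)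
  have mG := integral_time_weight_mono hΩo (hsqs g) hE_le
    (integrable_time_weight_sum_sq hΩ hru.memLp_grad hEc)
    (integrable_time_weight_sum_sq hΩ hru.memLp_grad cPE)
  have su := hsu _ cPE hPE0
  have sv := hsv _ hEc fun t => (hE t).le
  have n1 := nn (fun t => (hE t).le) (sq0 ut)
  have n2 := nn (fun t => (hE t).le) (sq0 L)
  have n3 := nn hPE0 (hsqs g)
  have n4 := nn hPPE0 (sq0 u)
  have n5 := nn hPE0' (sq0 vt)
  have n6 := nn hPE0' (sq0 Lv)
  have n7 := nn (fun t => (hE t).le) (hsqs gv)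
  have n8 := nn hPE0 (sq0 v)
  have n9 := nn hPE0 (sq0 fun z => ut z + L z)
  have isq : ∀ f : Space d → ℝ, 0 ≤ ∫ x in Ω, f x ^ 2 := fun f =>
    integral_nonneg fun x => sq_nonneg _
  have isqs : ∀ f : Fin d → Space d → ℝ, 0 ≤ ∑ i, ∫ x in Ω, f i x ^ 2 := fun f =>
    Finset.sum_nonneg fun i _ => isq _
  have hl0 : 0 < lam := zero_lt_one.trans_le hlam
  have hs0 : 0 < s := zero_lt_one.trans_le hs
  have hexp := Real.exp_pos (2 * s)
  have n10 : 0 ≤ Real.exp (2 * s) * (lam * s * ∫ x in Ω, v0 x ^ 2) +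
      E T * ∑ i, ∫ x in Ω, gvT i x ^ 2 :=
    add_nonneg (mul_nonneg hexp.le (mul_nonneg (by positivity) (isq _)))
      (mul_nonneg (hE T).le (isqs _))
  have n11 : 0 ≤ E T * ((∑ i, ∫ x in Ω, gT i x ^ 2) + lam * P T * ∫ x in Ω, uT x ^ 2) :=
    mul_nonneg (hE T).le (add_nonneg (isqs _) (mul_nonneg (by positivity) (isq _)))
  have n12 : 0 ≤ Real.exp (2 * s) * (∑ i, ∫ x in Ω, gv0 i x ^ 2) +
      E T * (lam * P T * ∫ x in Ω, vT x ^ 2) :=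
    add_nonneg (mul_nonneg hexp.le (isqs _))
      (mul_nonneg (hE T).le (mul_nonneg (by positivity) (isq _)))
  generalize (∫ z in parCylinder Ω T, E z.2 * ut z ^ 2) = At at *
  generalize (∫ z in parCylinder Ω T, E z.2 * L z ^ 2) = AL at *
  generalize (∫ z in parCylinder Ω T, P z.2 * E z.2 * ∑ i, g i z ^ 2) = AG at *
  generalize (∫ z in parCylinder Ω T, P z.2 ^ 2 * E z.2 * u z ^ 2) = AU at *
  generalize (∫ z in parCylinder Ω T, 1 / P z.2 * E z.2 * vt z ^ 2) = Bt at *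
  generalize (∫ z in parCylinder Ω T, 1 / P z.2 * E z.2 * Lv z ^ 2) = BL at *
  generalize (∫ z in parCylinder Ω T, E z.2 * ∑ i, gv i z ^ 2) = BG at *
  generalize (∫ z in parCylinder Ω T, P z.2 * E z.2 * v z ^ 2) = BU at *
  generalize (∫ z in parCylinder Ω T, P z.2 * E z.2 * (ut z + L z) ^ 2) = F at *
  generalize (Real.exp (2 * s) * (lam * s * ∫ x in Ω, v0 x ^ 2) +
      E T * ∑ i, ∫ x in Ω, gvT i x ^ 2) = b0 at *
  generalize (E T * ((∑ i, ∫ x in Ω, gT i x ^ 2) + lam * P T * ∫ x in Ω, uT x ^ 2)) = BT at *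
  generalize (Real.exp (2 * s) * (∑ i, ∫ x in Ω, gv0 i x ^ 2) +
      E T * (lam * P T * ∫ x in Ω, vT x ^ 2)) = Bv at *
  have hC2 : 0 ≤ C ^ 2 := sq_nonneg C
  have hll : lam * AU ≤ lam ^ 2 * AU := by
    rw [sq]; exact mul_le_mul_of_nonneg_right (le_mul_of_one_le_left hl0.le hlam) n4
  have hll' : lam * BU ≤ lam ^ 2 * BU := by
    rw [sq]; exact mul_le_mul_of_nonneg_right (le_mul_of_one_le_left hl0.le hlam) n8
  have q1 := mul_nonneg hl0.le n3
  have q2 := mul_nonneg hl0.le n7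
  have q3 := mul_nonneg hl0.le n4
  have q4 := mul_nonneg hl0.le n8
  have hlow : lam * (AU + AG + BU + BG) ≤ (At + AL + lam * AG + lam ^ 2 * AU) +
      (Bt + BL + lam * BG + lam ^ 2 * BU + b0) := by linarith
  have su' : F ≤ 4 * C ^ 2 * (AU + AG + BU + BG) := by
    refine su.trans ?_
    have e1 := mul_le_mul_of_nonneg_left mU' hC2
    have e2 := mul_nonneg hC2 n8
    have e3 := mul_nonneg hC2 n7
    linarith
  have sv' := sv.trans (add_le_add_left (mul_le_mul_of_nonneg_left
    (by linarith : _ ≤ AU + AG + BU + BG) (by positivity : 0 ≤ 8 * C ^ 2)) _)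
  refine absorb_lower_order (F := F) (G := 8 * C ^ 2 * (AU + AG + BU + BG)) hC (by positivity)
    (by positivity) (by positivity) n11 n12 n9 (by positivity) hlamC ?_ ?_ ?_ ?_ ?_
  · have e1 := mul_le_mul_of_nonneg_left su' hl0.le
    have e2 := mul_le_mul_of_nonneg_left hlow (by positivity : 0 ≤ 4 * C ^ 2)
    linarith
  · have e2 := mul_le_mul_of_nonneg_left hlow (by positivity : 0 ≤ 8 * C ^ 2)
    linarith
  · linarith
  · have e1 := mul_le_mul_of_nonneg_left
      (by linarith [mul_nonneg (sq_nonneg lam) n4] : AL ≤ At + AL + lam * AG + lam ^ 2 * AU)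
      (by positivity : 0 ≤ 14 * ρ ^ 2)
    linarith
  · have e1 := mul_le_mul_of_nonneg_right hlamT (add_nonneg n3 q3)
    linarith

end Coupling

/-! ### The right-hand sides of the equations -/

section Sources

variable {d : ℕ} {Ω : Set (Space d)} {T : ℝ}

theorem norm_gradX_sq (D : Set (SpaceTime d)) (u : SpaceTime d → ℝ) (z : SpaceTime d) :
    ‖gradX D u z‖ ^ 2 = ∑ i, weakDeriv D (spaceDir i) u z ^ 2 := by
  simp [gradX, EuclideanSpace.real_norm_sq_eq]

/-- The weak gradient is the family of the given square integrable weak derivatives, up to null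
sets. -/
theorem memH1_of_hasWeakDeriv (hΩo : IsOpen Ω) {a : Space d → ℝ} {a' : Fin d → Space d → ℝ}
    (ha : MemLp a 2 (volume.restrict Ω)) (ha' : ∀ i, MemLp (a' i) 2 (volume.restrict Ω))
    (h : ∀ i, HasWeakDeriv Ω (unitVec i) a (a' i)) :
    MemH1 Ω a ∧ Integrable (fun x => ‖grad Ω a x‖ ^ 2) (volume.restrict Ω) ∧
      ∫ x in Ω, ‖grad Ω a x‖ ^ 2 = ∑ i, ∫ x in Ω, a' i x ^ 2 := by
  have hd : ∀ i, HasL2WeakDeriv Ω (unitVec i) a := fun i => ⟨a' i, ha' i, h i⟩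
  have hae : (fun x => ‖grad Ω a x‖ ^ 2) =ᵐ[volume.restrict Ω] fun x => ∑ i, a' i x ^ 2 := by
    have : ∀ᵐ x ∂(volume.restrict Ω), ∀ i, weakDeriv Ω (unitVec i) a x = a' i x :=
      ae_all_iff.2 fun i => HasWeakDeriv.ae_eq hΩo (weakDeriv_spec (hd i)).2 (h i)
        (weakDeriv_spec (hd i)).1 (ha' i)
    filter_upwards [this] with x hx
    simp [grad, EuclideanSpace.real_norm_sq_eq, hx]
  refine ⟨⟨ha, hd⟩, ?_, ?_⟩
  · exact (integrable_finsetSum _ fun i _ => (ha' i).integrable_sq).congr hae.symm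
  · rw [integral_congr_ae hae]
    exact integral_finsetSum _ fun i _ => (ha' i).integrable_sq

variable {u v f S : SpaceTime d → ℝ} {C ρ : ℝ}

/-- The right-hand side `f = Q₁(u) + S` of the backward equation is of lower order in every norm
with a weight depending on time alone; `S` enters only through its slices in `L²(Ω)`. -/
theorem integral_backward_source_le (hΩ : IsFiniteMeasure (volume.restrict Ω))
    (hu : MemH21 (parCylinder Ω T) u) (hv : MemLp v 2 (volume.restrict (parCylinder Ω T)))
    (hS : AEStronglyMeasurable S (volume.restrict (parCylinder Ω T))) (hC : 0 ≤ C)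
    (hSv : ∀ᵐ t ∂(volume.restrict (Ioo 0 T)), eLpNorm (fun x => S (x, t)) 2 (volume.restrict Ω) ≤
      ENNReal.ofReal C * eLpNorm (fun x => v (x, t)) 2 (volume.restrict Ω))
    (hf : MemLp f 2 (volume.restrict (parCylinder Ω T)))
    (hfS : ∀ᵐ z ∂(volume.restrict (parCylinder Ω T)),
      |f z - S z| ≤ C * (|u z| + ‖gradX (parCylinder Ω T) u z‖))
    (θ : ℝ → ℝ) (hθ : Continuous θ) (hθ0 : ∀ t, 0 ≤ θ t) :
    ∫ z in parCylinder Ω T, θ z.2 * f z ^ 2 ≤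
      4 * C ^ 2 * ((∫ z in parCylinder Ω T, θ z.2 * u z ^ 2) +
        ∫ z in parCylinder Ω T, θ z.2 * ∑ i, weakDeriv (parCylinder Ω T) (spaceDir i) u z ^ 2) +
      2 * C ^ 2 * ∫ z in parCylinder Ω T, θ z.2 * v z ^ 2 := by
  obtain ⟨hSm, hSle⟩ := integral_time_weight_sq_le_of_slices hΩ hS hv hC hSv
  have i1 := integrable_time_weight_sq hΩ hu.memLp hθ
  have i2 := integrable_time_weight_sum_sq hΩ (fun i => (weakDeriv_spec (hu.space_deriv i)).1) hθ
  have i3 := integrable_time_weight_sq hΩ hSm hθ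
  have hle : ∫ z in parCylinder Ω T, θ z.2 * f z ^ 2 ≤
      4 * C ^ 2 * ((∫ z in parCylinder Ω T, θ z.2 * u z ^ 2) +
        ∫ z in parCylinder Ω T, θ z.2 * ∑ i, weakDeriv (parCylinder Ω T) (spaceDir i) u z ^ 2) +
      2 * ∫ z in parCylinder Ω T, θ z.2 * S z ^ 2 := by
    have e : ∫ z in parCylinder Ω T, (4 * C ^ 2 * (θ z.2 * u z ^ 2 +
        θ z.2 * ∑ i, weakDeriv (parCylinder Ω T) (spaceDir i) u z ^ 2) +
        2 * (θ z.2 * S z ^ 2)) = _ :=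
      integral_add ((i1.add i2).const_mul _) (i3.const_mul 2)
    rw [← integral_add i1 i2, ← integral_const_mul, ← integral_const_mul]
    refine le_trans ?_ e.le
    refine integral_mono_ae (integrable_time_weight_sq hΩ hf hθ)
      (((i1.add i2).const_mul _).add (i3.const_mul 2)) ?_
    filter_upwards [hfS] with z hz
    have h1 := pow_le_pow_left₀ (abs_nonneg _) hz 2
    rw [sq_abs] at h1
    have h2 : f z ^ 2 ≤ 4 * C ^ 2 * (u z ^ 2 + ‖gradX (parCylinder Ω T) u z‖ ^ 2) +
        2 * S z ^ 2 := by
      -- `f² ≤ 2 (f - S)² + 2 S²` and `(|u| + |∇u|)² ≤ 2 (|u|² + |∇u|²)`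
      have h3 := mul_nonneg (sq_nonneg C)
        (sq_nonneg (|u z| - ‖gradX (parCylinder Ω T) u z‖))
      have h4 := sq_nonneg (f z - 2 * S z)
      rw [← sq_abs (u z)]
      linarith
    rw [norm_gradX_sq] at h2
    have h5 := mul_le_mul_of_nonneg_left h2 (hθ0 z.2)
    linarith
  have := hSle θ hθ hθ0
  linarith

/-- The right-hand side `f = Q₂(u, v) + ρ L` of the forward equation is of lower order, except for
the term `ρ L`. -/
theorem integral_forward_source_le (hΩ : IsFiniteMeasure (volume.restrict Ω))
    (hu : MemH21 (parCylinder Ω T) u) (hv : MemH21 (parCylinder Ω T) v) {L : SpaceTime d → ℝ}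
    (hL : MemLp L 2 (volume.restrict (parCylinder Ω T)))
    (hf : MemLp f 2 (volume.restrict (parCylinder Ω T)))
    (hfL : ∀ᵐ z ∂(volume.restrict (parCylinder Ω T)),
      |f z - ρ * L z| ≤ C * (|u z| + |v z| + ‖gradX (parCylinder Ω T) u z‖ +
        ‖gradX (parCylinder Ω T) v z‖))
    (θ : ℝ → ℝ) (hθ : Continuous θ) (hθ0 : ∀ t, 0 ≤ θ t) :
    ∫ z in parCylinder Ω T, θ z.2 * f z ^ 2 ≤
      8 * C ^ 2 * ((∫ z in parCylinder Ω T, θ z.2 * u z ^ 2) +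
        (∫ z in parCylinder Ω T, θ z.2 * v z ^ 2) +
        (∫ z in parCylinder Ω T,
          θ z.2 * ∑ i, weakDeriv (parCylinder Ω T) (spaceDir i) u z ^ 2) +
        ∫ z in parCylinder Ω T,
          θ z.2 * ∑ i, weakDeriv (parCylinder Ω T) (spaceDir i) v z ^ 2) +
      2 * ρ ^ 2 * ∫ z in parCylinder Ω T, θ z.2 * L z ^ 2 := by
  have i1 := integrable_time_weight_sq hΩ hu.memLp hθ
  have i2 := integrable_time_weight_sq hΩ hv.memLp hθ
  have i3 := integrable_time_weight_sum_sq hΩ (fun i => (weakDeriv_spec (hu.space_deriv i)).1) hθ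
  have i4 := integrable_time_weight_sum_sq hΩ (fun i => (weakDeriv_spec (hv.space_deriv i)).1) hθ
  have i5 := integrable_time_weight_sq hΩ hL hθ
  have i123 := (i1.add i2).add i3
  have i1234 := i123.add i4
  calc ∫ z in parCylinder Ω T, θ z.2 * f z ^ 2
      ≤ ∫ z in parCylinder Ω T, (8 * C ^ 2 * (θ z.2 * u z ^ 2 + θ z.2 * v z ^ 2 +
          θ z.2 * (∑ i, weakDeriv (parCylinder Ω T) (spaceDir i) u z ^ 2) +
          θ z.2 * ∑ i, weakDeriv (parCylinder Ω T) (spaceDir i) v z ^ 2) +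
          2 * ρ ^ 2 * (θ z.2 * L z ^ 2)) := by
        refine integral_mono_ae (integrable_time_weight_sq hΩ hf hθ)
          ((i1234.const_mul _).add (i5.const_mul _)) ?_
        filter_upwards [hfL] with z hz
        have h1 := pow_le_pow_left₀ (abs_nonneg _) hz 2
        rw [sq_abs] at h1
        have h2 : f z ^ 2 ≤ 8 * C ^ 2 * (u z ^ 2 + v z ^ 2 +
            ‖gradX (parCylinder Ω T) u z‖ ^ 2 + ‖gradX (parCylinder Ω T) v z‖ ^ 2) +
            2 * ρ ^ 2 * L z ^ 2 := by
          rw [← sq_abs (u z), ← sq_abs (v z)]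
          generalize |u z| = a at *
          generalize |v z| = b at *
          generalize ‖gradX (parCylinder Ω T) u z‖ = m at *
          generalize ‖gradX (parCylinder Ω T) v z‖ = n at *
          have h3 := mul_nonneg (sq_nonneg C) (sq_nonneg (a - b))
          have h4 := mul_nonneg (sq_nonneg C) (sq_nonneg (a - m))
          have h5 := mul_nonneg (sq_nonneg C) (sq_nonneg (a - n))
          have h6 := mul_nonneg (sq_nonneg C) (sq_nonneg (b - m))
          have h7 := mul_nonneg (sq_nonneg C) (sq_nonneg (b - n))
          have h8 := mul_nonneg (sq_nonneg C) (sq_nonneg (m - n))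
          have h9 := sq_nonneg (f z - 2 * (ρ * L z))
          linarith
        rw [norm_gradX_sq, norm_gradX_sq] at h2
        have h5 := mul_le_mul_of_nonneg_left h2 (hθ0 z.2)
        linarith
    _ = _ := by
        rw [integral_add, integral_const_mul, integral_const_mul, integral_add, integral_add,
          integral_add]
        exacts [i1, i2, i1.add i2, i3, i123, i4, i1234.const_mul _, i5.const_mul _]

/-- The integral over `Q` on the left of the Carleman estimate, split into its terms. -/
theorem integral_weighted_sum (hΩ : IsFiniteMeasure (volume.restrict Ω))
    (hru : IsNeumannRegular Ω T u (dt (parCylinder Ω T) u) (laplacianX (parCylinder Ω T) u)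
      fun i => weakDeriv (parCylinder Ω T) (spaceDir i) u)
    (hrv : IsNeumannRegular Ω T v (dt (parCylinder Ω T) v) (laplacianX (parCylinder Ω T) v)
      fun i => weakDeriv (parCylinder Ω T) (spaceDir i) v) {s : ℝ} (hs : 1 ≤ s) (lam : ℝ) :
    ∫ z in parCylinder Ω T, ((dt (parCylinder Ω T) u z) ^ 2 + (laplacianX (parCylinder Ω T) u z) ^ 2
        + s * lam * weight lam z.2 * ‖gradX (parCylinder Ω T) u z‖ ^ 2
        + s ^ 2 * lam ^ 2 * (weight lam z.2) ^ 2 * (u z) ^ 2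
        + 1 / (s * weight lam z.2) *
            ((dt (parCylinder Ω T) v z) ^ 2 + (laplacianX (parCylinder Ω T) v z) ^ 2)
        + lam * ‖gradX (parCylinder Ω T) v z‖ ^ 2
        + s * lam ^ 2 * weight lam z.2 * (v z) ^ 2) * Real.exp (2 * s * weight lam z.2) =
      (∫ z in parCylinder Ω T, carlemanWeight s lam z.2 * dt (parCylinder Ω T) u z ^ 2) +
      (∫ z in parCylinder Ω T, carlemanWeight s lam z.2 * laplacianX (parCylinder Ω T) u z ^ 2) +
      lam * (∫ z in parCylinder Ω T, carlemanPhase s lam z.2 * carlemanWeight s lam z.2 *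
        ∑ i, weakDeriv (parCylinder Ω T) (spaceDir i) u z ^ 2) +
      lam ^ 2 * (∫ z in parCylinder Ω T,
        carlemanPhase s lam z.2 ^ 2 * carlemanWeight s lam z.2 * u z ^ 2) +
      (∫ z in parCylinder Ω T,
        1 / carlemanPhase s lam z.2 * carlemanWeight s lam z.2 * dt (parCylinder Ω T) v z ^ 2) +
      (∫ z in parCylinder Ω T,
        1 / carlemanPhase s lam z.2 * carlemanWeight s lam z.2 *
          laplacianX (parCylinder Ω T) v z ^ 2) +
      lam * (∫ z in parCylinder Ω T, carlemanWeight s lam z.2 *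
        ∑ i, weakDeriv (parCylinder Ω T) (spaceDir i) v z ^ 2) +
      lam ^ 2 * (∫ z in parCylinder Ω T,
        carlemanPhase s lam z.2 * carlemanWeight s lam z.2 * v z ^ 2) := by
  have hPc := continuous_carlemanPhase s lam
  have hEc := continuous_carlemanWeight s lam
  have hPE := continuous_carlemanWeight_div_phase hs lam
  have j1 := integrable_time_weight_sq hΩ hru.memLp_dt hEc
  have j2 := integrable_time_weight_sq hΩ hru.memLp_lap hEc
  have j3 := (integrable_time_weight_sum_sq hΩ hru.memLp_grad
    (θ := fun t => carlemanPhase s lam t * carlemanWeight s lam t) (by fun_prop)).const_mul lam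
  have j4 := (integrable_time_weight_sq hΩ hru.memLp
    (θ := fun t => carlemanPhase s lam t ^ 2 * carlemanWeight s lam t)
    (by fun_prop)).const_mul (lam ^ 2)
  have j5 := integrable_time_weight_sq hΩ hrv.memLp_dt hPE
  have j6 := integrable_time_weight_sq hΩ hrv.memLp_lap hPE
  have j7 := (integrable_time_weight_sum_sq hΩ hrv.memLp_grad hEc).const_mul lam
  have j8 := (integrable_time_weight_sq hΩ hrv.memLp
    (θ := fun t => carlemanPhase s lam t * carlemanWeight s lam t)
    (by fun_prop)).const_mul (lam ^ 2)
  have k2 := j1.add j2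
  have k3 := k2.add j3
  have k4 := k3.add j4
  have k5 := k4.add j5
  have k6 := k5.add j6
  have k7 := k6.add j7
  have e : ∀ z : SpaceTime d, ((dt (parCylinder Ω T) u z) ^ 2
        + (laplacianX (parCylinder Ω T) u z) ^ 2
        + s * lam * weight lam z.2 * ‖gradX (parCylinder Ω T) u z‖ ^ 2
        + s ^ 2 * lam ^ 2 * (weight lam z.2) ^ 2 * (u z) ^ 2
        + 1 / (s * weight lam z.2) *
            ((dt (parCylinder Ω T) v z) ^ 2 + (laplacianX (parCylinder Ω T) v z) ^ 2)
        + lam * ‖gradX (parCylinder Ω T) v z‖ ^ 2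
        + s * lam ^ 2 * weight lam z.2 * (v z) ^ 2) * Real.exp (2 * s * weight lam z.2) =
      carlemanWeight s lam z.2 * dt (parCylinder Ω T) u z ^ 2 +
      carlemanWeight s lam z.2 * laplacianX (parCylinder Ω T) u z ^ 2 +
      lam * (carlemanPhase s lam z.2 * carlemanWeight s lam z.2 *
        ∑ i, weakDeriv (parCylinder Ω T) (spaceDir i) u z ^ 2) +
      lam ^ 2 * (carlemanPhase s lam z.2 ^ 2 * carlemanWeight s lam z.2 * u z ^ 2) +
      1 / carlemanPhase s lam z.2 * carlemanWeight s lam z.2 * dt (parCylinder Ω T) v z ^ 2 +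
      1 / carlemanPhase s lam z.2 * carlemanWeight s lam z.2 *
        laplacianX (parCylinder Ω T) v z ^ 2 +
      lam * (carlemanWeight s lam z.2 *
        ∑ i, weakDeriv (parCylinder Ω T) (spaceDir i) v z ^ 2) +
      lam ^ 2 * (carlemanPhase s lam z.2 * carlemanWeight s lam z.2 * v z ^ 2) := fun z => by
    rw [norm_gradX_sq, norm_gradX_sq, carlemanPhase, carlemanWeight]
    ring
  simp_rw [e]
  rw [integral_add, integral_add, integral_add, integral_add, integral_add, integral_add,
    integral_add, integral_const_mul, integral_const_mul, integral_const_mul, integral_const_mul]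
  exacts [j1, j2, k2, j3, k3, j4, k4, j5, k5, j6, k6, j7, k7, j8]

end Sources

end MeanField

open MeanField

theorem theorem2p1 {d : ℕ} (hd : 1 ≤ d) (Ω : Set (Space d)) (hΩ : IsSmoothBoundedDomain Ω)
    (T : ℝ) (hT : 0 < T) (ρ₀ : ℝ) (C₀ : ℝ) (hC₀ : 0 < C₀) :
    ∃ C s₀ lam₀ : ℝ, 0 < C ∧ 0 < s₀ ∧ 0 < lam₀ ∧
      ∀ (Q₁ : (SpaceTime d → ℝ) → SpaceTime d → ℝ)
        (Q₂ : (SpaceTime d → ℝ) → (SpaceTime d → ℝ) → SpaceTime d → ℝ)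
        (S : (SpaceTime d → ℝ) → SpaceTime d → ℝ),
      BoundQ₁ (parCylinder Ω T) C₀ Q₁ →
      BoundQ₂ (parCylinder Ω T) C₀ Q₂ →
      (BoundSPointwise (parCylinder Ω T) C₀ S ∨ BoundSL2 Ω T C₀ S) →
      ∀ u v : SpaceTime d → ℝ,
      MemH21 (parCylinder Ω T) u → MemH21 (parCylinder Ω T) v →
      (∀ᵐ z ∂(volume.restrict (parCylinder Ω T)),
        dt (parCylinder Ω T) u z + laplacianX (parCylinder Ω T) u z = Q₁ u z + S v z) →
      (∀ᵐ z ∂(volume.restrict (parCylinder Ω T)),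
        dt (parCylinder Ω T) v z - laplacianX (parCylinder Ω T) v z =
          Q₂ u v z + ρ₀ * laplacianX (parCylinder Ω T) u z) →
      NeumannZero Ω T u → NeumannZero Ω T v →
      ∃ u0 uT v0 vT : Space d → ℝ,
        MemH1 Ω u0 ∧ MemH1 Ω uT ∧ MemH1 Ω v0 ∧ MemH1 Ω vT ∧
        HasTimeTraces Ω T u u0 uT ∧ HasTimeTraces Ω T v v0 vT ∧
        ∀ s lam : ℝ, s₀ ≤ s → lam₀ ≤ lam →
          (∫ z in parCylinder Ω T,
              ((dt (parCylinder Ω T) u z) ^ 2 + (laplacianX (parCylinder Ω T) u z) ^ 2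
                + s * lam * weight lam z.2 * ‖gradX (parCylinder Ω T) u z‖ ^ 2
                + s ^ 2 * lam ^ 2 * (weight lam z.2) ^ 2 * (u z) ^ 2
                + 1 / (s * weight lam z.2) *
                    ((dt (parCylinder Ω T) v z) ^ 2 + (laplacianX (parCylinder Ω T) v z) ^ 2)
                + lam * ‖gradX (parCylinder Ω T) v z‖ ^ 2
                + s * lam ^ 2 * weight lam z.2 * (v z) ^ 2)
              * Real.exp (2 * s * weight lam z.2))
            + (∫ x in Ω,
                (s ^ 2 * lam * (u0 x) ^ 2 + s * ‖grad Ω u0 x‖ ^ 2) * Real.exp (2 * s))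
            + (∫ x in Ω,
                (s * lam * (v0 x) ^ 2 * Real.exp (2 * s)
                  + ‖grad Ω vT x‖ ^ 2 * Real.exp (2 * s * weight lam T)))
          ≤ C * (∫ x in Ω,
                (s * lam * weight lam T * (vT x) ^ 2 * Real.exp (2 * s * weight lam T)
                  + ‖grad Ω v0 x‖ ^ 2 * Real.exp (2 * s)))
            + C * (∫ x in Ω,
                (s * lam ^ 2 * (weight lam T) ^ 2 * (uT x) ^ 2
                  + s * weight lam T * ‖grad Ω uT x‖ ^ 2)
                * Real.exp (2 * s * weight lam T)) := by
  have hfin := isFiniteMeasure_restrict hΩ.isBounded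
  have hΩo := hΩ.isOpen
  -- `λ ≥ 1/T` serves the initial values of `u`, the last summand of `λ₀` the absorption
  refine ⟨42 * (1 + 14 * ρ₀ ^ 2), 1, 1 + 1 / T + 2 * ((1 + 14 * ρ₀ ^ 2) * 12 + 56) * C₀ ^ 2,
    by positivity, one_pos, by positivity, ?_⟩
  intro Q₁ Q₂ S hQ₁ hQ₂ hS u v hu hv hequ heqv hνu hνv
  have hru := hu.isNeumannRegular hΩ hνu
  have hrv := hv.isNeumannRegular hΩ hνv
  obtain ⟨u0, uT, g0, gT, hEu⟩ := hru.exists_traces hΩo hfin hT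
  obtain ⟨v0, vT, gv0, gvT, hEv⟩ := hrv.exists_traces hΩo hfin hT
  obtain ⟨hu0, iu0, eu0⟩ := memH1_of_hasWeakDeriv hΩo hEu.memLp_zero hEu.memLp_grad_zero
    hEu.hasWeakDeriv_zero
  obtain ⟨huT, iuT, euT⟩ := memH1_of_hasWeakDeriv hΩo hEu.memLp_end hEu.memLp_grad_end
    hEu.hasWeakDeriv_end
  obtain ⟨hv0, iv0, ev0⟩ := memH1_of_hasWeakDeriv hΩo hEv.memLp_zero hEv.memLp_grad_zero
    hEv.hasWeakDeriv_zero
  obtain ⟨hvT, ivT, evT⟩ := memH1_of_hasWeakDeriv hΩo hEv.memLp_end hEv.memLp_grad_end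
    hEv.hasWeakDeriv_end
  refine ⟨u0, uT, v0, vT, hu0, huT, hv0, hvT, hEu.integral_test, hEv.integral_test, ?_⟩
  intro s lam hs hlam
  have hT1 : 0 < 1 / T := by positivity
  have hm : 0 ≤ 2 * ((1 + 14 * ρ₀ ^ 2) * 12 + 56) * C₀ ^ 2 := by positivity
  have hlam1 : 1 ≤ lam := by linarith
  have hlam0 : 0 < lam := by linarith
  have hs0 : 0 < s := by linarith
  have hSm : AEStronglyMeasurable (S v) (volume.restrict (parCylinder Ω T)) :=
    hS.elim (fun h => (h v hv).1) (fun h => (h v hv).1)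
  have hSv : ∀ᵐ t ∂(volume.restrict (Ioo 0 T)),
      eLpNorm (fun x => S v (x, t)) 2 (volume.restrict Ω) ≤
        ENNReal.ofReal C₀ * eLpNorm (fun x => v (x, t)) 2 (volume.restrict Ω) :=
    hS.elim (fun h => eLpNorm_slice_le_of_pointwise (h v hv).2) (fun h => (h v hv).2)
  -- the equations turn the bounds on `Q₁`, `Q₂` and `S` into bounds on `∂ₜu + Δu` and `∂ₜv - Δv`
  have key := coupled_carleman (ρ := ρ₀) hΩo hT hfin hru hEu hrv hEv hC₀ hs hlam1 (by linarith)
    (by linarith)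
    (integral_backward_source_le hfin hu hv.memLp hSm hC₀.le hSv
      (hru.memLp_dt.add hru.memLp_lap) (by
        filter_upwards [hequ, (hQ₁ u hu).2] with z h1 h2
        rwa [h1, add_sub_cancel_right]))
    (integral_forward_source_le hfin hu hv hru.memLp_lap (hrv.memLp_dt.sub hrv.memLp_lap) (by
      filter_upwards [heqv, (hQ₂ u v hu hv).2] with z h1 h2
      rwa [h1, add_sub_cancel_right]))
  have e2 : ∫ x in Ω, (s ^ 2 * lam * (u0 x) ^ 2 + s * ‖grad Ω u0 x‖ ^ 2) * Real.exp (2 * s) =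
      s * Real.exp (2 * s) * ((∑ i, ∫ x in Ω, g0 i x ^ 2) + lam * s * ∫ x in Ω, u0 x ^ 2) := by
    rw [integral_mul_const, integral_add (hu0.memLp.integrable_sq.const_mul _) (iu0.const_mul s),
      integral_const_mul, integral_const_mul, eu0]
    ring
  have e3 : ∫ x in Ω, (s * lam * (v0 x) ^ 2 * Real.exp (2 * s)
        + ‖grad Ω vT x‖ ^ 2 * Real.exp (2 * s * weight lam T)) =
      Real.exp (2 * s) * (lam * s * ∫ x in Ω, v0 x ^ 2) +
        carlemanWeight s lam T * ∑ i, ∫ x in Ω, gvT i x ^ 2 := by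
    rw [integral_add ((hv0.memLp.integrable_sq.const_mul _).mul_const _) (ivT.mul_const _),
      integral_mul_const, integral_mul_const, integral_const_mul, evT, carlemanWeight]
    ring
  have e4 : ∫ x in Ω, (s * lam * weight lam T * (vT x) ^ 2 * Real.exp (2 * s * weight lam T)
        + ‖grad Ω v0 x‖ ^ 2 * Real.exp (2 * s)) =
      Real.exp (2 * s) * (∑ i, ∫ x in Ω, gv0 i x ^ 2) +
        carlemanWeight s lam T * (lam * carlemanPhase s lam T * ∫ x in Ω, vT x ^ 2) := by
    rw [integral_add ((hvT.memLp.integrable_sq.const_mul _).mul_const _) (iv0.mul_const _),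
      integral_mul_const, integral_mul_const, integral_const_mul, ev0, carlemanWeight,
      carlemanPhase]
    ring
  -- the factors `λ φ(T)` and `s φ(T)` to spare on the right are at least `1`
  have e5 : carlemanWeight s lam T * ((∑ i, ∫ x in Ω, gT i x ^ 2) +
        lam * carlemanPhase s lam T * ∫ x in Ω, uT x ^ 2) ≤
      ∫ x in Ω, (s * lam ^ 2 * (weight lam T) ^ 2 * (uT x) ^ 2
        + s * weight lam T * ‖grad Ω uT x‖ ^ 2) * Real.exp (2 * s * weight lam T) := by
    rw [integral_mul_const, integral_add (huT.memLp.integrable_sq.const_mul _) (iuT.const_mul _),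
      integral_const_mul, integral_const_mul, euT, mul_comm, carlemanWeight, carlemanPhase,
      add_comm]
    have hw := one_le_weight hlam0.le hT.le
    refine mul_le_mul_of_nonneg_right (add_le_add ?_ ?_) (Real.exp_pos _).le
    · refine mul_le_mul_of_nonneg_right ?_ (integral_nonneg fun x => sq_nonneg _)
      have h1 : 1 ≤ lam * weight lam T := one_le_mul_of_one_le_of_one_le hlam1 hw
      have h2 : 0 ≤ s * lam * weight lam T := by positivity
      linarith [mul_le_mul_of_nonneg_left h1 h2]
    · exact le_mul_of_one_le_left
        (Finset.sum_nonneg fun i _ => integral_nonneg fun x => sq_nonneg _)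
        (one_le_mul_of_one_le_of_one_le hs hw)
  rw [integral_weighted_sum hfin hru hrv hs, e2, e3, e4]
  have e6 := mul_le_mul_of_nonneg_left e5 (by positivity : 0 ≤ 42 * (1 + 14 * ρ₀ ^ 2))
  linarith
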